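/- **Setting.** Let $(\Omega,\mathscr F,\mathbb P)$ be a probability space and $\Phi=\Phi_1:\Omega\to\Omega$ an invertible, bimeasurable, $\mathbb P$-preserving map (e.g. the time-one Wiener shift). Let $\mathbb T^m=\mathbb R^m/\mathbb Z^m$, $\alpha\in\mathbb R^m$, $r\in\mathbb N=\{0,1,2,\dots\}$, and let $U\subset\mathbb R^{2d}$ be open. Random maps and sections that agree for almost every (a.e.) $\omega$ are identified. * $\Sigma_{r,1}=\{(i,j)\in\mathbb N^2: i\le r,\ i+j\le r+1\}$. $\mathcal L^\infty(C^{\Sigma_{r,1}})$ is the space of jointly measurable $F:U\times\mathbb T^m\times\Omega\to\mathbb R^{2d}$ such that, for a.e. $\omega$ and all $(i,j)\in\Sigma_{r,1}$, $D_\theta^iD_z^jF(\cdot,\cdot,\omega)$ exists and is continuous on $U\times\mathbb T^m$, and such that, with constants not depending on $\omega$ (off a null set), these derivatives are bounded and have a common modulus of continuity in $z$: there is $\rho$ with $\rho(t)\to0$ as $t\to0^+$ and $|D_\theta^iD_z^jF(z,\theta,\omega)-D_\theta^iD_z^jF(w,\theta,\omega)|\le\rho(|z-w|)$ whenever the segment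 $[z,w]$ lies in $U$. Its norm is the essential supremum over $\omega$ of $\sup_{(i,j)\in\Sigma_{r,1},\,z\in U,\,\theta}|D_\theta^iD_z^jF(z,\theta,\omega)|$. * $\mathcal L^\infty(C^r)$ is the space of jointly measurable $\kappa:\mathbb T^m\times\Omega\to V$ ($V=\mathbb R^{2d}$ or $\mathbb C^{2d}$) that are $C^r$ in $\theta$ for a.e. $\omega$, with finite norm $\|\kappa\|_{\mathcal L^\infty(C^r)}=\operatorname{ess\,sup}_\omega\sup_{i\le r,\theta}|D^i_\theta\kappa(\theta,\omega)|$. * For $K:\mathbb T^m\times\Omega\to U$ put $M_K(\theta,\omega)=D_zF(K(\theta,\omega),\theta,\omega)$; its transfer operator, acting on complex sections, is $\mathscr M_K[\kappa](\theta,\omega)=M_K(\theta-\alpha,\Phi^{-1}\omega)\,\kappa(\theta-\alpha,\Phi^{-1}\omega)$. The cocycle of $M=M_K$ is $M(\theta,\omega,N)=M(\theta+(N-1)\alpha,\Phi^{N-1}\omega)\cdots M(\theta,\omega)$ for $N>0$, $\mathrm{Id}$ for $N=0$, and $M(\theta+N\alpha,\Phi^{N}\omega)^{-1}\cdots M(\theta-\alpha,\Phi^{-1}\omega)^{-1}$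 for $N<0$. * The random invariance equation for $F$ is $$F(K(\theta,\omega),\theta,\omega)=K(\theta+\alpha,\Phi\omega)\quad\text{for a.e. }\omega\text{ and all }\theta.\tag{1}$$ **Theorem.** Let $c_H,\delta>0$, $A,B\in\mathbb R$ and a modulus $\rho$ ($\rho(t)\to0$ as $t\to0^+$) be given. There are $\epsilon_0,C,\eta>0$, depending only on the setting $(\Omega,\mathbb P,\Phi,d,m,r,\alpha,U)$ and on $c_H,\delta,A,B,\rho$, such that the following holds for all $0<\epsilon<\epsilon_0$. Let $F\in\mathcal L^\infty(C^{\Sigma_{r,1}})$ have norm at most $A$ and modulus of continuity $\rho$ as above, and let $F(\cdot,\theta,\omega)$ be a $C^1$ local diffeomorphism on $U$ for a.e. $\omega$ and all $\theta$. Let $K_*\in\mathcal L^\infty(C^r)$ have values in $\mathbb R^{2d}$, norm at most $B$, and satisfy: for a.e. $\omega$ and all $\theta$, the closed ball of radius $\delta$ about $K_*(\theta,\omega)$ lies in $U$. Assume 1. $\|F(K_*(\theta,\omega),\theta,\omega)-K_*(\theta+\alpha,\Phi\omega)\|_{\mathcal L^\infty(C^r)}<\epsilon$; 2. for every $y\in\mathbb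 C$ with $|y|=1$, $\mathscr M_{K_*}-y\,\mathrm{Id}$ is invertible on $\mathcal L^\infty(C^r)$ (complex sections) and $\|(\mathscr M_{K_*}-y\,\mathrm{Id})^{-1}\|\le c_H$. Then there is $K_\epsilon\in\mathcal L^\infty(C^r)$ such that: * **(a) Existence.** $K_\epsilon$ takes values in $U$ (a.e. $\omega$), solves (1), and $\|K_\epsilon-K_*\|_{\mathcal L^\infty(C^r)}\le C\epsilon$. * **(b) Uniqueness.** $\|K_\epsilon-K_*\|_{\mathcal L^\infty(C^0)}<\eta$, and every $U$-valued solution $K\in\mathcal L^\infty(C^0)$ of (1) with $\|K-K_*\|_{\mathcal L^\infty(C^0)}<\eta$ equals $K_\epsilon$. * **(c) Persistence.** There are $s>0$ and a map $\mathcal K$, continuously (Fréchet) differentiable from the ball of radius $s$ about $F$ in $\mathcal L^\infty(C^{\Sigma_{r,1}})$ to $\mathcal L^\infty(C^r)$, with $\mathcal K(F)=K_\epsilon$, such that for each $G$ in this ball $\mathcal K(G)$ is a $U$-valued solution of (1) for $G$, has $\mathcal L^\infty(C^0)$-distance less than $\eta$ from $K_*$, and is the only $U$-valued $\mathcal L^\infty(C^0)$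 solution for $G$ at such a distance. * **(d) Normal hyperbolicity.** For a suitable representative $K_\epsilon$, $\mathcal K_\epsilon(\omega)=\{(K_\epsilon(\theta,\omega),\theta):\theta\in\mathbb T^m\}$ is a random set in $\mathbb R^{2d}\times\mathbb T^m$, and $\{K_\epsilon(\theta,\omega):\theta\in\mathbb T^m\}$ is a random set in $\mathbb R^{2d}$ (i.e. nonempty closed sets whose distance to each fixed point is measurable in $\omega$). The torus is normally hyperbolic: with $M=M_{K_\epsilon}$ there are measurable $C(\omega)$, $\lambda_S(\omega)$, $\lambda_U(\omega)$ and, for a.e. $\omega$ and all $\theta$, a splitting $\mathbb R^{2d}=\mathscr E^S(\theta,\omega)\oplus\mathscr E^U(\theta,\omega)$ whose projections are jointly measurable and $C^r$ in $\theta$, such that for a.e. $\omega$ and all $\theta$: $C(\omega)>0$, $0<\lambda_S(\omega)<1<\lambda_U(\omega)$; $M(\theta,\omega)$ is invertible and maps $\mathscr E^{S}(\theta,\omega)$ onto $\mathscr E^{S}(\theta+\alpha,\Phi\omega)$ and $\mathscr E^U(\theta,\omega)$ onto $\mathscr E^U(\theta+\alpha,\Phi\omega)$; $v\in\mathscr E^S(\theta,\omega)$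 iff $|M(\theta,\omega,N)v|\le C(\omega)\lambda_S(\omega)^N|v|$ for all integers $N\ge0$; and $v\in\mathscr E^U(\theta,\omega)$ iff $|M(\theta,\omega,N)v|\le C(\omega)\lambda_U(\omega)^N|v|$ for all integers $N\le0$. -/

import Mathlib

open MeasureTheory Filter Topology Set
open scoped ENNReal

noncomputable section

namespace RandomTorus

/-! ### Phase space, torus, mixed derivatives -/

/-- The Euclidean space `ℝⁿ`. -/
abbrev Eu (n : ℕ) : Type := EuclideanSpace ℝ (Fin n)

/-- The Euclidean space `ℂⁿ`, the complexification of `Eu n`. -/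
abbrev EuC (n : ℕ) : Type := EuclideanSpace ℂ (Fin n)

/-- The torus `𝕋ᵐ = ℝᵐ / ℤᵐ`. -/
abbrev Torus (m : ℕ) : Type := UnitAddTorus (Fin m)

/-- The covering map `ℝᵐ → 𝕋ᵐ`. -/
def toTorus {m : ℕ} (x : Eu m) : Torus m := fun k => ((x k : ℝ) : UnitAddCircle)

/-- The space of values of `D_θ^i D_z^j`: `i`-linear maps on `ℝᵐ` with values in the `j`-linear maps
from `E` to `V`, with the operator norms. -/
abbrev MixedForm (E V : Type*) [NormedAddCommGroup E] [NormedSpace ℝ E]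
    [NormedAddCommGroup V] [NormedSpace ℝ V] (m i j : ℕ) : Type _ :=
  ContinuousMultilinearMap ℝ (fun _ : Fin i => Eu m)
    (ContinuousMultilinearMap ℝ (fun _ : Fin j => E) V)

/-- `D_θ^i D_z^j f (z, θ)` at the angle `θ = toTorus x`; derivatives on the torus are computed
on its universal cover `ℝᵐ`. -/
def mixedDeriv {E V : Type*} [NormedAddCommGroup E] [NormedSpace ℝ E]
    [NormedAddCommGroup V] [NormedSpace ℝ V] {m : ℕ} (i j : ℕ) (f : E → Torus m → V)
    (z : E) (x : Eu m) : MixedForm E V m i j :=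
  iteratedFDeriv ℝ i
    (fun x' : Eu m => iteratedFDeriv ℝ j (fun z' : E => f z' (toTorus x')) z) x

/-- `D_θ^i κ (θ)` at the angle `θ = toTorus x`. -/
def torusDeriv {V : Type*} [NormedAddCommGroup V] [NormedSpace ℝ V] {m : ℕ} (i : ℕ)
    (κ : Torus m → V) (x : Eu m) : ContinuousMultilinearMap ℝ (fun _ : Fin i => Eu m) V :=
  iteratedFDeriv ℝ i (fun x' : Eu m => κ (toTorus x')) x

/-- The index set `Σ_{r,s} = {(i, j) | i ≤ r, i + j ≤ r + s}`. -/
def sigmaSet (r s : ℕ) : Set (ℕ × ℕ) := {p | p.1 ≤ r ∧ p.1 + p.2 ≤ r + s}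

/-! ### Auxiliary norm inequalities -/

theorem enorm_add_le_of {W : Type*} [NormedAddCommGroup W] {a b : W} {s t : ℝ≥0∞}
    (ha : ‖a‖ₑ ≤ s) (hb : ‖b‖ₑ ≤ t) : ‖a + b‖ₑ ≤ s + t :=
  (enorm_add_le a b).trans (add_le_add ha hb)

theorem enorm_zero_le (W : Type*) [NormedAddCommGroup W] : ‖(0 : W)‖ₑ ≤ 0 := enorm_zero.le

theorem enorm_smul_le_of {W : Type*} [NormedAddCommGroup W] [NormedSpace ℝ W] (c : ℝ) {a : W}
    {s : ℝ≥0∞} (ha : ‖a‖ₑ ≤ s) : ‖c • a‖ₑ ≤ ‖c‖ₑ * s := by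
  rw [enorm_smul]
  gcongr

theorem norm_add_sub_le_of {W : Type*} [NormedAddCommGroup W] {a b a' b' : W} {s t : ℝ}
    (ha : ‖a - a'‖ ≤ s) (hb : ‖b - b'‖ ≤ t) : ‖a + b - (a' + b')‖ ≤ s + t := by
  rw [add_sub_add_comm]
  exact (norm_add_le _ _).trans (add_le_add ha hb)

theorem norm_smul_sub_le_of {W : Type*} [NormedAddCommGroup W] [NormedSpace ℝ W] (c : ℝ)
    {a a' : W} {s : ℝ} (ha : ‖a - a'‖ ≤ s) : ‖c • a - c • a'‖ ≤ ‖c‖ * s := by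
  rw [← smul_sub, norm_smul]
  exact mul_le_mul_of_nonneg_left ha (norm_nonneg c)

theorem continuousOn_smul_of {W X : Type*} [TopologicalSpace X] [NormedAddCommGroup W]
    [NormedSpace ℝ W] (c : ℝ) {f : X → W} {s : Set X} (hf : ContinuousOn f s) :
    ContinuousOn (fun x => c • f x) s := hf.const_smul c

/-! ### Random sections: the space `L^∞(Ω, C^r(𝕋ᵐ, V))` -/

section Sections

variable {Ω : Type*} [MeasurableSpace Ω] (P : Measure Ω)
  {V : Type*} [NormedAddCommGroup V] [NormedSpace ℝ V]

/-- `‖κ‖_{L^∞(C^r)}`, the essential supremum over `ω` of `sup_{i ≤ r, θ} |D_θ^i κ(θ, ω)|`,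
as an extended non-negative number. -/
def secENorm {m : ℕ} (r : ℕ) (κ : Torus m → Ω → V) : ℝ≥0∞ :=
  essSup (fun ω => ⨆ i : ℕ, ⨆ _ : i ≤ r, ⨆ x : Eu m, ‖torusDeriv i (fun θ => κ θ ω) x‖ₑ) P

variable {P} in
theorem secENorm_zero {m r : ℕ} : secENorm P r (fun (_ : Torus m) (_ : Ω) => (0 : V)) = 0 := by
  refine le_antisymm ?_ bot_le
  refine essSup_le_of_ae_le _ (Eventually.of_forall fun ω => ?_)
  refine iSup_le fun i => iSup_le fun hi => iSup_le fun x => ?_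
  have e : torusDeriv i (fun _ : Torus m => (0 : V)) x = 0 :=
    congrFun (iteratedFDeriv_fun_zero (𝕜 := ℝ) (E := Eu m) (F := V) (n := i)) x
  rw [e]
  exact enorm_zero_le (ContinuousMultilinearMap ℝ (fun _ : Fin i => Eu m) V)

variable [MeasurableSpace V]

/-- `κ` is an `L^∞(C^r)` random section: jointly measurable, of class `C^r` in `θ` for almost
every `ω`, with derivatives up to order `r` bounded, essentially uniformly in `ω`. -/
structure IsRandomSection {m : ℕ} (r : ℕ) (κ : Torus m → Ω → V) : Prop where
  meas : Measurable fun p : Torus m × Ω => κ p.1 p.2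
  smooth : ∀ᵐ ω ∂P, ContDiff ℝ r fun x : Eu m => κ (toTorus x) ω
  bdd : secENorm P r κ ≠ ∞

variable {P}

theorem secENorm_add_le {m r : ℕ} {κ μ : Torus m → Ω → V} (hκ : IsRandomSection P r κ)
    (hμ : IsRandomSection P r μ) :
    secENorm P r (fun θ ω => κ θ ω + μ θ ω) ≤ secENorm P r κ + secENorm P r μ := by
  refine le_trans (essSup_mono_ae ?_) (ENNReal.essSup_add_le _ _)
  filter_upwards [hκ.smooth, hμ.smooth] with ω h1 h2
  refine iSup_le fun i => iSup_le fun hi => iSup_le fun x => ?_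
  have hi' : ((i : ℕ∞) : WithTop ℕ∞) ≤ r := by exact_mod_cast hi
  have e : torusDeriv i (fun θ => κ θ ω + μ θ ω) x
      = torusDeriv i (fun θ => κ θ ω) x + torusDeriv i (fun θ => μ θ ω) x :=
    iteratedFDeriv_add_apply (h1.of_le hi').contDiffAt (h2.of_le hi').contDiffAt
  rw [e]
  refine enorm_add_le_of (W := ContinuousMultilinearMap ℝ (fun _ : Fin i => Eu m) V) ?_ ?_
  · exact le_iSup_of_le i (le_iSup_of_le hi (le_iSup_of_le x le_rfl))
  · exact le_iSup_of_le i (le_iSup_of_le hi (le_iSup_of_le x le_rfl))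

theorem secENorm_smul_le {m r : ℕ} (c : ℝ) {κ : Torus m → Ω → V}
    (hκ : IsRandomSection P r κ) :
    secENorm P r (fun θ ω => c • κ θ ω) ≤ ‖c‖ₑ * secENorm P r κ := by
  rw [secENorm, secENorm, ← ENNReal.essSup_const_mul]
  refine essSup_mono_ae ?_
  filter_upwards [hκ.smooth] with ω h1
  refine iSup_le fun i => iSup_le fun hi => iSup_le fun x => ?_
  have hi' : ((i : ℕ∞) : WithTop ℕ∞) ≤ r := by exact_mod_cast hi
  have e : torusDeriv i (fun θ => c • κ θ ω) x = c • torusDeriv i (fun θ => κ θ ω) x :=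
    iteratedFDeriv_const_smul_apply (h1.of_le hi').contDiffAt
  rw [e]
  refine enorm_smul_le_of (W := ContinuousMultilinearMap ℝ (fun _ : Fin i => Eu m) V) c ?_
  exact le_iSup_of_le i (le_iSup_of_le hi (le_iSup_of_le x le_rfl))

variable (P V) [BorelSpace V] [SecondCountableTopology V]

/-- The vector space of `L^∞(C^r)` random sections (functions, not yet classes). -/
def sectionSubmodule (m r : ℕ) : Submodule ℝ (Torus m → Ω → V) where
  carrier := {κ | IsRandomSection P r κ}
  add_mem' {κ μ} hκ hμ :=
    { meas := hκ.meas.add hμ.meas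
      smooth := by
        filter_upwards [hκ.smooth, hμ.smooth] with ω h1 h2 using h1.add h2
      bdd := ne_top_of_le_ne_top (ENNReal.add_ne_top.2 ⟨hκ.bdd, hμ.bdd⟩)
        (secENorm_add_le hκ hμ) }
  zero_mem' :=
    { meas := measurable_const
      smooth := Eventually.of_forall fun _ => contDiff_const
      bdd := by
        rw [show secENorm P r (0 : Torus m → Ω → V) = 0 from secENorm_zero]
        exact ENNReal.zero_ne_top }
  smul_mem' c κ hκ :=
    { meas := hκ.meas.const_smul c
      smooth := by
        filter_upwards [hκ.smooth] with ω h1 using h1.const_smul c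
      bdd := ne_top_of_le_ne_top (ENNReal.mul_ne_top enorm_ne_top hκ.bdd)
        (secENorm_smul_le c hκ) }

/-- `L^∞(C^r)` random sections `𝕋ᵐ × Ω → V`, with the seminorm `‖·‖_{L^∞(C^r)}`. -/
def RSection (m r : ℕ) : Type _ := ↥(sectionSubmodule P V m r)

instance (m r : ℕ) : AddCommGroup (RSection P V m r) :=
  inferInstanceAs (AddCommGroup ↥(sectionSubmodule P V m r))

instance (m r : ℕ) : Module ℝ (RSection P V m r) :=
  inferInstanceAs (Module ℝ ↥(sectionSubmodule P V m r))

instance (m r : ℕ) : CoeFun (RSection P V m r) fun _ => Torus m → Ω → V := ⟨fun κ => κ.1⟩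

instance (m r : ℕ) : SeminormedAddCommGroup (RSection P V m r) :=
  AddGroupSeminorm.toSeminormedAddCommGroup
    { toFun := fun κ => (secENorm P r κ).toReal
      map_zero' := by
        change (secENorm P r (0 : Torus m → Ω → V)).toReal = 0
        rw [show secENorm P r (0 : Torus m → Ω → V) = 0 from secENorm_zero]
        rfl
      add_le' := fun κ μ => by
        rw [← ENNReal.toReal_add κ.2.bdd μ.2.bdd]
        exact ENNReal.toReal_mono (ENNReal.add_ne_top.2 ⟨κ.2.bdd, μ.2.bdd⟩)
          (secENorm_add_le κ.2 μ.2)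
      neg' := fun κ => by
        have aux : ∀ κ : RSection P V m r,
            secENorm P r ((-κ : RSection P V m r) : Torus m → Ω → V) ≤ secENorm P r κ := by
          intro κ
          have h := secENorm_smul_le (-1) κ.2
          have h1 : (fun θ ω => (-1 : ℝ) • κ θ ω)
              = ((-κ : RSection P V m r) : Torus m → Ω → V) := by
            funext θ ω
            exact neg_one_smul ℝ _
          rw [h1] at h
          simpa using h
        have h2 := aux (-κ)
        rw [neg_neg] at h2
        exact congrArg ENNReal.toReal (le_antisymm (aux κ) h2) }

theorem RSection.norm_def {m r : ℕ} (κ : RSection P V m r) :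
    ‖κ‖ = (secENorm P r κ).toReal := rfl

instance (m r : ℕ) : NormedSpace ℝ (RSection P V m r) where
  norm_smul_le c κ := by
    rw [RSection.norm_def, RSection.norm_def]
    have h := ENNReal.toReal_mono (ENNReal.mul_ne_top enorm_ne_top κ.2.bdd)
      (secENorm_smul_le c κ.2)
    rwa [ENNReal.toReal_mul, toReal_enorm] at h

/-- The normed space `L^∞(Ω, C^r(𝕋ᵐ, V))`: random sections modulo equality for almost
every `ω`. -/
abbrev LInfC (m r : ℕ) : Type _ := SeparationQuotient (RSection P V m r)

end Sections

/-! ### Random maps: the space `L^∞(Ω, C^Σ(U × 𝕋ᵐ, ℝⁿ))` -/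

section Maps

variable {Ω : Type*} [MeasurableSpace Ω] (P : Measure Ω) {n m : ℕ}

/-- `‖F‖_{L^∞(C^Σ)}`, the essential supremum over `ω` of
`sup_{(i,j) ∈ Σ, z ∈ U, θ} |D_θ^i D_z^j F(z, θ, ω)|`, as an extended non-negative number. -/
def mapENorm (S : Set (ℕ × ℕ)) (U : Set (Eu n)) (F : Eu n → Torus m → Ω → Eu n) : ℝ≥0∞ :=
  essSup (fun ω => ⨆ p : ℕ × ℕ, ⨆ _ : p ∈ S, ⨆ z : Eu n, ⨆ _ : z ∈ U, ⨆ x : Eu m,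
    ‖mixedDeriv p.1 p.2 (fun z θ => F z θ ω) z x‖ₑ) P

/-- For almost every `ω`, `ρ` is a modulus of continuity in `z` of every `D_θ^i D_z^j F(·, ·, ω)`,
`(i, j) ∈ Σ`, along segments contained in `U`. -/
def HasModulus (S : Set (ℕ × ℕ)) (U : Set (Eu n)) (F : Eu n → Torus m → Ω → Eu n)
    (ρ : ℝ → ℝ) : Prop :=
  ∀ᵐ ω ∂P, ∀ p ∈ S, ∀ x : Eu m, ∀ z w : Eu n, segment ℝ z w ⊆ U →
    ‖mixedDeriv p.1 p.2 (fun z θ => F z θ ω) z x - mixedDeriv p.1 p.2 (fun z θ => F z θ ω) w x‖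
      ≤ ρ ‖z - w‖

/-- The regularity of the fibre map `f = F(·, ·, ω)` on `U × 𝕋ᵐ`: for `(i, j) ∈ Σ` the derivative
`D_θ^i D_z^j f` exists and is jointly continuous. -/
structure IsCSigma (S : Set (ℕ × ℕ)) (U : Set (Eu n)) (f : Eu n → Torus m → Eu n) : Prop where
  diff_z : ∀ p ∈ S, ∀ x : Eu m, ∀ z ∈ U, ContDiffAt ℝ p.2 (fun z' => f z' (toTorus x)) z
  diff_x : ∀ p ∈ S, ∀ z ∈ U,
    ContDiff ℝ p.1 fun x : Eu m => iteratedFDeriv ℝ p.2 (fun z' => f z' (toTorus x)) z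
  cont : ∀ p ∈ S, ContinuousOn (fun q : Eu n × Eu m => mixedDeriv p.1 p.2 f q.1 q.2) (U ×ˢ univ)

/-- `F` is an `L^∞(C^Σ)` random map on `U × 𝕋ᵐ × Ω`: it is jointly measurable, for almost every `ω`
the derivatives `D_θ^i D_z^j F`, `(i, j) ∈ Σ`, exist and are continuous, and, essentially uniformly
in `ω`, they are bounded and have a modulus of continuity in `z`. -/
structure IsRandomMap (S : Set (ℕ × ℕ)) (U : Set (Eu n)) (F : Eu n → Torus m → Ω → Eu n) :
    Prop where
  meas : Measurable fun p : U × Torus m × Ω => F p.1 p.2.1 p.2.2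
  smooth : ∀ᵐ ω ∂P, IsCSigma S U fun z θ => F z θ ω
  bdd : mapENorm P S U F ≠ ∞
  modulus : ∃ ρ : ℝ → ℝ, Tendsto ρ (𝓝[>] 0) (𝓝 0) ∧ HasModulus P S U F ρ

variable {P} {S : Set (ℕ × ℕ)} {U : Set (Eu n)}

theorem mixedDeriv_add {f g : Eu n → Torus m → Eu n} (hf : IsCSigma S U f)
    (hg : IsCSigma S U g) {p : ℕ × ℕ} (hp : p ∈ S) {z : Eu n} (hz : z ∈ U) (x : Eu m) :
    mixedDeriv p.1 p.2 (fun z θ => f z θ + g z θ) z x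
      = mixedDeriv p.1 p.2 f z x + mixedDeriv p.1 p.2 g z x := by
  have h1 : (fun x' : Eu m =>
      iteratedFDeriv ℝ p.2 (fun z' => f z' (toTorus x') + g z' (toTorus x')) z)
      = (fun x' : Eu m => iteratedFDeriv ℝ p.2 (fun z' => f z' (toTorus x')) z)
        + fun x' : Eu m => iteratedFDeriv ℝ p.2 (fun z' => g z' (toTorus x')) z := by
    funext x'
    exact iteratedFDeriv_add_apply (hf.diff_z p hp x' z hz) (hg.diff_z p hp x' z hz)
  unfold mixedDeriv
  rw [h1]
  exact iteratedFDeriv_add_apply (hf.diff_x p hp z hz).contDiffAt (hg.diff_x p hp z hz).contDiffAt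

theorem mixedDeriv_smul (c : ℝ) {f : Eu n → Torus m → Eu n} (hf : IsCSigma S U f)
    {p : ℕ × ℕ} (hp : p ∈ S) {z : Eu n} (hz : z ∈ U) (x : Eu m) :
    mixedDeriv p.1 p.2 (fun z θ => c • f z θ) z x = c • mixedDeriv p.1 p.2 f z x := by
  have h1 : (fun x' : Eu m => iteratedFDeriv ℝ p.2 (fun z' => c • f z' (toTorus x')) z)
      = fun x' : Eu m => c • iteratedFDeriv ℝ p.2 (fun z' => f z' (toTorus x')) z := by
    funext x'
    exact iteratedFDeriv_const_smul_apply' (a := c) (hf.diff_z p hp x' z hz)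
  unfold mixedDeriv
  rw [h1]
  exact iteratedFDeriv_const_smul_apply' (a := c) (hf.diff_x p hp z hz).contDiffAt

theorem mixedDeriv_zero (p : ℕ × ℕ) (z : Eu n) (x : Eu m) :
    mixedDeriv p.1 p.2 (fun (_ : Eu n) (_ : Torus m) => (0 : Eu n)) z x = 0 := by
  unfold mixedDeriv
  have h1 : (fun _ : Eu m => iteratedFDeriv ℝ p.2 (fun _ : Eu n => (0 : Eu n)) z)
      = fun _ => 0 := by
    funext x'
    exact congrFun iteratedFDeriv_fun_zero z
  rw [h1]
  exact congrFun iteratedFDeriv_fun_zero x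

theorem IsCSigma.add {f g : Eu n → Torus m → Eu n} (hf : IsCSigma S U f)
    (hg : IsCSigma S U g) : IsCSigma S U fun z θ => f z θ + g z θ where
  diff_z p hp x z hz := (hf.diff_z p hp x z hz).add (hg.diff_z p hp x z hz)
  diff_x p hp z hz := by
    convert (hf.diff_x p hp z hz).add (hg.diff_x p hp z hz) using 1
    funext x
    exact iteratedFDeriv_add_apply (hf.diff_z p hp x z hz) (hg.diff_z p hp x z hz)
  cont p hp := by
    have h : ContinuousOn (fun q : Eu n × Eu m => (mixedDeriv p.1 p.2 f q.1 q.2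
        + mixedDeriv p.1 p.2 g q.1 q.2 : MixedForm (Eu n) (Eu n) m p.1 p.2)) (U ×ˢ univ) :=
      (hf.cont p hp).add (hg.cont p hp)
    exact h.congr fun q hq => mixedDeriv_add hf hg hp hq.1 q.2

theorem IsCSigma.smul (c : ℝ) {f : Eu n → Torus m → Eu n} (hf : IsCSigma S U f) :
    IsCSigma S U fun z θ => c • f z θ where
  diff_z p hp x z hz := (hf.diff_z p hp x z hz).const_smul c
  diff_x p hp z hz := by
    convert (hf.diff_x p hp z hz).const_smul c using 1
    funext x
    exact iteratedFDeriv_const_smul_apply' (a := c) (hf.diff_z p hp x z hz)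
  cont p hp := by
    have h : ContinuousOn (fun q : Eu n × Eu m =>
        (c • mixedDeriv p.1 p.2 f q.1 q.2 : MixedForm (Eu n) (Eu n) m p.1 p.2)) (U ×ˢ univ) :=
      continuousOn_smul_of (W := MixedForm (Eu n) (Eu n) m p.1 p.2) c (hf.cont p hp)
    exact h.congr fun q hq => mixedDeriv_smul c hf hp hq.1 q.2

theorem IsCSigma.zero : IsCSigma S U fun (_ : Eu n) (_ : Torus m) => (0 : Eu n) where
  diff_z _ _ _ _ _ := contDiffAt_const
  diff_x p _ z _ := by
    have h : (fun _ : Eu m => iteratedFDeriv ℝ p.2 (fun _ : Eu n => (0 : Eu n)) z)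
        = fun _ => 0 := by
      funext x
      exact congrFun iteratedFDeriv_fun_zero z
    rw [h]
    exact contDiff_const
  cont p _ := (continuousOn_const (c := 0)).congr fun q _ => mixedDeriv_zero p q.1 q.2

theorem mapENorm_add_le {F G : Eu n → Torus m → Ω → Eu n} (hF : IsRandomMap P S U F)
    (hG : IsRandomMap P S U G) :
    mapENorm P S U (fun z θ ω => F z θ ω + G z θ ω) ≤ mapENorm P S U F + mapENorm P S U G := by
  refine le_trans (essSup_mono_ae ?_) (ENNReal.essSup_add_le _ _)
  filter_upwards [hF.smooth, hG.smooth] with ω h1 h2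
  refine iSup_le fun p => iSup_le fun hp => iSup_le fun z => iSup_le fun hz => iSup_le fun x => ?_
  rw [mixedDeriv_add h1 h2 hp hz x]
  refine enorm_add_le_of (W := MixedForm (Eu n) (Eu n) m p.1 p.2) ?_ ?_
  · exact le_iSup_of_le p (le_iSup_of_le hp (le_iSup_of_le z (le_iSup_of_le hz
      (le_iSup_of_le x le_rfl))))
  · exact le_iSup_of_le p (le_iSup_of_le hp (le_iSup_of_le z (le_iSup_of_le hz
      (le_iSup_of_le x le_rfl))))

theorem mapENorm_smul_le (c : ℝ) {F : Eu n → Torus m → Ω → Eu n} (hF : IsRandomMap P S U F) :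
    mapENorm P S U (fun z θ ω => c • F z θ ω) ≤ ‖c‖ₑ * mapENorm P S U F := by
  rw [mapENorm, mapENorm, ← ENNReal.essSup_const_mul]
  refine essSup_mono_ae ?_
  filter_upwards [hF.smooth] with ω h1
  refine iSup_le fun p => iSup_le fun hp => iSup_le fun z => iSup_le fun hz => iSup_le fun x => ?_
  rw [mixedDeriv_smul c h1 hp hz x]
  refine enorm_smul_le_of (W := MixedForm (Eu n) (Eu n) m p.1 p.2) c ?_
  exact le_iSup_of_le p (le_iSup_of_le hp (le_iSup_of_le z (le_iSup_of_le hz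
      (le_iSup_of_le x le_rfl))))

theorem mapENorm_zero :
    mapENorm P S U (fun (_ : Eu n) (_ : Torus m) (_ : Ω) => (0 : Eu n)) = 0 := by
  refine le_antisymm ?_ bot_le
  refine essSup_le_of_ae_le _ (Eventually.of_forall fun ω => ?_)
  refine iSup_le fun p => iSup_le fun hp => iSup_le fun z => iSup_le fun hz => iSup_le fun x => ?_
  rw [mixedDeriv_zero p z x]
  exact enorm_zero_le (MixedForm (Eu n) (Eu n) m p.1 p.2)

variable (P S U m)

/-- The vector space of `L^∞(C^Σ)` random maps (functions, not yet classes). -/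
def mapSubmodule : Submodule ℝ (Eu n → Torus m → Ω → Eu n) where
  carrier := {F | IsRandomMap P S U F}
  add_mem' {F G} hF hG :=
    { meas := hF.meas.add hG.meas
      smooth := by
        filter_upwards [hF.smooth, hG.smooth] with ω h1 h2 using h1.add h2
      bdd := ne_top_of_le_ne_top (ENNReal.add_ne_top.2 ⟨hF.bdd, hG.bdd⟩) (mapENorm_add_le hF hG)
      modulus := by
        obtain ⟨ρ, hρ, h1⟩ := hF.modulus
        obtain ⟨τ, hτ, h2⟩ := hG.modulus
        refine ⟨fun t => ρ t + τ t, by simpa using hρ.add hτ, ?_⟩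
        filter_upwards [h1, h2, hF.smooth, hG.smooth] with ω k1 k2 s1 s2 p hp x z w hzw
        have hz := hzw (left_mem_segment ℝ z w)
        have hw := hzw (right_mem_segment ℝ z w)
        have e1 := mixedDeriv_add s1 s2 hp hz x
        have e2 := mixedDeriv_add s1 s2 hp hw x
        simp only [Pi.add_apply]
        rw [e1, e2]
        exact norm_add_sub_le_of (W := MixedForm (Eu n) (Eu n) m p.1 p.2) (k1 p hp x z w hzw) (k2 p hp x z w hzw) }
  zero_mem' :=
    { meas := measurable_const
      smooth := Eventually.of_forall fun _ => IsCSigma.zero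
      bdd := by
        rw [show mapENorm P S U (0 : Eu n → Torus m → Ω → Eu n) = 0 from mapENorm_zero]
        exact ENNReal.zero_ne_top
      modulus := by
        refine ⟨fun _ => 0, tendsto_const_nhds, Eventually.of_forall fun ω p _ x z w _ => ?_⟩
        have e1 := mixedDeriv_zero (m := m) p z x
        have e2 := mixedDeriv_zero (m := m) p w x
        simp only [Pi.zero_apply]
        rw [e1, e2, sub_self]
        exact (norm_zero (E := MixedForm (Eu n) (Eu n) m p.1 p.2)).le }
  smul_mem' c F hF :=
    { meas := hF.meas.const_smul c
      smooth := by
        filter_upwards [hF.smooth] with ω h1 using h1.smul c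
      bdd := ne_top_of_le_ne_top (ENNReal.mul_ne_top enorm_ne_top hF.bdd) (mapENorm_smul_le c hF)
      modulus := by
        obtain ⟨ρ, hρ, h1⟩ := hF.modulus
        refine ⟨fun t => ‖c‖ * ρ t, by simpa using hρ.const_mul ‖c‖, ?_⟩
        filter_upwards [h1, hF.smooth] with ω k1 s1 p hp x z w hzw
        have hz := hzw (left_mem_segment ℝ z w)
        have hw := hzw (right_mem_segment ℝ z w)
        have e1 := mixedDeriv_smul c s1 hp hz x
        have e2 := mixedDeriv_smul c s1 hp hw x
        simp only [Pi.smul_apply]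
        rw [e1, e2]
        exact norm_smul_sub_le_of (W := MixedForm (Eu n) (Eu n) m p.1 p.2) c (k1 p hp x z w hzw) }

/-- `L^∞(C^Σ)` random maps on `U × 𝕋ᵐ × Ω`, with the seminorm `‖·‖_{L^∞(C^Σ)}`. -/
def RMap : Type _ := ↥(mapSubmodule P m S U)

instance : AddCommGroup (RMap P m S U) := inferInstanceAs (AddCommGroup ↥(mapSubmodule P m S U))

instance : Module ℝ (RMap P m S U) := inferInstanceAs (Module ℝ ↥(mapSubmodule P m S U))

instance : CoeFun (RMap P m S U) fun _ => Eu n → Torus m → Ω → Eu n := ⟨fun F => F.1⟩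

instance : SeminormedAddCommGroup (RMap P m S U) :=
  AddGroupSeminorm.toSeminormedAddCommGroup
    { toFun := fun F => (mapENorm P S U F).toReal
      map_zero' := by
        change (mapENorm P S U (0 : Eu n → Torus m → Ω → Eu n)).toReal = 0
        rw [show mapENorm P S U (0 : Eu n → Torus m → Ω → Eu n) = 0 from mapENorm_zero]
        rfl
      add_le' := fun F G => by
        rw [← ENNReal.toReal_add F.2.bdd G.2.bdd]
        exact ENNReal.toReal_mono (ENNReal.add_ne_top.2 ⟨F.2.bdd, G.2.bdd⟩)
          (mapENorm_add_le F.2 G.2)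
      neg' := fun F => by
        have aux : ∀ F : RMap P m S U,
            mapENorm P S U ((-F : RMap P m S U) : Eu n → Torus m → Ω → Eu n)
              ≤ mapENorm P S U F := by
          intro F
          have h := mapENorm_smul_le (-1) F.2
          have h1 : (fun z θ ω => (-1 : ℝ) • F z θ ω)
              = ((-F : RMap P m S U) : Eu n → Torus m → Ω → Eu n) := by
            funext z θ ω
            exact neg_one_smul ℝ _
          rw [h1] at h
          simpa using h
        have h2 := aux (-F)
        rw [neg_neg] at h2
        exact congrArg ENNReal.toReal (le_antisymm (aux F) h2) }

theorem RMap.norm_def (F : RMap P m S U) : ‖F‖ = (mapENorm P S U F).toReal := rfl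

instance : NormedSpace ℝ (RMap P m S U) where
  norm_smul_le c F := by
    rw [RMap.norm_def, RMap.norm_def]
    have h := ENNReal.toReal_mono (ENNReal.mul_ne_top enorm_ne_top F.2.bdd)
      (mapENorm_smul_le c F.2)
    rwa [ENNReal.toReal_mul, toReal_enorm] at h

/-- The normed space `L^∞(Ω, C^Σ(U × 𝕋ᵐ, ℝⁿ))`: random maps modulo equality on `U × 𝕋ᵐ` for almost
every `ω`. -/
abbrev LInfCSigma : Type _ := SeparationQuotient (RMap P m S U)

end Maps

/-! ### Skew-products, transfer operators, hyperbolicity -/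

section Dynamics

variable {Ω : Type*} [MeasurableSpace Ω] (P : Measure Ω) {n m : ℕ}
  (Φ : Ω ≃ᵐ Ω) (α : Eu m)

/-- The error `F(K(θ, ω), θ, ω) - K(θ + α, Φ ω)` in the random invariance equation. -/
def invarianceError (F : Eu n → Torus m → Ω → Eu n) (K : Torus m → Ω → Eu n) :
    Torus m → Ω → Eu n :=
  fun θ ω => F (K θ ω) θ ω - K (θ + toTorus α) (Φ ω)

/-- `K` takes its values in `U` and solves the random invariance equation
`F(K(θ, ω), θ, ω) = K(θ + α, Φ ω)`, for almost every `ω` and every `θ`. -/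
def IsInvariantTorus (U : Set (Eu n)) (F : Eu n → Torus m → Ω → Eu n)
    (K : Torus m → Ω → Eu n) : Prop :=
  (∀ᵐ ω ∂P, ∀ θ, K θ ω ∈ U) ∧
    ∀ᵐ ω ∂P, ∀ θ, F (K θ ω) θ ω = K (θ + toTorus α) (Φ ω)

/-- The transfer matrix `M(θ, ω) = D_z F(K(θ, ω), θ, ω)`. -/
def transferMatrix (F : Eu n → Torus m → Ω → Eu n) (K : Torus m → Ω → Eu n) :
    Torus m → Ω → (Eu n →L[ℝ] Eu n) :=
  fun θ ω => fderiv ℝ (fun z => F z θ ω) (K θ ω)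

/-- The complexification of a real matrix: `A (a + i b) = A a + i A b`. -/
def complexify (A : Eu n →L[ℝ] Eu n) (v : EuC n) : EuC n :=
  WithLp.toLp 2 fun k =>
    (A (WithLp.toLp 2 fun l => (v l).re) k : ℂ)
      + Complex.I * (A (WithLp.toLp 2 fun l => (v l).im) k : ℂ)

/-- The transfer operator `𝓜[κ](θ, ω) = M(θ - α, Φ⁻¹ ω) κ(θ - α, Φ⁻¹ ω)` on complex random
sections. -/
def transferOp (M : Torus m → Ω → (Eu n →L[ℝ] Eu n)) (κ : Torus m → Ω → EuC n) :
    Torus m → Ω → EuC n :=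
  fun θ ω => complexify (M (θ - toTorus α) (Φ.symm ω)) (κ (θ - toTorus α) (Φ.symm ω))

/-- `𝓜 - y Id` is invertible on (complex) `L^∞(C^r)` sections and its inverse `R` has operator norm
at most `c`: for all sections `κ`, `η` one has `(𝓜 - y Id) κ = η` if and only if `κ = R η`. -/
def ResolventBound (r : ℕ) (M : Torus m → Ω → (Eu n →L[ℝ] Eu n)) (y : ℂ) (c : ℝ) : Prop :=
  ∃ R : LInfC P (EuC n) m r →L[ℝ] LInfC P (EuC n) m r, ‖R‖ ≤ c ∧
    ∀ κ η : RSection P (EuC n) m r,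
      (∀ᵐ ω ∂P, ∀ θ, transferOp Φ α M κ θ ω - y • κ θ ω = η θ ω) ↔
        SeparationQuotient.mk κ = R (SeparationQuotient.mk η)

/-- The forward cocycle `M(θ, ω, N) = M(θ + (N-1)α, Φ^{N-1} ω) ⋯ M(θ, ω)`, `N ≥ 0`. -/
def cocycleFwd (M : Torus m → Ω → (Eu n →L[ℝ] Eu n)) (θ : Torus m) (ω : Ω) :
    ℕ → (Eu n →L[ℝ] Eu n)
  | 0 => ContinuousLinearMap.id ℝ (Eu n)
  | N + 1 => (M (θ + N • toTorus α) (Φ^[N] ω)).comp (cocycleFwd M θ ω N)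

/-- The backward cocycle `M(θ, ω, -N) = M(θ - Nα, Φ^{-N} ω)⁻¹ ⋯ M(θ - α, Φ⁻¹ ω)⁻¹`, `N ≥ 0`. -/
def cocycleBwd (M : Torus m → Ω → (Eu n →L[ℝ] Eu n)) (θ : Torus m) (ω : Ω) :
    ℕ → (Eu n →L[ℝ] Eu n)
  | 0 => ContinuousLinearMap.id ℝ (Eu n)
  | N + 1 => (M (θ - (N + 1) • toTorus α) (Φ.symm^[N + 1] ω)).inverse.comp (cocycleBwd M θ ω N)

/-- Normal hyperbolicity of the linear skew-product `(M, α, Φ)`: for almost every `ω` all matrices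
`M(θ, ω)` are invertible, and there are a splitting `ℝⁿ = E^S(θ, ω) ⊕ E^U(θ, ω)`, invariant under
the skew-product, of class `C^r` in `θ` and measurable (in the sense of its projections), and
random constants `C > 0`, `0 < λ_S < 1 < λ_U`, such that `E^S` and `E^U` are characterized by the
growth rates `|M(θ, ω, N) v| ≤ C λ_S^N |v|` (`N ≥ 0`), `|M(θ, ω, N) v| ≤ C λ_U^N |v|` (`N ≤ 0`). -/
def IsNormallyHyperbolic (r : ℕ) (M : Torus m → Ω → (Eu n →L[ℝ] Eu n)) : Prop :=
  ∃ (ES EU : Torus m → Ω → Submodule ℝ (Eu n)) (prS prU : Torus m → Ω → (Eu n →L[ℝ] Eu n))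
    (C lS lU : Ω → ℝ),
    (Measurable fun p : Torus m × Ω => prS p.1 p.2) ∧
    (Measurable fun p : Torus m × Ω => prU p.1 p.2) ∧
    Measurable C ∧ Measurable lS ∧ Measurable lU ∧
    ∀ᵐ ω ∂P,
      (ContDiff ℝ r fun x : Eu m => prS (toTorus x) ω) ∧
      (ContDiff ℝ r fun x : Eu m => prU (toTorus x) ω) ∧
      0 < C ω ∧ 0 < lS ω ∧ lS ω < 1 ∧ 1 < lU ω ∧
      ∀ θ : Torus m,
        (M θ ω).IsInvertible ∧
        IsCompl (ES θ ω) (EU θ ω) ∧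
        (∀ v, prS θ ω v ∈ ES θ ω ∧ prU θ ω v ∈ EU θ ω ∧ prS θ ω v + prU θ ω v = v) ∧
        (∀ v, v ∈ ES θ ω ↔ ∀ N : ℕ, ‖cocycleFwd Φ α M θ ω N v‖ ≤ C ω * lS ω ^ N * ‖v‖) ∧
        (∀ v, v ∈ EU θ ω ↔
          ∀ N : ℕ, ‖cocycleBwd Φ α M θ ω N v‖ ≤ C ω * (lU ω ^ N)⁻¹ * ‖v‖) ∧
        (ES θ ω).map (M θ ω : Eu n →ₗ[ℝ] Eu n) = ES (θ + toTorus α) (Φ ω) ∧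
        (EU θ ω).map (M θ ω : Eu n →ₗ[ℝ] Eu n) = EU (θ + toTorus α) (Φ ω)

/-- A random set: a family of non-empty closed sets whose distance to each point is a random
variable. -/
def IsRandomSet {X : Type*} [PseudoMetricSpace X] (A : Ω → Set X) : Prop :=
  (∀ ω, (A ω).Nonempty ∧ IsClosed (A ω)) ∧ ∀ x, Measurable fun ω => Metric.infDist x (A ω)

/-- The random torus `𝓚(ω) = {(K(θ, ω), θ) | θ ∈ 𝕋ᵐ}` parameterized by `K`. -/
def torusSet (K : Torus m → Ω → Eu n) (ω : Ω) : Set (Eu n × Torus m) :=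
  Set.range fun θ => (K θ ω, θ)

/-- The torus parameterized by `K` is a normally hyperbolic random invariant torus of the
skew-product `(F, α, Φ)`: `𝓚` is a random set, as is its projection to `ℝⁿ`, it is invariant, and
its linearized dynamics is normally hyperbolic. -/
structure IsNormallyHyperbolicTorus (r : ℕ) (U : Set (Eu n)) (F : Eu n → Torus m → Ω → Eu n)
    (K : Torus m → Ω → Eu n) : Prop where
  randomSet : IsRandomSet (torusSet K)
  randomSet_proj : IsRandomSet fun ω => Set.range fun θ => K θ ω
  invariant : IsInvariantTorus P Φ α U F K
  hyperbolic : IsNormallyHyperbolic P Φ α r (transferMatrix F K)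

end Dynamics

end RandomTorus

end

open RandomTorus

/-! Let `S` be the transport of sections by the skew-product over `Φ` and the rotation by `α`.
Invariant tori of `G` are the fixed points of `k ↦ S (G ∘ k)` (`transportMap`) in the Banach space
`LInfC`. This map is linear in `G` and differentiable in `k`, and its derivative at `k` is the
transfer operator of the dynamics linearized along `k`. At `K_*` the hypothesis for `y = 1` says
that the derivative minus the identity has an inverse of norm at most `c_H`. A quantitative inverse
function theorem, `exists_contDiffOn_fixedPoint`, then gives existence with `C = 2 c_H` and `C¹`
dependence on `G`. Its analytic input is the Taylor estimate `exists_crBound_comp_remainder` for `x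
↦ g (K x) x` in `C^r`, proved by induction on `r` through directional derivatives.

Uniqueness among continuous sections and normal hyperbolicity use the whole unit circle. For an
operator `a` with resolvent `R y = (y - a)⁻¹` on the circle, the integrals of `y ^ k * R y` form a
Green family `G k` (`exists_greenFamily`): `G 0` is the spectral projection onto the stable part, `G
k` for `k > 0` is `a ^ k` on that part, and `G k` for `k < 0` is minus the inverse iterate on the
unstable part. A bounded two-sided orbit of `a` vanishes. This yields the product laws of the
family, and with them exponential decay (`exists_exponential_decay`).

The same uniqueness turns operators into matrices. Multiplication by a scalar function is
intertwined by `a` with multiplication by the transported function, hence `G k` intertwines them as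
well. So `G k` acts by a matrix over the `k`-th iterate of the skew-product
(`IsTransferOp.greenFamily_apply`), and the operator identities become identities between matrices
along almost every orbit (`IsTransferOp.ae_isGreenAlongOrbit`).

Along an orbit these matrices give an exponential dichotomy, with projection `G 0`
(`IsTransferOp.isNormallyHyperbolic`). They also give uniqueness: the difference of two nearby
solutions is bounded and almost invariant under the linearized cocycle, and summing it against
finitely many Green matrices improves any bound for it by the factor `3/4`, so it vanishes
(`IsTransferOp.ae_eq_zero_of_almost_invariant`). Only pointwise bounds enter here, so the competing
solution need not be more than continuous. The resolvent lives on complex sections; real parts bring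
the Green family back to real ones. -/

/-- A Green family of the equation `x (k + 1) = a x k` in a normed ring: a two-sided sequence
solving the inhomogeneous equation with unit impulse, bounded and tending to zero. -/
structure IsGreenFamily {𝓐 : Type*} [NormedRing 𝓐] (a : 𝓐) (G : ℤ → 𝓐) (c : ℝ) : Prop where
  left : ∀ k, a * G k = G (k + 1) - if k = -1 then 1 else 0
  right : ∀ k, G k * a = G (k + 1) - if k = -1 then 1 else 0
  bound : ∀ k, ‖G k‖ ≤ c
  decay : ∀ k, ‖G k‖ * |(k : ℝ) + 1| ≤ 2 * c ^ 2

/-! ### Green families as contour integrals of the resolvent -/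

section GreenExistence

variable {𝓐 : Type*} [NormedRing 𝓐] [NormedAlgebra ℝ 𝓐]

/-- The point `exp(it)` of the unit circle. -/
noncomputable def unitExp (t : ℝ) : ℂ := Complex.exp (t * Complex.I)

theorem norm_unitExp (t : ℝ) : ‖unitExp t‖ = 1 := Complex.norm_exp_ofReal_mul_I t

theorem unitExp_ne_zero (t : ℝ) : unitExp t ≠ 0 := Complex.exp_ne_zero _

theorem unitExp_add (s t : ℝ) : unitExp (s + t) = unitExp s * unitExp t := by
  simp [unitExp, add_mul, Complex.exp_add]

theorem unitExp_zpow (t : ℝ) (k : ℤ) : unitExp t ^ k = unitExp (k * t) := by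
  rw [unitExp, unitExp, ← Complex.exp_int_mul]
  congr 1
  push_cast
  ring

theorem unitExp_periodic : Function.Periodic unitExp (2 * Real.pi) := by
  intro t
  have h : unitExp (2 * Real.pi) = 1 := by
    simp [unitExp]
  rw [unitExp_add, h, mul_one]

theorem continuous_unitExp : Continuous unitExp := by
  unfold unitExp
  fun_prop

theorem norm_unitExp_sub_le (t s : ℝ) : ‖unitExp t - unitExp (t + s)‖ ≤ |s| := by
  rw [unitExp_add, ← mul_one_sub, norm_mul, norm_unitExp, one_mul, norm_sub_rev]
  have := Real.norm_exp_I_mul_ofReal_sub_one_le (x := s)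
  rwa [mul_comm, Real.norm_eq_abs] at this

theorem unitExp_pi_div {k : ℤ} (hk : k ≠ 0) : unitExp (Real.pi / k) ^ k = -1 := by
  have hk' : (k : ℝ) ≠ 0 := by exact_mod_cast hk
  rw [unitExp_zpow, mul_div_cancel₀ _ hk']
  simp [unitExp]

-- Complex scalars act through `J`, because the algebra to which this is applied consists of
-- real-linear operators on complex sections.
variable {J : ℂ →+* 𝓐} (hJ : ∀ y, ‖J y‖ ≤ ‖y‖)
include hJ

omit [NormedAlgebra ℝ 𝓐] in
theorem continuous_of_ringHom_norm_le : Continuous J :=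
  AddMonoidHomClass.continuous_of_bound J 1 (by simpa using hJ)

/-- Translation by `π / k` changes the sign of the integrand, while the integral over a full period
does not see translations. -/
theorem integral_ringHom_unitExp_zpow {k : ℤ} (hk : k ≠ 0) :
    ∫ t in (0 : ℝ)..2 * Real.pi, J (unitExp t ^ k) = 0 := by
  have hper : Function.Periodic (fun t => J (unitExp t ^ k)) (2 * Real.pi) := fun t => by
    simp only [unitExp_periodic t]
  have h1 := hper.intervalIntegral_add_eq 0 (0 + Real.pi / k)
  have h2 := intervalIntegral.integral_comp_add_right (a := 0) (b := 2 * Real.pi)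
    (fun t => J (unitExp t ^ k)) (Real.pi / k)
  have h3 : ∀ t, J (unitExp (t + Real.pi / k) ^ k) = - J (unitExp t ^ k) := fun t => by
    rw [unitExp_add, mul_zpow, unitExp_pi_div hk, mul_neg_one, map_neg]
  simp only [h3, intervalIntegral.integral_neg] at h2
  rw [zero_add, zero_add] at h1
  rw [zero_add, add_comm (2 * Real.pi), ← h1] at h2
  have h4 : (2 : ℝ) • ∫ t in (0 : ℝ)..2 * Real.pi, J (unitExp t ^ k) = 0 := by
    rw [two_smul]
    nth_rewrite 1 [← h2]
    exact neg_add_cancel _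
  exact (smul_eq_zero_iff_right two_ne_zero).1 h4

/-- `G k` is the mean of `y ^ (k + 1) * R y` over the circle. The two relations come from `a * R y =
y * R y - 1` and its mirror image. The decay is that of the Fourier coefficients of a Lipschitz
function. -/
theorem exists_greenFamily [CompleteSpace 𝓐] {a : 𝓐} (ha : ∀ y, Commute (J y) a) {R : ℂ → 𝓐}
    {c : ℝ} (hR : ∀ y, ‖y‖ = 1 → R y * (J y - a) = 1 ∧ (J y - a) * R y = 1)
    (hc : ∀ y, ‖y‖ = 1 → ‖R y‖ ≤ c) : ∃ G : ℤ → 𝓐, IsGreenFamily a G c := by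
  have hJc := continuous_of_ringHom_norm_le hJ
  have hc0 : 0 ≤ c := (norm_nonneg _).trans (hc 1 (by simp))
  have hpi := Real.pi_pos
  -- The resolvent identity makes `R` Lipschitz on the circle with constant `c ^ 2`.
  have hlip : ∀ y z, ‖y‖ = 1 → ‖z‖ = 1 → ‖R y - R z‖ ≤ c ^ 2 * ‖y - z‖ := by
    intro y z hy hz
    have e : R y - R z = R y * J (z - y) * R z := by
      have : R y * J (z - y) * R z = R y * ((J z - a) * R z) - (R y * (J y - a)) * R z := by
        rw [map_sub]; noncomm_ring
      rw [this, (hR y hy).1, (hR z hz).2, mul_one, one_mul]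
    rw [e]
    calc _ ≤ ‖R y‖ * ‖J (z - y)‖ * ‖R z‖ :=
          (norm_mul_le _ _).trans (by gcongr; exact norm_mul_le _ _)
      _ ≤ c * ‖z - y‖ * c := by gcongr <;> first | exact hc _ ‹_› | exact hJ _
      _ = _ := by rw [norm_sub_rev]; ring
  have hRc : Continuous fun t => R (unitExp t) := by
    have : LipschitzWith (Real.toNNReal (c ^ 2)) fun t => R (unitExp t) := by
      refine LipschitzWith.of_dist_le_mul fun s t => ?_
      rw [dist_eq_norm, Real.coe_toNNReal _ (sq_nonneg c)]
      refine (hlip _ _ (norm_unitExp s) (norm_unitExp t)).trans ?_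
      gcongr
      have := norm_unitExp_sub_le s (t - s)
      rwa [add_sub_cancel, abs_sub_comm] at this
    exact this.continuous
  have hJR : ∀ y z, ‖z‖ = 1 → J y * R z = R z * J y := by
    intro y z hz
    have h1 : Commute (J y) (J z - a) := by
      refine Commute.sub_right ?_ (ha y)
      change J y * J z = J z * J y
      rw [← map_mul, ← map_mul, mul_comm]
    calc J y * R z = R z * (J z - a) * (J y * R z) := by rw [(hR z hz).1, one_mul]
      _ = R z * ((J z - a) * J y) * R z := by noncomm_ring
      _ = R z * (J y * (J z - a)) * R z := by rw [h1.eq]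
      _ = R z * J y * ((J z - a) * R z) := by noncomm_ring
      _ = _ := by rw [(hR z hz).2, mul_one]
  have hzc : ∀ k : ℤ, Continuous fun t => J (unitExp t ^ k) := fun k => by
    refine hJc.comp ?_
    simp only [unitExp_zpow]
    exact continuous_unitExp.comp (by fun_prop)
  have hJ1 : ∀ t (k : ℤ), ‖J (unitExp t ^ k)‖ ≤ 1 := fun t k => (hJ _).trans (by
    rw [norm_zpow, norm_unitExp, one_zpow])
  -- The exponent is `k + 1` because `dy = i y dt` on the circle; this is why the impulse sits at `k
  -- = -1`.
  set f : ℤ → ℝ → 𝓐 := fun k t => J (unitExp t ^ (k + 1)) * R (unitExp t) with hf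
  have hfc : ∀ k, Continuous (f k) := fun k => (hzc _).mul hRc
  have hfi : ∀ k u v, IntervalIntegrable (f k) volume u v := fun k u v =>
    (hfc k).intervalIntegrable u v
  have hzi : ∀ (k : ℤ) (u v : ℝ), IntervalIntegrable (fun t => J (unitExp t ^ k)) volume u v :=
    fun k u v => (hzc k).intervalIntegrable u v
  set G : ℤ → 𝓐 := fun k => (2 * Real.pi)⁻¹ • ∫ t in (0 : ℝ)..2 * Real.pi, f k t with hG
  have hnG : ∀ (g : ℝ → 𝓐) (b : ℝ), (∀ t, ‖g t‖ ≤ b) →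
      ‖(2 * Real.pi)⁻¹ • ∫ t in (0 : ℝ)..2 * Real.pi, g t‖ ≤ b := by
    intro g b hg
    rw [norm_smul, norm_inv, Real.norm_of_nonneg (by positivity), inv_mul_le_iff₀ (by positivity)]
    have := intervalIntegral.norm_integral_le_of_norm_le_const (a := 0) (b := 2 * Real.pi)
      (fun t _ => hg t)
    rwa [sub_zero, abs_of_pos (by positivity), mul_comm b] at this
  have hid : ∀ k : ℤ, ((2 * Real.pi)⁻¹ • ∫ t in (0 : ℝ)..2 * Real.pi, J (unitExp t ^ (k + 1)))
      = if k = -1 then 1 else 0 := by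
    intro k
    split_ifs with hk
    · subst hk
      simp only [neg_add_cancel, zpow_zero, map_one, intervalIntegral.integral_const, sub_zero,
        smul_smul]
      rw [inv_mul_cancel₀ (by positivity), one_smul]
    · rw [integral_ringHom_unitExp_zpow hJ (by omega), smul_zero]
  have hstep : ∀ (k : ℤ) t, a * f k t = f (k + 1) t - J (unitExp t ^ (k + 1)) := by
    intro k t
    have h2 := (hR _ (norm_unitExp t)).2
    have h3 : a * R (unitExp t) = J (unitExp t) * R (unitExp t) - 1 := by
      rw [← h2]; noncomm_ring
    simp only [hf]
    rw [← mul_assoc, ← (ha _).eq, mul_assoc, h3, mul_sub, mul_one, ← mul_assoc, ← map_mul,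
      ← zpow_add_one₀ (unitExp_ne_zero t)]
  have hstep' : ∀ (k : ℤ) t, f k t * a = f (k + 1) t - J (unitExp t ^ (k + 1)) := by
    intro k t
    have h2 := (hR _ (norm_unitExp t)).1
    have h3 : R (unitExp t) * a = J (unitExp t) * R (unitExp t) - 1 := by
      rw [hJR _ _ (norm_unitExp t), ← h2]; noncomm_ring
    simp only [hf]
    rw [mul_assoc, h3, mul_sub, mul_one, ← mul_assoc, ← map_mul,
      ← zpow_add_one₀ (unitExp_ne_zero t)]
  refine ⟨G, ⟨fun k => ?_, fun k => ?_, fun k => ?_, fun k => ?_⟩⟩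
  · simp only [hG]
    have e := (ContinuousLinearMap.mul ℝ 𝓐 a).intervalIntegral_comp_comm (hfi k 0 (2 * Real.pi))
    simp only [ContinuousLinearMap.mul_apply', hstep] at e
    rw [mul_smul_comm, ← e]
    rw [intervalIntegral.integral_sub (hfi _ _ _) (hzi _ _ _), smul_sub, hid]
  · simp only [hG]
    have e := ((ContinuousLinearMap.mul ℝ 𝓐).flip a).intervalIntegral_comp_comm
      (hfi k 0 (2 * Real.pi))
    simp only [ContinuousLinearMap.flip_apply, ContinuousLinearMap.mul_apply', hstep'] at e
    rw [smul_mul_assoc, ← e]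
    rw [intervalIntegral.integral_sub (hfi _ _ _) (hzi _ _ _), smul_sub, hid]
  · refine hnG _ _ fun t => ?_
    refine (norm_mul_le _ _).trans ?_
    calc _ ≤ 1 * c := by gcongr; exacts [hJ1 _ _, hc _ (norm_unitExp t)]
      _ = c := one_mul c
  · rcases eq_or_ne (k + 1) 0 with hk | hk
    · have : (k : ℝ) + 1 = 0 := by exact_mod_cast hk
      rw [this, abs_zero, mul_zero]
      positivity
    · have hk' : (k : ℝ) + 1 ≠ 0 := by exact_mod_cast hk
      -- Half a period of the phase. Averaging with the translate by `s` leaves the difference `R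
      -- (y) - R (y')` at points of distance at most `|s|`, so `2 ‖G k‖ ≤ c ^ 2 * π / |k + 1|`, and
      -- `π ≤ 4`.
      set s : ℝ := Real.pi / ((k + 1 : ℤ) : ℝ) with hs
      have hper : Function.Periodic (f k) (2 * Real.pi) := fun t => by
        simp only [hf, unitExp_periodic t]
      have h1 := hper.intervalIntegral_add_eq 0 (0 + s)
      have h2 := intervalIntegral.integral_comp_add_right (a := 0) (b := 2 * Real.pi) (f k) s
      rw [zero_add, zero_add] at h1
      rw [zero_add, add_comm (2 * Real.pi), ← h1] at h2
      have h3 : G k + G k = (2 * Real.pi)⁻¹ • ∫ t in (0 : ℝ)..2 * Real.pi,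
          (J (unitExp t ^ (k + 1)) * (R (unitExp t) - R (unitExp (t + s)))) := by
        have h4 : ∀ t, J (unitExp t ^ (k + 1)) * (R (unitExp t) - R (unitExp (t + s)))
            = f k t + f k (t + s) := by
          intro t
          simp only [hf]
          rw [unitExp_add t s, mul_zpow, unitExp_pi_div hk, mul_neg_one, map_neg]
          noncomm_ring
        simp only [h4]
        have hsi : IntervalIntegrable (fun t => f k (t + s)) volume 0 (2 * Real.pi) :=
          ((hfc k).comp (continuous_add_const s)).intervalIntegrable _ _
        rw [intervalIntegral.integral_add (hfi _ _ _) hsi, h2, smul_add]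
      have h5 : ‖G k + G k‖ ≤ c ^ 2 * |s| := by
        rw [h3]
        refine hnG _ _ fun t => (norm_mul_le _ _).trans ?_
        calc _ ≤ 1 * (c ^ 2 * |s|) := by
              gcongr
              · exact hJ1 _ _
              · exact (hlip _ _ (norm_unitExp _) (norm_unitExp _)).trans
                  (by gcongr; exact norm_unitExp_sub_le _ _)
          _ = _ := one_mul _
      have h6 : |s| * |(k : ℝ) + 1| = Real.pi := by
        rw [← abs_mul, hs]
        push_cast
        rw [div_mul_cancel₀ _ hk', abs_of_pos hpi]
      rw [← two_smul ℝ, norm_smul, Real.norm_ofNat] at h5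
      have h7 := mul_le_mul_of_nonneg_right h5 (abs_nonneg ((k : ℝ) + 1))
      rw [mul_assoc, mul_assoc, h6] at h7
      nlinarith [Real.pi_le_four, sq_nonneg c]

end GreenExistence

/-! ### Product laws and exponential decay of Green families -/

namespace IsGreenFamily

variable {𝓐 : Type*} [NormedRing 𝓐] {a : 𝓐} {G : ℤ → 𝓐} {c : ℝ} (hG : IsGreenFamily a G c)
include hG

theorem pow_mul_apply (k : ℕ) : a ^ k * G 0 = G k := by
  induction k with
  | zero => simp
  | succ k ih =>
    rw [pow_succ', mul_assoc, ih, hG.left]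
    rw [if_neg (by omega)]
    push_cast
    simp

/-- The last of the `k` steps, from `G (-1)` to `G 0`, crosses the impulse; for `k = 0` nothing is
crossed. -/
theorem neg_mul_pow (k : ℕ) : G (-k) * a ^ k = G 0 - if k = 0 then 0 else 1 := by
  induction k with
  | zero => simp
  | succ k ih =>
    rw [pow_succ', ← mul_assoc, hG.right]
    have e : (-((k + 1 : ℕ) : ℤ)) + 1 = -k := by push_cast; ring
    rw [e, sub_mul, ih]
    rcases k with _ | k
    · simp
    · rw [if_neg (by omega), if_neg (by omega), if_neg (by omega)]
      simp

theorem mul_pow_apply (k : ℕ) : G 0 * a ^ k = G k := by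
  induction k with
  | zero => simp
  | succ k ih =>
    rw [pow_succ, ← mul_assoc, ih, hG.right]
    rw [if_neg (by omega)]
    push_cast
    simp

theorem nonneg : 0 ≤ c := (norm_nonneg _).trans (hG.bound 0)

theorem tendsto_natCast : Tendsto (fun k : ℕ => ‖G k‖) atTop (𝓝 0) := by
  have h : Tendsto (fun k : ℕ => 2 * c ^ 2 / ((k : ℝ) + 1)) atTop (𝓝 0) :=
    tendsto_const_nhds.div_atTop (tendsto_atTop_add_const_right _ _ tendsto_natCast_atTop_atTop)
  refine squeeze_zero (fun _ => norm_nonneg _) (fun k => ?_) h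
  have := hG.decay k
  rw [le_div_iff₀ (by positivity)]
  rwa [abs_of_nonneg (by positivity), Int.cast_natCast] at this

theorem tendsto_neg_natCast : Tendsto (fun k : ℕ => ‖G (-k)‖) atTop (𝓝 0) := by
  have h : Tendsto (fun k : ℕ => 2 * c ^ 2 / ((k : ℝ) + -1)) atTop (𝓝 0) :=
    tendsto_const_nhds.div_atTop (tendsto_atTop_add_const_right _ _ tendsto_natCast_atTop_atTop)
  refine squeeze_zero' (Eventually.of_forall fun _ => norm_nonneg _) ?_ h
  filter_upwards [eventually_gt_atTop 1] with k hk
  have := hG.decay (-k)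
  have hk' : (1 : ℝ) < k := by exact_mod_cast hk
  rw [le_div_iff₀ (by linarith)]
  rwa [Int.cast_neg, Int.cast_natCast, abs_of_neg (by linarith), neg_add, neg_neg] at this

/-- A bounded two-sided orbit of `a` vanishes. -/
theorem eq_zero_of_bounded {x : ℤ → 𝓐} {b : ℝ} (hx : ∀ k, ‖x k‖ ≤ b)
    (hax : ∀ k, a * x k = x (k + 1)) (k : ℤ) : x k = 0 := by
  have hpow : ∀ (j : ℕ) k, a ^ j * x k = x (k + j) := by
    intro j
    induction j with
    | zero => simp
    | succ j ih =>
      intro k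
      rw [pow_succ', mul_assoc, ih, hax]
      push_cast
      ring_nf
  have hbd : ∀ j : ℕ, 0 < j → ‖x k‖ ≤ (‖G j‖ + ‖G (-j)‖) * b := by
    intro j hj
    have h1 : G j * x (k - j) = G 0 * x k := by
      rw [← hG.mul_pow_apply, mul_assoc, hpow, sub_add_cancel]
    have h2 : G (-j) * x (k + j) = G 0 * x k - x k := by
      rw [← hpow, ← mul_assoc, hG.neg_mul_pow, if_neg hj.ne', sub_mul, one_mul]
    -- The stable component of `x k` is recovered from the past and the unstable one from the
    -- future, with coefficients that tend to zero as `j` grows.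
    have h3 : x k = G j * x (k - j) - G (-j) * x (k + j) := by rw [h1, h2]; abel
    rw [h3, add_mul]
    refine (norm_sub_le _ _).trans (add_le_add ?_ ?_) <;>
    · refine (norm_mul_le _ _).trans ?_
      gcongr
      exact hx _
  have hlim : Tendsto (fun j : ℕ => (‖G j‖ + ‖G (-j)‖) * b) atTop (𝓝 0) := by
    simpa using (hG.tendsto_natCast.add hG.tendsto_neg_natCast).mul_const b
  have := ge_of_tendsto hlim ((eventually_gt_atTop 0).mono hbd)
  exact norm_le_zero_iff.1 this

/-- A bounded family intertwining `a` with itself intertwines the Green family. -/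
theorem intertwine {L : ℤ → 𝓐} {b : ℝ} (hL : ∀ k, ‖L k‖ ≤ b)
    (haL : ∀ k, a * L k = L (k + 1) * a) (k : ℤ) : L k * G k = G k * L 0 := by
  have h := hG.eq_zero_of_bounded (x := fun k => L k * G k - G k * L 0) (b := b * c + c * b)
    (fun k => ?_) (fun k => ?_) k
  · exact sub_eq_zero.1 h
  · have hb : 0 ≤ b := (norm_nonneg _).trans (hL 0)
    have hc := hG.nonneg
    refine (norm_sub_le _ _).trans (add_le_add ?_ ?_)
    · refine (norm_mul_le _ _).trans ?_
      gcongr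
      exacts [hL k, hG.bound k]
    · refine (norm_mul_le _ _).trans ?_
      gcongr
      exacts [hG.bound k, hL 0]
  -- Both terms of the difference receive the same impulse `L 0` at `k = -1`, so it cancels.
  · simp only [mul_sub, ← mul_assoc, haL, hG.left]
    rw [mul_assoc, hG.left]
    split_ifs with hk
    · subst hk
      simp [mul_sub, sub_mul]
    · simp

/-- Both sides are bounded and solve the equation with impulse `G 0` at `k = -1`, hence they agree.
At `k = 0` this says that `G 0` is a projection. -/
theorem apply_mul_zero (k : ℤ) : G k * G 0 = if 0 ≤ k then G k else 0 := by
  have hc := hG.nonneg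
  have h := hG.eq_zero_of_bounded (x := fun k => G k * G 0 - if 0 ≤ k then G k else 0)
    (b := c * c + c) (fun k => ?_) (fun k => ?_) k
  · exact sub_eq_zero.1 h
  · refine (norm_sub_le _ _).trans (add_le_add ?_ ?_)
    · refine (norm_mul_le _ _).trans ?_
      gcongr
      exacts [hG.bound k, hG.bound 0]
    · split_ifs
      · exact hG.bound k
      · simpa using hc
  · simp only [mul_sub, ← mul_assoc, hG.left]
    rcases lt_trichotomy k (-1) with hk | hk | hk
    · rw [if_neg (by omega), if_neg (by omega), if_neg (by omega)]
      simp
    · subst hk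
      simp [sub_mul]
    · rw [if_neg (by omega), if_pos (by omega), if_pos (by omega), hG.left, if_neg (by omega)]
      simp

/-- With `mul_neg_natCast` this makes `‖G k‖` submultiplicative in each time direction, which is
what upgrades convergence to zero to exponential decay. -/
theorem mul_natCast (j k : ℕ) : G j * G k = G (j + k : ℕ) := by
  have h0 : G 0 * G 0 = G 0 := by simpa using hG.apply_mul_zero 0
  calc G j * G k = a ^ j * (G 0 * a ^ k) * G 0 := by
        rw [← hG.pow_mul_apply j, ← hG.pow_mul_apply k]; noncomm_ring
    _ = a ^ j * a ^ k * (G 0 * G 0) := by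
        rw [hG.mul_pow_apply, ← hG.pow_mul_apply]; noncomm_ring
    _ = _ := by rw [h0, ← pow_add, hG.pow_mul_apply]

theorem commute_zero (k : ℤ) : G 0 * G k = G k * G 0 := by
  have hc := hG.nonneg
  refine hG.intertwine (L := fun _ => G 0) (b := c) (fun _ => hG.bound 0) (fun k => ?_) k
  have h1 := hG.left 0
  have h2 := hG.right 0
  rw [h1, h2]

theorem mul_neg_natCast {j k : ℕ} (hj : 0 < j) (hk : 0 < k) :
    G (-j) * G (-k) = - G (-(j + k : ℕ)) := by
  have h1 : a ^ j * G (-(j + k : ℕ)) = G (-k) := by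
    clear hj
    induction j with
    | zero => simp
    | succ j ih =>
      rw [pow_succ, mul_assoc, hG.left, if_neg (by omega), sub_zero]
      convert ih using 3
      push_cast
      ring
  rw [← h1, ← mul_assoc, hG.neg_mul_pow, if_neg hj.ne', sub_mul, one_mul, hG.commute_zero,
    hG.apply_mul_zero, if_neg (by omega), zero_sub]

/-- A submultiplicative sequence tending to zero is at most `1/2` at some time `p`, hence halves
every `p` steps. -/
theorem exists_exponential_decay : ∃ D lam : ℝ, 0 < D ∧ 0 < lam ∧ lam < 1 ∧
    ∀ k : ℕ, ‖G k‖ ≤ D * lam ^ k ∧ ‖G (-k)‖ ≤ D * lam ^ k := by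
  have hc := hG.nonneg
  -- The factor `2 * c + 2` covers the bound `c` for the times below `p'`, and also the time `p'`
  -- itself, where `u p' ≤ 1/2` has to serve because the product law needs positive times.
  have key : ∀ u : ℕ → ℝ, (∀ k, 0 ≤ u k) → (∀ k, u k ≤ c) →
      (∀ j k, 0 < j → 0 < k → u (j + k) ≤ u j * u k) → Tendsto u atTop (𝓝 0) →
      ∃ p : ℕ, ∀ p' ≥ p, 0 < p' → ∀ k, u k ≤ (2 * c + 2) * ((1 / 2 : ℝ) ^ (k / p')) := by
    intro u h0 hub hsub hlim
    obtain ⟨p, hp⟩ := eventually_atTop.1 ((tendsto_order.1 hlim).2 (1 / 2) (by norm_num))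
    refine ⟨p, fun p' hp' hpos k => ?_⟩
    have hq : ∀ q r, r < p' → u (q * p' + r) ≤ (2 * c + 2) * ((1 / 2 : ℝ) ^ q) := by
      intro q
      induction q with
      | zero => intro r _; simpa using (hub _).trans (by linarith)
      | succ q ih =>
        intro r hr
        have e : (q + 1) * p' + r = p' + (q * p' + r) := by ring
        rcases Nat.eq_zero_or_pos (q * p' + r) with h | h
        · have hq0 : q = 0 := by
            rcases Nat.eq_zero_or_pos q with h' | h'
            · exact h'
            · have := Nat.mul_pos h' hpos; omega
          subst hq0
          rw [e, h, add_zero]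
          have := (hp p' hp').le
          simp only [zero_add, pow_one]
          linarith
        · rw [e, pow_succ]
          have h1 := hsub p' _ hpos h
          have h2 := ih r hr
          have h3 := (hp p' hp').le
          have h4 : u p' * u (q * p' + r) ≤ 1 / 2 * ((2 * c + 2) * (1 / 2) ^ q) := by
            gcongr
            exact h0 _
          linarith
    have := hq (k / p') (k % p') (Nat.mod_lt _ hpos)
    rwa [Nat.div_add_mod' k p'] at this
  obtain ⟨p₁, h₁⟩ := key (fun k => ‖G k‖) (fun _ => norm_nonneg _) (fun k => hG.bound _)
    (fun j k _ _ => by rw [← hG.mul_natCast]; exact norm_mul_le _ _) hG.tendsto_natCast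
  obtain ⟨p₂, h₂⟩ := key (fun k => ‖G (-k)‖) (fun _ => norm_nonneg _) (fun k => hG.bound _)
    (fun j k hj hk => by
      have := hG.mul_neg_natCast hj hk
      rw [← norm_neg, ← this]; exact norm_mul_le _ _) hG.tendsto_neg_natCast
  -- One `p` serves both directions since `key` holds for every larger time. Below, `lam ^ p = 1/2`,
  -- and rounding `k / p` down costs a factor `2`.
  set p := max (max p₁ p₂) 1 with hp
  have hp0 : 0 < p := by omega
  set lam : ℝ := (1 / 2 : ℝ) ^ ((p : ℝ)⁻¹) with hlam
  have hlam0 : 0 < lam := by positivity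
  have hlp : lam ^ p = 1 / 2 := Real.rpow_inv_natCast_pow (by norm_num) hp0.ne'
  have hlam1 : lam < 1 := Real.rpow_lt_one (by norm_num) (by norm_num) (by positivity)
  have hle : ∀ k, (1 / 2 : ℝ) ^ (k / p) ≤ 2 * lam ^ k := by
    intro k
    have h1 : lam ^ k = (1 / 2) ^ (k / p) * lam ^ (k % p) := by
      rw [← hlp, ← pow_mul, ← pow_add, Nat.div_add_mod]
    have h2 : lam ^ p ≤ lam ^ (k % p) :=
      pow_le_pow_of_le_one hlam0.le hlam1.le (Nat.mod_lt _ hp0).le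
    rw [h1]
    rw [hlp] at h2
    have h3 : (0 : ℝ) < (1 / 2) ^ (k / p) := by positivity
    nlinarith
  refine ⟨(2 * c + 2) * 2, lam, by positivity, hlam0, hlam1, fun k => ⟨?_, ?_⟩⟩
  · refine (h₁ p (by omega) hp0 k).trans ?_
    rw [mul_assoc]
    gcongr
    exact hle k
  · refine (h₂ p (by omega) hp0 k).trans ?_
    rw [mul_assoc]
    gcongr
    exact hle k

end IsGreenFamily

/-! ### A quantitative fixed point theorem with parameters -/

section AbstractFixedPoint

variable {𝓧 𝓕 : Type*} [NormedAddCommGroup 𝓧] [NormedSpace ℝ 𝓧]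
  [NormedAddCommGroup 𝓕] [NormedSpace ℝ 𝓕]

/-- An invertible operator perturbed by less than half the inverse norm of its inverse. -/
theorem exists_inverse_of_norm_sub_le {𝓐 : Type*} [NormedRing 𝓐] [CompleteSpace 𝓐]
    {a b L : 𝓐} {c : ℝ} (hL : L * a = 1) (hL' : a * L = 1) (hc : ‖L‖ ≤ c)
    (hab : ‖b - a‖ * c ≤ 1 / 2) : ∃ L' : 𝓐, L' * b = 1 ∧ b * L' = 1 ∧ ‖L'‖ ≤ 2 * c := by
  have h1 : ‖L * (a - b)‖ < 1 := by
    calc _ ≤ ‖L‖ * ‖a - b‖ := norm_mul_le _ _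
      _ ≤ c * ‖a - b‖ := by gcongr
      _ < 1 := by rw [norm_sub_rev, mul_comm]; linarith
  set u := Units.oneSub _ h1 with hu
  have hb : b = a * u := by
    rw [hu, Units.val_oneSub, mul_sub, mul_one, ← mul_assoc, hL', one_mul, sub_sub_cancel]
  have e1 : (↑u⁻¹ * L) * b = 1 := by
    rw [hb, mul_assoc, ← mul_assoc L, hL, one_mul, Units.inv_mul]
  have e2 : b * (↑u⁻¹ * L) = 1 := by
    rw [hb, mul_assoc, ← mul_assoc (u : 𝓐), Units.mul_inv, one_mul, hL']
  refine ⟨↑u⁻¹ * L, e1, e2, ?_⟩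
  set L' := (↑u⁻¹ * L : 𝓐)
  -- The Neumann series gives the inverse; this identity, with the last term absorbed, gives its
  -- explicit bound.
  have e3 : L' = L + L * (a - b) * L' := by
    rw [mul_sub, sub_mul, hL, one_mul, mul_assoc, e2, mul_one]; abel
  have h2 : ‖L'‖ ≤ c + 1 / 2 * ‖L'‖ := by
    calc ‖L'‖ = ‖L + L * (a - b) * L'‖ := by rw [← e3]
      _ ≤ ‖L‖ + ‖L * (a - b)‖ * ‖L'‖ :=
        (norm_add_le _ _).trans (add_le_add le_rfl (norm_mul_le _ _))
      _ ≤ c + 1 / 2 * ‖L'‖ := by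
        gcongr
        calc _ ≤ ‖L‖ * ‖a - b‖ := norm_mul_le _ _
          _ ≤ c * ‖a - b‖ := by gcongr
          _ ≤ _ := by rw [norm_sub_rev, mul_comm]; exact hab
  linarith

variable [CompleteSpace 𝓧]

/-- Existence and differentiable dependence on `G` of solutions of `e k G = k`, for `e` linear
in `G`. -/
theorem exists_contDiffOn_fixedPoint {e : 𝓧 → 𝓕 →L[ℝ] 𝓧} {m : 𝓧 → 𝓕 →L[ℝ] (𝓧 →L[ℝ] 𝓧)}
    {k₀ : 𝓧} {F : 𝓕} {δ τ ε c C₁ : ℝ} (hc : 0 < c) (hC₁ : 0 < C₁) (hτδ : τ ≤ δ) (hε : 0 ≤ ε)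
    (hετ : 2 * c * ε < τ)
    (hder : ∀ k ∈ Metric.ball k₀ δ, ∀ G, HasFDerivAt (fun k => e k G) (m k G) k)
    (he : ‖e k₀‖ ≤ C₁) (hm : ∀ k ∈ Metric.ball k₀ δ, ‖m k‖ ≤ C₁)
    (hmc : ∀ G, ContinuousOn (fun k => m k G) (Metric.ball k₀ δ))
    (hmF : ∀ k ∈ Metric.ball k₀ τ, ‖m k F - m k₀ F‖ ≤ (4 * c)⁻¹)
    {L : 𝓧 →L[ℝ] 𝓧} (hL : L * (m k₀ F - 1) = 1) (hL' : (m k₀ F - 1) * L = 1) (hLc : ‖L‖ ≤ c)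
    (hF : ‖e k₀ F - k₀‖ ≤ ε) :
    ∃ s > 0, ∃ 𝒦 : 𝓕 → 𝓧, ContDiffOn ℝ 1 𝒦 (Metric.ball F s) ∧
      (∀ G ∈ Metric.ball F s, 𝒦 G ∈ Metric.ball k₀ τ ∧ e (𝒦 G) G = 𝒦 G) ∧
      ‖𝒦 F - k₀‖ ≤ 2 * c * ε := by
  have hsub : Metric.ball k₀ τ ⊆ Metric.ball k₀ δ := Metric.ball_subset_ball hτδ
  have hτ : 0 < τ := lt_of_le_of_lt (by positivity) hετ
  -- Budget for the deviation of `m k G` from `m k₀ F`: `(4 * c)⁻¹` for moving `k` and `(8 * c)⁻¹`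
  -- for moving `G`, together less than `(2 * c)⁻¹`. The second condition keeps the solutions inside
  -- the ball of radius `τ`.
  obtain ⟨s, hs0, hs1, hs2⟩ : ∃ s > 0, C₁ * s ≤ (8 * c)⁻¹ ∧ 2 * c * (ε + C₁ * s) < τ := by
    have h1 : ∀ᶠ s in 𝓝[>] (0 : ℝ), C₁ * s ≤ (8 * c)⁻¹ := by
      refine Tendsto.eventually_le_const (v := 0) (by positivity) ?_
      have : Continuous fun s : ℝ => C₁ * s := by fun_prop
      simpa using (this.tendsto 0).mono_left nhdsWithin_le_nhds
    have h2 : ∀ᶠ s in 𝓝[>] (0 : ℝ), 2 * c * (ε + C₁ * s) < τ := by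
      refine Tendsto.eventually_lt_const hετ ?_
      have : Continuous fun s : ℝ => 2 * c * (ε + C₁ * s) := by fun_prop
      simpa using (this.tendsto 0).mono_left nhdsWithin_le_nhds
    obtain ⟨s, hs, hs'⟩ := ((h1.and h2).and self_mem_nhdsWithin).exists
    exact ⟨s, hs', hs⟩
  -- deviation of the derivative
  have hdev : ∀ G ∈ Metric.ball F s, ∀ k ∈ Metric.ball k₀ τ,
      ‖m k G - m k₀ F‖ ≤ (2 * c)⁻¹ := by
    intro G hG k hk
    have h1 : ‖m k (G - F)‖ ≤ C₁ * s := by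
      refine ((m k).le_opNorm _).trans ?_
      have := (mem_ball_iff_norm.1 hG).le
      gcongr
      exact hm k (hsub hk)
    have e1 : m k G - m k₀ F = (m k F - m k₀ F) + m k (G - F) := by rw [map_sub]; abel
    rw [e1]
    have h2 : (4 * c)⁻¹ + (8 * c)⁻¹ ≤ (2 * c)⁻¹ := by
      field_simp; norm_num
    linarith [norm_add_le (m k F - m k₀ F) (m k (G - F)), hmF k hk]
  have happ : ∀ G ∈ Metric.ball F s, ∀ k ∈ Metric.ball k₀ τ, ∀ k' ∈ Metric.ball k₀ τ,
      ‖e k G - e k' G - m k₀ F (k - k')‖ ≤ (2 * c)⁻¹ * ‖k - k'‖ := by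
    intro G hG k hk k' hk'
    exact (convex_ball k₀ τ).norm_image_sub_le_of_norm_hasFDerivWithin_le'
      (fun x hx => (hder x (hsub hx) G).hasFDerivWithinAt) (fun x hx => hdev G hG x hx) hk' hk
  have hLv : ∀ v, L (m k₀ F v - v) = v := fun v => by
    simpa using DFunLike.congr_fun hL v
  have hexp : ∀ v, ‖v‖ ≤ c * ‖m k₀ F v - v‖ := fun v => by
    calc ‖v‖ = ‖L (m k₀ F v - v)‖ := by rw [hLv]
      _ ≤ _ := (L.le_opNorm _).trans (by gcongr)
  have hball : ∀ {u}, u < τ → Metric.closedBall k₀ u ⊆ Metric.ball k₀ τ := fun h =>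
    Metric.closedBall_subset_ball h
  -- solutions
  have hex : ∀ G ∈ Metric.ball F s, ∃ k, ‖k - k₀‖ ≤ 2 * c * (ε + C₁ * ‖G - F‖) ∧ e k G = k := by
    intro G hG
    set u := 2 * c * (ε + C₁ * ‖G - F‖) with hu
    have hu0 : 0 ≤ u := by positivity
    have huτ : u < τ := by
      refine lt_of_le_of_lt ?_ hs2
      rw [hu]
      have := (mem_ball_iff_norm.1 hG).le
      gcongr
    have ha : ApproximatesLinearOn (fun k => e k G - k) (m k₀ F - 1) (Metric.ball k₀ τ)
        (Real.toNNReal (2 * c)⁻¹) := by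
      intro x hx y hy
      rw [Real.coe_toNNReal _ (by positivity)]
      convert happ G hG x hx y hy using 2
      simp
      abel
    let Linv : (m k₀ F - 1 : 𝓧 →L[ℝ] 𝓧).NonlinearRightInverse :=
      { toFun := L
        nnnorm := Real.toNNReal c
        bound' := fun y => by
          rw [Real.coe_toNNReal _ hc.le]
          exact (L.le_opNorm _).trans (by gcongr)
        right_inv' := fun y => by simpa using DFunLike.congr_fun hL' y }
    have hsurj := ha.surjOn_closedBall_of_nonlinearRightInverse Linv hu0 (hball huτ)
    have h0 : (0 : 𝓧) ∈ Metric.closedBall (e k₀ G - k₀)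
        (((Linv.nnnorm : ℝ)⁻¹ - Real.toNNReal (2 * c)⁻¹) * u) := by
      have e2 : (Linv.nnnorm : ℝ) = c := Real.coe_toNNReal _ hc.le
      rw [mem_closedBall_iff_norm, e2, Real.coe_toNNReal _ (by positivity), zero_sub, norm_neg]
      have e3 : (c⁻¹ - (2 * c)⁻¹) * u = ε + C₁ * ‖G - F‖ := by
        rw [hu]; field_simp; ring
      rw [e3]
      have e4 : e k₀ G - k₀ = (e k₀ F - k₀) + e k₀ (G - F) := by rw [map_sub]; abel
      rw [e4]
      refine (norm_add_le _ _).trans (add_le_add hF ((e k₀).le_opNorm _ |>.trans ?_))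
      gcongr
    obtain ⟨k, hk, hk0⟩ := hsurj h0
    exact ⟨k, mem_closedBall_iff_norm.1 hk, sub_eq_zero.1 hk0⟩
  choose! 𝒦 h𝒦 h𝒦e using hex
  have hmem : ∀ G ∈ Metric.ball F s, 𝒦 G ∈ Metric.ball k₀ τ := by
    intro G hG
    rw [mem_ball_iff_norm]
    refine (h𝒦 G hG).trans_lt (lt_of_le_of_lt ?_ hs2)
    have := (mem_ball_iff_norm.1 hG).le
    gcongr
  have helip : ∀ k ∈ Metric.ball k₀ τ, ∀ k' ∈ Metric.ball k₀ τ, ∀ G,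
      ‖e k' G - e k G‖ ≤ C₁ * ‖G‖ * ‖k' - k‖ := by
    intro k hk k' hk' G
    exact (convex_ball k₀ τ).norm_image_sub_le_of_norm_hasFDerivWithin_le
      (fun x hx => (hder x (hsub hx) G).hasFDerivWithinAt)
      (fun x hx => ((m x).le_opNorm G).trans (by gcongr; exact hm x (hsub hx))) hk hk'
  -- Lipschitz dependence
  have hlip : ∀ G ∈ Metric.ball F s, ∀ G' ∈ Metric.ball F s,
      ‖𝒦 G' - 𝒦 G‖ ≤ 2 * c * ‖e (𝒦 G)‖ * ‖G' - G‖ := by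
    intro G hG G' hG'
    have h1 := happ G' hG' _ (hmem G' hG') _ (hmem G hG)
    have h2 := hexp (𝒦 G' - 𝒦 G)
    have e1 : m k₀ F (𝒦 G' - 𝒦 G) - (𝒦 G' - 𝒦 G)
        = -(e (𝒦 G') G' - e (𝒦 G) G' - m k₀ F (𝒦 G' - 𝒦 G)) - e (𝒦 G) (G' - G) := by
      rw [map_sub (e (𝒦 G)), h𝒦e G hG, h𝒦e G' hG']; abel
    rw [e1] at h2
    have h3 := norm_sub_le (-(e (𝒦 G') G' - e (𝒦 G) G' - m k₀ F (𝒦 G' - 𝒦 G)))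
      (e (𝒦 G) (G' - G))
    rw [norm_neg] at h3
    have h4 := (e (𝒦 G)).le_opNorm (G' - G)
    have h5 : ‖𝒦 G' - 𝒦 G‖ ≤ c * ((2 * c)⁻¹ * ‖𝒦 G' - 𝒦 G‖ + ‖e (𝒦 G)‖ * ‖G' - G‖) :=
      h2.trans (by gcongr; linarith)
    have e2 : c * ((2 * c)⁻¹ * ‖𝒦 G' - 𝒦 G‖ + ‖e (𝒦 G)‖ * ‖G' - G‖)
        = ‖𝒦 G' - 𝒦 G‖ / 2 + c * (‖e (𝒦 G)‖ * ‖G' - G‖) := by field_simp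
    rw [e2] at h5
    linarith
  have hcont : ∀ G ∈ Metric.ball F s, ContinuousAt 𝒦 G := by
    intro G hG
    rw [ContinuousAt, tendsto_iff_norm_sub_tendsto_zero]
    have h1 : Tendsto (fun G' => 2 * c * ‖e (𝒦 G)‖ * ‖G' - G‖) (𝓝 G) (𝓝 0) := by
      have : Continuous fun G' => 2 * c * ‖e (𝒦 G)‖ * ‖G' - G‖ := by fun_prop
      simpa using this.tendsto G
    refine squeeze_zero' (Eventually.of_forall fun _ => norm_nonneg _) ?_ h1
    filter_upwards [Metric.isOpen_ball.mem_nhds hG] with G' hG' using hlip G hG G' hG'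
  -- the inverse of the linearization
  have hinv : ∀ G ∈ Metric.ball F s, ∃ L' : 𝓧 →L[ℝ] 𝓧, L' * (m (𝒦 G) G - 1) = 1 ∧
      (m (𝒦 G) G - 1) * L' = 1 ∧ ‖L'‖ ≤ 2 * c := by
    intro G hG
    refine exists_inverse_of_norm_sub_le hL hL' hLc ?_
    rw [sub_sub_sub_cancel_right]
    have := hdev G hG _ (hmem G hG)
    calc _ ≤ (2 * c)⁻¹ * c := by gcongr
      _ = 1 / 2 := by field_simp
  -- The formula is what differentiating `e (𝒦 G) G = 𝒦 G` gives.
  have hderiv : ∀ G ∈ Metric.ball F s, HasFDerivAt 𝒦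
      ((-(Ring.inverse (m (𝒦 G) G - 1))) ∘L e (𝒦 G)) G := by
    intro G hG
    obtain ⟨L', h1, h2, h3⟩ := hinv G hG
    have hR : Ring.inverse (m (𝒦 G) G - 1) = L' :=
      Ring.inverse_unit ⟨m (𝒦 G) G - 1, L', h2, h1⟩
    rw [hR, hasFDerivAt_iff_isLittleO]
    set k := 𝒦 G with hk
    have hO : (fun G' => 𝒦 G' - k) =O[𝓝 G] fun G' => G' - G := by
      refine Asymptotics.IsBigO.of_bound (2 * c * ‖e k‖) ?_
      filter_upwards [Metric.isOpen_ball.mem_nhds hG] with G' hG' using hlip G hG G' hG'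
    have hd := (hasFDerivAt_iff_isLittleO.1 (hder k (hsub (hmem G hG)) G)).comp_tendsto (hcont G hG)
    have hd1 : (fun G' => e (𝒦 G') G - e k G - m k G (𝒦 G' - k)) =o[𝓝 G] fun G' => G' - G :=
      hd.trans_isBigO hO
    -- By linearity of `e` in `G` the mixed increment is bounded by a product of two small factors.
    have hd2 : (fun G' => e (𝒦 G') (G' - G) - e k (G' - G)) =o[𝓝 G] fun G' => G' - G := by
      have hb : (fun G' => e (𝒦 G') (G' - G) - e k (G' - G)) =O[𝓝 G]
          fun G' => ‖G' - G‖ * ‖𝒦 G' - k‖ := by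
        refine Asymptotics.IsBigO.of_bound C₁ ?_
        filter_upwards [Metric.isOpen_ball.mem_nhds hG] with G' hG'
        rw [norm_mul, norm_norm, norm_norm, ← mul_assoc]
        exact helip _ (hmem G hG) _ (hmem G' hG') _
      refine hb.trans_isLittleO ?_
      have h4 : (fun G' => ‖𝒦 G' - k‖) =o[𝓝 G] fun _ => (1 : ℝ) := by
        rw [Asymptotics.isLittleO_one_iff]
        exact tendsto_iff_norm_sub_tendsto_zero.1 (hcont G hG)
      have h5 := (Asymptotics.isBigO_refl (fun G' => ‖G' - G‖) (𝓝 G)).mul_isLittleO h4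
      simp only [mul_one] at h5
      exact h5.trans_isBigO (Asymptotics.isBigO_refl _ _).norm_left
    have hd3 := (L'.isBigO_comp (fun G' => (e (𝒦 G') G - e k G - m k G (𝒦 G' - k))
      + (e (𝒦 G') (G' - G) - e k (G' - G))) (𝓝 G)).trans_isLittleO (hd1.add hd2)
    refine (hd3.neg_left).congr' ?_ EventuallyEq.rfl
    filter_upwards [Metric.isOpen_ball.mem_nhds hG] with G' hG'
    have hLv' : ∀ v, L' (m k G v - v) = v := fun v => by
      simpa using DFunLike.congr_fun h1 v
    have e1 := hLv' (𝒦 G' - k)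
    have e2 : e (𝒦 G') G - e k G - m k G (𝒦 G' - k) + (e (𝒦 G') (G' - G) - e k (G' - G))
        = -(m k G (𝒦 G' - k) - (𝒦 G' - k)) - e k (G' - G) := by
      rw [map_sub (e (𝒦 G')), h𝒦e G' hG', h𝒦e G hG]; abel
    rw [e2, map_sub, map_neg, e1]
    simp
    abel
  have hderc : ContinuousOn (fun G => (-(Ring.inverse (m (𝒦 G) G - 1))) ∘L e (𝒦 G))
      (Metric.ball F s) := by
    intro G hG
    refine ContinuousAt.continuousWithinAt ?_
    obtain ⟨L', h1, h2, h3⟩ := hinv G hG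
    have hk := hsub (hmem G hG)
    -- The map `k ↦ m k` is continuous only at each fixed `G`, not in operator norm. The uniform
    -- bound `C₁` deals with the increment of `G`.
    have c1 : ContinuousAt (fun G => m (𝒦 G) G) G := by
      have e1 : ∀ G', m (𝒦 G') G' = m (𝒦 G') G + m (𝒦 G') (G' - G) := fun G' => by
        rw [map_sub]; abel
      simp only [e1]
      have a1 : Tendsto (fun G' => m (𝒦 G') G) (𝓝 G) (𝓝 (m (𝒦 G) G)) :=
        (((hmc G).continuousAt (Metric.isOpen_ball.mem_nhds hk)).tendsto).comp (hcont G hG)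
      have a2 : Tendsto (fun G' => m (𝒦 G') (G' - G)) (𝓝 G) (𝓝 0) := by
        have : Tendsto (fun G' => C₁ * ‖G' - G‖) (𝓝 G) (𝓝 0) := by
          have : Continuous fun G' => C₁ * ‖G' - G‖ := by fun_prop
          simpa using this.tendsto G
        refine squeeze_zero_norm' ?_ this
        filter_upwards [Metric.isOpen_ball.mem_nhds hG] with G' hG'
        refine ((m (𝒦 G')).le_opNorm _).trans ?_
        gcongr
        exact hm _ (hsub (hmem G' hG'))
      unfold ContinuousAt
      simpa using a1.add a2
    have c2 : ContinuousAt (fun G => Ring.inverse (m (𝒦 G) G - 1)) G := by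
      have := NormedRing.inverse_continuousAt (⟨m (𝒦 G) G - 1, L', h2, h1⟩ : (𝓧 →L[ℝ] 𝓧)ˣ)
      exact ContinuousAt.comp (f := fun G => m (𝒦 G) G - 1) (g := Ring.inverse) this
        (c1.sub continuousAt_const)
    have c3 : ContinuousAt (fun G => e (𝒦 G)) G := by
      rw [ContinuousAt, tendsto_iff_norm_sub_tendsto_zero]
      have h1 : Tendsto (fun G' => C₁ * ‖𝒦 G' - 𝒦 G‖) (𝓝 G) (𝓝 0) := by
        simpa using (tendsto_iff_norm_sub_tendsto_zero.1 (hcont G hG)).const_mul C₁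
      refine squeeze_zero' (Eventually.of_forall fun _ => norm_nonneg _) ?_ h1
      filter_upwards [Metric.isOpen_ball.mem_nhds hG] with G' hG'
      refine ContinuousLinearMap.opNorm_le_bound _ (by positivity) fun H => ?_
      have := helip _ (hmem G hG) _ (hmem G' hG') H
      rw [sub_apply]
      linarith
    exact c2.neg.clm_comp c3
  refine ⟨s, hs0, 𝒦, ?_, fun G hG => ⟨hmem G hG, h𝒦e G hG⟩, ?_⟩
  · rw [show (1 : WithTop ℕ∞) = 0 + 1 from rfl,
      contDiffOn_succ_iff_fderiv_of_isOpen Metric.isOpen_ball]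
    refine ⟨fun G hG => (hderiv G hG).differentiableAt.differentiableWithinAt, by simp, ?_⟩
    exact contDiffOn_zero.2 <| hderc.congr fun G hG => (hderiv G hG).fderiv
  · simpa using h𝒦 F (Metric.mem_ball_self hs0)

end AbstractFixedPoint

/-! ### Mixed partial derivatives and their interchange -/

section MixedDerivatives

variable {E X V W : Type*} [NormedAddCommGroup E] [NormedSpace ℝ E] [NormedAddCommGroup X]
  [NormedSpace ℝ X] [NormedAddCommGroup V] [NormedSpace ℝ V] [NormedAddCommGroup W]
  [NormedSpace ℝ W]

/-- Evaluation of the last argument of a multilinear map at `a`. -/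
noncomputable def evalLast (V : Type*) [NormedAddCommGroup V] [NormedSpace ℝ V] (n : ℕ) (a : E) :
    ContinuousMultilinearMap ℝ (fun _ : Fin (n + 1) => E) V →L[ℝ]
      ContinuousMultilinearMap ℝ (fun _ : Fin n => E) V :=
  (ContinuousLinearMap.compContinuousMultilinearMapL ℝ (fun _ : Fin n => E) (E →L[ℝ] V) V
    (ContinuousLinearMap.apply ℝ V a)) ∘L
    ((continuousMultilinearCurryRightEquiv' ℝ n E V).toContinuousLinearEquiv :
      ContinuousMultilinearMap ℝ (fun _ : Fin (n + 1) => E) V →L[ℝ] _)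

theorem norm_evalLast_apply_le (n : ℕ) (a : E)
    (T : ContinuousMultilinearMap ℝ (fun _ : Fin (n + 1) => E) V) :
    ‖evalLast V n a T‖ ≤ ‖a‖ * ‖T‖ := by
  have h1 := (ContinuousLinearMap.apply ℝ V a).norm_compContinuousMultilinearMap_le
    (continuousMultilinearCurryRightEquiv' ℝ n E V T)
  rw [LinearIsometryEquiv.norm_map] at h1
  have h2 : ‖ContinuousLinearMap.apply ℝ V a‖ ≤ ‖a‖ :=
    ContinuousLinearMap.opNorm_le_bound _ (norm_nonneg a) fun L => by
      rw [mul_comm]; exact L.le_opNorm a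
  exact h1.trans (by gcongr)

theorem iteratedFDeriv_fderiv_apply {f : E → V} {x : E} {n : ℕ} {N : WithTop ℕ∞}
    (hf : ContDiffAt ℝ N f x) (hn : (n + 1 : ℕ) ≤ N) (a : E) :
    iteratedFDeriv ℝ n (fun y => fderiv ℝ f y a) x
      = evalLast V n a (iteratedFDeriv ℝ (n + 1) f x) := by
  have h1 : ContDiffAt ℝ n (fderiv ℝ f) x := hf.fderiv_right (by exact_mod_cast hn)
  have h2 := (ContinuousLinearMap.apply ℝ V a).iteratedFDeriv_comp_left h1 le_rfl
  rw [iteratedFDeriv_succ_eq_comp_right]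
  change iteratedFDeriv ℝ n (⇑(ContinuousLinearMap.apply ℝ V a) ∘ fderiv ℝ f) x = _
  rw [h2]
  change _ = (ContinuousLinearMap.apply ℝ V a).compContinuousMultilinearMap
    (continuousMultilinearCurryRightEquiv' ℝ n E V
      ((continuousMultilinearCurryRightEquiv' ℝ n E V).symm _))
  rw [LinearIsometryEquiv.apply_symm_apply]

theorem curryFin1_iteratedFDeriv_one (f : E → V) (x : E) :
    continuousMultilinearCurryFin1 ℝ E V (iteratedFDeriv ℝ 1 f x) = fderiv ℝ f x := by
  ext v
  simp

theorem HasFDerivAt.clm_comp_left (L : V →L[ℝ] W) {f : E → V} {f' : E →L[ℝ] V} {x : E}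
    (hf : HasFDerivAt f f' x) : HasFDerivAt (fun x => L (f x)) (L ∘L f') x :=
  L.hasFDerivAt.comp x hf

theorem ContinuousOn.clm_comp_left {Y : Type*} [TopologicalSpace Y] (L : V →L[ℝ] W)
    {f : Y → E →L[ℝ] V} {s : Set Y} (hf : ContinuousOn f s) :
    ContinuousOn (fun q => L ∘L f q) s :=
  continuousOn_const.clm_comp hf

theorem ContinuousAt.exists_norm_sub_lt {Y : Type*} [PseudoMetricSpace Y] {f : Y → V} {y : Y}
    (hf : ContinuousAt f y) {ε : ℝ} (hε : 0 < ε) :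
    ∃ η > 0, ∀ q, dist q y < η → ‖f q - f y‖ < ε := by
  simpa only [dist_eq_norm] using Metric.continuousAt_iff.1 hf ε hε

/-- Interchange of partial derivatives: if `g` has a `z`-derivative `D`, if `g` and `D` are
differentiable in `x` and `D_x D` is continuous, then `D_x g` is differentiable in `z`, with
derivative `D_x D` up to the order of arguments. -/
theorem hasFDerivAt_fderiv_swap {U : Set E} (hU : IsOpen U) {g : E → X → V}
    {D : E → X → E →L[ℝ] V} (h1 : ∀ z ∈ U, ∀ x, HasFDerivAt (fun z => g z x) (D z x) z)
    (h2 : ∀ z ∈ U, Differentiable ℝ (g z)) (h3 : ∀ z ∈ U, Differentiable ℝ (D z))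
    (h4 : ContinuousOn (fun q : E × X => fderiv ℝ (D q.1) q.2) (U ×ˢ univ)) {z : E} (hz : z ∈ U)
    (x : X) :
    HasFDerivAt (fun z' => fderiv ℝ (g z') x) ((fderiv ℝ (D z) x).flip) z := by
  rw [hasFDerivAt_iff_isLittleO, Asymptotics.isLittleO_iff]
  intro ε hε
  have hc : ContinuousAt (fun q : E × X => fderiv ℝ (D q.1) q.2) (z, x) :=
    h4.continuousAt ((hU.prod isOpen_univ).mem_nhds ⟨hz, mem_univ _⟩)
  obtain ⟨η₁, hη₁, hUb⟩ := Metric.isOpen_iff.1 hU z hz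
  obtain ⟨η₂, hη₂, hb⟩ := ContinuousAt.exists_norm_sub_lt (V := X →L[ℝ] E →L[ℝ] V) hc
    (half_pos hε)
  set η := min η₁ η₂
  have hη : 0 < η := lt_min hη₁ hη₂
  have hzU : Metric.ball z η ⊆ U := (Metric.ball_subset_ball (min_le_left _ _)).trans hUb
  have hclose : ∀ w ∈ Metric.ball z η, ∀ y ∈ Metric.ball x η,
      ‖fderiv ℝ (D w) y - fderiv ℝ (D z) y‖ ≤ ε := by
    intro w hw y hy
    have hw' := lt_of_lt_of_le (Metric.mem_ball.1 hw) (min_le_right η₁ η₂)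
    have hy' := lt_of_lt_of_le (Metric.mem_ball.1 hy) (min_le_right η₁ η₂)
    have a1 := hb (w, y) (by rw [Prod.dist_eq]; exact max_lt hw' hy')
    have a2 := hb (z, y) (by rw [Prod.dist_eq]; exact max_lt (by simpa using hη₂) hy')
    have e1 : fderiv ℝ (D w) y - fderiv ℝ (D z) y
        = (fderiv ℝ (D w) y - fderiv ℝ (D z) x) - (fderiv ℝ (D z) y - fderiv ℝ (D z) x) := by abel
    rw [e1]
    have := norm_sub_le (fderiv ℝ (D w) y - fderiv ℝ (D z) x)
      (fderiv ℝ (D z) y - fderiv ℝ (D z) x)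
    linarith
  filter_upwards [Metric.ball_mem_nhds z hη] with z' hz'
  -- The error of the candidate derivative is the `x`-derivative of this function, so a Lipschitz
  -- bound for the function near `x` controls it. That bound takes two mean value inequalities: in
  -- `x` for `D`, then in `z` for `g`.
  have hξ : HasFDerivAt (fun y => g z' y - g z y - D z y (z' - z))
      (fderiv ℝ (g z') x - fderiv ℝ (g z) x - (fderiv ℝ (D z) x).flip (z' - z)) x := by
    refine ((h2 z' (hzU hz') x).hasFDerivAt.sub (h2 z hz x).hasFDerivAt).sub ?_
    have := (h3 z hz x).hasFDerivAt.clm_apply (hasFDerivAt_const (z' - z) x)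
    simpa using this
  refine hξ.le_of_lip' (by positivity) ?_
  filter_upwards [Metric.ball_mem_nhds x hη] with y hy
  have hxb : x ∈ Metric.ball x η := Metric.mem_ball_self hη
  have hzb : z ∈ Metric.ball z η := Metric.mem_ball_self hη
  have hinner : ∀ w ∈ Metric.ball z η, ‖(D w y - D w x) - (D z y - D z x)‖ ≤ ε * ‖y - x‖ := by
    intro w hw
    have := (convex_ball x η).norm_image_sub_le_of_norm_hasFDerivWithin_le (C := ε)
      (f := fun y => D w y - D z y)
      (fun v _ => ((h3 w (hzU hw) v).hasFDerivAt.sub (h3 z hz v).hasFDerivAt).hasFDerivWithinAt)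
      (fun v hv => hclose w hw v hv) hxb hy
    rwa [sub_sub_sub_comm] at this
  have := (convex_ball z η).norm_image_sub_le_of_norm_hasFDerivWithin_le'
    (f := fun w => g w y - g w x) (φ := D z y - D z x)
    (fun w hw => ((h1 w (hzU hw) y).sub (h1 w (hzU hw) x)).hasFDerivWithinAt) hinner hzb hz'
  calc _ = ‖g z' y - g z' x - (g z y - g z x) - (D z y - D z x) (z' - z)‖ := by
        congr 1
        simp
        abel
    _ ≤ _ := this
    _ = _ := by ring

/-- `D_x^i D_z^j g (z, x)`. -/
noncomputable def mixedD (i j : ℕ) (g : E → X → V) (z : E) (x : X) :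
    ContinuousMultilinearMap ℝ (fun _ : Fin i => X)
      (ContinuousMultilinearMap ℝ (fun _ : Fin j => E) V) :=
  iteratedFDeriv ℝ i (fun x' => iteratedFDeriv ℝ j (fun z' => g z' x') z) x

/-- `g` has continuous mixed derivatives of the orders in `S`, bounded by `A` on `U`. -/
structure MixedRegular (S : Set (ℕ × ℕ)) (U : Set E) (A : ℝ) (g : E → X → V) : Prop where
  diff_z : ∀ p ∈ S, ∀ x, ∀ z ∈ U, ContDiffAt ℝ p.2 (fun z' => g z' x) z
  diff_x : ∀ p ∈ S, ∀ z ∈ U, ContDiff ℝ p.1 fun x => iteratedFDeriv ℝ p.2 (fun z' => g z' x) z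
  cont : ∀ p ∈ S, ContinuousOn (fun q : E × X => mixedD p.1 p.2 g q.1 q.2) (U ×ˢ univ)
  bound : ∀ p ∈ S, ∀ z ∈ U, ∀ x, ‖mixedD p.1 p.2 g z x‖ ≤ A

/-- The mixed derivatives of `g` of the orders in `S` vary by at most `R` in `z` on segments in
`U` of length at most `τ`. -/
def MixedModulus (S : Set (ℕ × ℕ)) (U : Set E) (τ R : ℝ) (g : E → X → V) : Prop :=
  ∀ p ∈ S, ∀ x, ∀ z w, segment ℝ z w ⊆ U → ‖z - w‖ ≤ τ →
    ‖mixedD p.1 p.2 g z x - mixedD p.1 p.2 g w x‖ ≤ R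

/-- The partial derivative of `g` in the `z`-direction `a`. -/
noncomputable def derivZ (a : E) (g : E → X → V) (z : E) (x : X) : V :=
  fderiv ℝ (fun z' => g z' x) z a

/-- The partial derivative of `g` in the `x`-direction `b`. -/
noncomputable def derivX (b : X) (g : E → X → V) (z : E) (x : X) : V :=
  fderiv ℝ (g z) x b

variable {S S' : Set (ℕ × ℕ)} {U : Set E} {A τ R : ℝ} {g : E → X → V}

theorem MixedRegular.mono (hg : MixedRegular S U A g) (h : S' ⊆ S) : MixedRegular S' U A g where
  diff_z p hp := hg.diff_z p (h hp)
  diff_x p hp := hg.diff_x p (h hp)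
  cont p hp := hg.cont p (h hp)
  bound p hp := hg.bound p (h hp)

theorem MixedModulus.mono (hg : MixedModulus S U τ R g) (h : S' ⊆ S) : MixedModulus S' U τ R g :=
  fun p hp => hg p (h hp)

theorem mixedD_derivZ {i j : ℕ} {z : E} (h : ∀ x, ContDiffAt ℝ (j + 1 : ℕ) (fun z' => g z' x) z)
    (h' : ContDiff ℝ i fun x => iteratedFDeriv ℝ (j + 1) (fun z' => g z' x) z) (a : E) (x : X) :
    mixedD i j (derivZ a g) z x
      = (evalLast V j a).compContinuousMultilinearMap (mixedD i (j + 1) g z x) := by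
  unfold mixedD derivZ
  have h1 : (fun x' => iteratedFDeriv ℝ j (fun z' => fderiv ℝ (fun z' => g z' x') z' a) z)
      = evalLast V j a ∘ fun x' => iteratedFDeriv ℝ (j + 1) (fun z' => g z' x') z := by
    funext x'
    exact iteratedFDeriv_fderiv_apply (h x') le_rfl a
  rw [h1]
  exact (evalLast V j a).iteratedFDeriv_comp_left h'.contDiffAt le_rfl

theorem norm_evalLast_comp_le (i j : ℕ) {a : E} (ha : ‖a‖ ≤ 1)
    (T : ContinuousMultilinearMap ℝ (fun _ : Fin i => X)
      (ContinuousMultilinearMap ℝ (fun _ : Fin (j + 1) => E) V)) :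
    ‖(evalLast V j a).compContinuousMultilinearMap T‖ ≤ ‖T‖ := by
  refine ((evalLast V j a).norm_compContinuousMultilinearMap_le T).trans ?_
  have : ‖evalLast V j a‖ ≤ 1 := ContinuousLinearMap.opNorm_le_bound _ zero_le_one fun T =>
    (norm_evalLast_apply_le j a T).trans (by gcongr)
  exact mul_le_of_le_one_left (norm_nonneg _) this

theorem MixedRegular.derivZ (hU : IsOpen U) (hg : MixedRegular S U A g)
    (hS : ∀ p ∈ S', (p.1, p.2 + 1) ∈ S) {a : E} (ha : ‖a‖ ≤ 1) :
    MixedRegular S' U A (derivZ a g) := by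
  have key : ∀ p ∈ S', ∀ z ∈ U, ∀ x, mixedD p.1 p.2 (_root_.derivZ a g) z x
      = (evalLast V p.2 a).compContinuousMultilinearMap (mixedD p.1 (p.2 + 1) g z x) :=
    fun p hp z hz x => mixedD_derivZ (fun x => hg.diff_z _ (hS p hp) x z hz)
      (hg.diff_x _ (hS p hp) z hz) a x
  refine ⟨fun p hp x z hz => ?_, fun p hp z hz => ?_, fun p hp => ?_, fun p hp z hz x => ?_⟩
  · exact ((hg.diff_z _ (hS p hp) x z hz).fderiv_right (by norm_cast)).clm_apply contDiffAt_const
  · have h1 : (fun x => iteratedFDeriv ℝ p.2 (fun z' => _root_.derivZ a g z' x) z)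
        = evalLast V p.2 a ∘ fun x' => iteratedFDeriv ℝ (p.2 + 1) (fun z' => g z' x') z := by
      funext x'
      exact iteratedFDeriv_fderiv_apply (hg.diff_z _ (hS p hp) x' z hz) le_rfl a
    rw [h1]
    exact (evalLast V p.2 a).contDiff.comp (hg.diff_x _ (hS p hp) z hz)
  · refine ContinuousOn.congr ?_ fun q hq => key p hp q.1 hq.1 q.2
    exact (ContinuousLinearMap.compContinuousMultilinearMapL ℝ (fun _ : Fin p.1 => X) _ _
      (evalLast V p.2 a)).continuous.comp_continuousOn (hg.cont _ (hS p hp))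
  · rw [key p hp z hz]
    exact (norm_evalLast_comp_le _ _ ha _).trans (hg.bound _ (hS p hp) z hz x)

theorem MixedModulus.derivZ (hg : MixedRegular S U A g) (hm : MixedModulus S U τ R g)
    (hS : ∀ p ∈ S', (p.1, p.2 + 1) ∈ S) {a : E} (ha : ‖a‖ ≤ 1) :
    MixedModulus S' U τ R (derivZ a g) := by
  have key : ∀ p ∈ S', ∀ z ∈ U, ∀ x, mixedD p.1 p.2 (_root_.derivZ a g) z x
      = (evalLast V p.2 a).compContinuousMultilinearMap (mixedD p.1 (p.2 + 1) g z x) :=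
    fun p hp z hz x => mixedD_derivZ (fun x => hg.diff_z _ (hS p hp) x z hz)
      (hg.diff_x _ (hS p hp) z hz) a x
  intro p hp x z w hzw hτ
  rw [key p hp z (hzw (left_mem_segment ℝ z w)), key p hp w (hzw (right_mem_segment ℝ z w))]
  have := norm_evalLast_comp_le p.1 p.2 ha
    (mixedD p.1 (p.2 + 1) g z x - mixedD p.1 (p.2 + 1) g w x)
  refine le_trans (le_of_eq ?_) (this.trans (hm _ (hS p hp) x z w hzw hτ))
  congr 1

/-- Currying of the first argument, as a continuous linear map. -/
noncomputable def curryFirst (E V : Type*) [NormedAddCommGroup E] [NormedSpace ℝ E]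
    [NormedAddCommGroup V] [NormedSpace ℝ V] (j : ℕ) :
    ContinuousMultilinearMap ℝ (fun _ : Fin (j + 1) => E) V →L[ℝ]
      (E →L[ℝ] ContinuousMultilinearMap ℝ (fun _ : Fin j => E) V) :=
  (continuousMultilinearCurryLeftEquiv ℝ (fun _ : Fin (j + 1) => E) V).toContinuousLinearEquiv

/-- Uncurrying of the first argument, as a continuous linear map. -/
noncomputable def uncurryFirst (E V : Type*) [NormedAddCommGroup E] [NormedSpace ℝ E]
    [NormedAddCommGroup V] [NormedSpace ℝ V] (j : ℕ) :
    (E →L[ℝ] ContinuousMultilinearMap ℝ (fun _ : Fin j => E) V) →L[ℝ]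
      ContinuousMultilinearMap ℝ (fun _ : Fin (j + 1) => E) V :=
  (continuousMultilinearCurryLeftEquiv ℝ (fun _ : Fin (j + 1) => E)
    V).symm.toContinuousLinearEquiv

theorem iteratedFDeriv_succ_eq_uncurryFirst (f : E → V) (j : ℕ) (z : E) :
    iteratedFDeriv ℝ (j + 1) f z = uncurryFirst E V j (fderiv ℝ (iteratedFDeriv ℝ j f) z) := by
  rw [iteratedFDeriv_succ_eq_comp_left]
  rfl

theorem fderiv_iteratedFDeriv_eq_curryFirst (f : E → V) (j : ℕ) (z : E) :
    fderiv ℝ (iteratedFDeriv ℝ j f) z = curryFirst E V j (iteratedFDeriv ℝ (j + 1) f z) := by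
  rw [iteratedFDeriv_succ_eq_uncurryFirst]
  exact ((continuousMultilinearCurryLeftEquiv ℝ (fun _ : Fin (j + 1) => E)
    V).apply_symm_apply _).symm

/-- The interchange theorem applied to `D_z^j g`. The bound on `j` places `(1, j + 1)` in the index
set, which is the continuity needed there. -/
theorem hasFDerivAt_fderiv_iteratedFDeriv (hU : IsOpen U) {r s : ℕ}
    (hg : MixedRegular (sigmaSet (r + 1) s) U A g) {j : ℕ} (hj : j + 1 ≤ r + s)
    {z : E} (hz : z ∈ U) (x : X) :
    HasFDerivAt (fun z => fderiv ℝ (fun x => iteratedFDeriv ℝ j (fun z' => g z' x) z) x)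
      ((fderiv ℝ (fun x => fderiv ℝ (iteratedFDeriv ℝ j (fun z' => g z' x)) z) x).flip) z := by
  have m1 : ∀ k ≤ r + s, (1, k) ∈ sigmaSet (r + 1) s := fun k hk =>
    ⟨by simp, by simp only; omega⟩
  have m0 : ∀ k ≤ r + s + 1, (0, k) ∈ sigmaSet (r + 1) s := fun k hk =>
    ⟨by simp, by simp only; omega⟩
  have hdx : ∀ k ≤ r + s, ∀ z ∈ U,
      Differentiable ℝ fun x => iteratedFDeriv ℝ k (fun z' => g z' x) z :=
    fun k hk z hz => (hg.diff_x _ (m1 k hk) z hz).differentiable (by simp)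
  have hDx : ∀ z ∈ U, ∀ x, HasFDerivAt
      (fun x => fderiv ℝ (iteratedFDeriv ℝ j (fun z' => g z' x)) z)
      (curryFirst E V j ∘L
        (fderiv ℝ (fun x => iteratedFDeriv ℝ (j + 1) (fun z' => g z' x) z) x)) x := by
    intro z hz x
    simp only [fderiv_iteratedFDeriv_eq_curryFirst]
    exact HasFDerivAt.clm_comp_left
      (V := ContinuousMultilinearMap ℝ (fun _ : Fin (j + 1) => E) V)
      (W := E →L[ℝ] ContinuousMultilinearMap ℝ (fun _ : Fin j => E) V)
      (curryFirst E V j) (hdx _ hj z hz x).hasFDerivAt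
  refine hasFDerivAt_fderiv_swap (U := U) hU
    (g := fun z x => iteratedFDeriv ℝ j (fun z' => g z' x) z)
    (D := fun z x => fderiv ℝ (iteratedFDeriv ℝ j (fun z' => g z' x)) z)
    (fun z hz x => ?_) (fun z hz => hdx j (by omega) z hz)
    (fun z hz x => (hDx z hz x).differentiableAt) ?_ hz x
  · refine DifferentiableAt.hasFDerivAt ?_
    exact (hg.diff_z _ (m0 (j + 1) (by omega)) x z hz).differentiableAt_iteratedFDeriv
      (by exact_mod_cast Nat.lt_succ_self j)
  · have hc : ContinuousOn (fun q : E × X => fderiv ℝ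
        (fun x => iteratedFDeriv ℝ (j + 1) (fun z' => g z' x) q.1) q.2) (U ×ˢ univ) := by
      have := hg.cont _ (m1 (j + 1) hj)
      refine ((continuousMultilinearCurryFin1 ℝ X _).continuous.comp_continuousOn this).congr ?_
      intro q _
      exact (curryFin1_iteratedFDeriv_one _ _).symm
    have hc' := ContinuousOn.clm_comp_left
      (V := ContinuousMultilinearMap ℝ (fun _ : Fin (j + 1) => E) V)
      (W := E →L[ℝ] ContinuousMultilinearMap ℝ (fun _ : Fin j => E) V)
      (curryFirst E V j) hc
    exact hc'.congr fun q hq => (hDx q.1 hq.1 q.2).fderiv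

/-- Mixed derivatives are defined with the `z`-derivatives taken first, so a derivative in `x` taken
before them has to be moved outside, past one `z`-derivative at a time. -/
theorem iteratedFDeriv_derivX (hU : IsOpen U) {r s : ℕ}
    (hg : MixedRegular (sigmaSet (r + 1) s) U A g) (b : X) {j : ℕ} (hj : j ≤ r + s) :
    ∀ z ∈ U, ∀ x, iteratedFDeriv ℝ j (fun z' => derivX b g z' x) z
      = fderiv ℝ (fun x => iteratedFDeriv ℝ j (fun z' => g z' x) z) x b := by
  induction j with
  | zero =>
    intro z hz x
    simp only [iteratedFDeriv_zero_eq_comp, Function.comp_def]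
    have h1 : DifferentiableAt ℝ (g z) x := by
      have h2 := (hg.diff_x (1, 0) ⟨by simp, by simp only; omega⟩ z hz).differentiable (by simp) x
      have h3 := (continuousMultilinearCurryFin0 ℝ E V).differentiableAt.comp x h2
      exact h3
    have h2 := ((continuousMultilinearCurryFin0 ℝ E V).symm.hasFDerivAt.comp x
      h1.hasFDerivAt).fderiv
    simp only [Function.comp_def] at h2
    rw [h2]
    rfl
  | succ j ih =>
    intro z hz x
    have hj' : j ≤ r + s := by omega
    have hsw := hasFDerivAt_fderiv_iteratedFDeriv hU hg hj hz x
    have h1 : fderiv ℝ (iteratedFDeriv ℝ j (fun z' => derivX b g z' x)) z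
        = fderiv ℝ (fun x => fderiv ℝ (iteratedFDeriv ℝ j (fun z' => g z' x)) z) x b := by
      have h2 : iteratedFDeriv ℝ j (fun z' => derivX b g z' x) =ᶠ[𝓝 z]
          fun z => fderiv ℝ (fun x => iteratedFDeriv ℝ j (fun z' => g z' x) z) x b := by
        filter_upwards [hU.mem_nhds hz] with w hw using ih hj' w hw x
      rw [h2.fderiv_eq]
      have h3 := hsw.clm_apply (hasFDerivAt_const b z)
      rw [h3.fderiv]
      ext a
      simp
    have h5 : DifferentiableAt ℝ
        (fun x => fderiv ℝ (iteratedFDeriv ℝ j (fun z' => g z' x)) z) x := by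
      have h6 : DifferentiableAt ℝ (fun x => iteratedFDeriv ℝ (j + 1) (fun z' => g z' x) z) x :=
        (hg.diff_x (1, j + 1) ⟨by simp, by simp only; omega⟩ z hz).differentiable (by simp) x
      simp only [fderiv_iteratedFDeriv_eq_curryFirst]
      exact (HasFDerivAt.clm_comp_left
        (V := ContinuousMultilinearMap ℝ (fun _ : Fin (j + 1) => E) V)
        (W := E →L[ℝ] ContinuousMultilinearMap ℝ (fun _ : Fin j => E) V)
        (curryFirst E V j) h6.hasFDerivAt).differentiableAt
    simp only [iteratedFDeriv_succ_eq_uncurryFirst]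
    have h7 := HasFDerivAt.clm_comp_left
      (V := E →L[ℝ] ContinuousMultilinearMap ℝ (fun _ : Fin j => E) V)
      (W := ContinuousMultilinearMap ℝ (fun _ : Fin (j + 1) => E) V)
      (uncurryFirst E V j) h5.hasFDerivAt
    rw [h1, h7.fderiv]
    rfl

end MixedDerivatives

/-! ### Regularity classes under partial derivatives, and the chain rule -/

section MixedDerivativesX

variable {E X V : Type*} [NormedAddCommGroup E] [NormedSpace ℝ E] [NormedAddCommGroup X]
  [NormedSpace ℝ X] [NormedAddCommGroup V] [NormedSpace ℝ V]
  {U : Set E} {A τ R : ℝ} {g : E → X → V} {r s : ℕ}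

theorem MixedRegular.mixedD_derivX (hU : IsOpen U)
    (hg : MixedRegular (sigmaSet (r + 1) s) U A g) (b : X) {p : ℕ × ℕ} (hp : p ∈ sigmaSet r s)
    {z : E} (hz : z ∈ U) (x : X) :
    mixedD p.1 p.2 (_root_.derivX b g) z x = evalLast _ p.1 b (mixedD (p.1 + 1) p.2 g z x) := by
  have hp' : (p.1 + 1, p.2) ∈ sigmaSet (r + 1) s :=
    ⟨Nat.succ_le_succ hp.1, by have := hp.2; simp only; omega⟩
  unfold mixedD
  simp only [iteratedFDeriv_derivX hU hg b (show p.2 ≤ r + s by have := hp.2; omega) z hz]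
  exact iteratedFDeriv_fderiv_apply (V := ContinuousMultilinearMap ℝ (fun _ : Fin p.2 => E) V)
    (hg.diff_x _ hp' z hz).contDiffAt le_rfl b

/-- A derivative in `x` costs one unit of `r` and nothing else, neither `s` nor the bound `A`; this
drives the inductions on `r` below. -/
theorem MixedRegular.derivX (hU : IsOpen U) (hg : MixedRegular (sigmaSet (r + 1) s) U A g) {b : X}
    (hb : ‖b‖ ≤ 1) : MixedRegular (sigmaSet r s) U A (derivX b g) := by
  have hS : ∀ p ∈ sigmaSet r s, (p.1 + 1, p.2) ∈ sigmaSet (r + 1) s := fun p hp =>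
    ⟨Nat.succ_le_succ hp.1, by have := hp.2; simp only; omega⟩
  have hj : ∀ p ∈ sigmaSet r s, p.2 ≤ r + s := fun p hp => by have := hp.2; omega
  refine ⟨fun p hp x z hz => ?_, fun p hp z hz => ?_, fun p hp => ?_, fun p hp z hz x => ?_⟩
  -- Smoothness in `z` is read off from the iterated derivatives: by the interchange they are the
  -- `b`-derivatives of `D_z^k g`, continuous up to order `p.2` and differentiable below it.
  · have h : ContDiffOn ℝ (p.2 : ℕ∞) (fun z' => _root_.derivX b g z' x) U := by
      refine contDiffOn_of_continuousOn_differentiableOn (fun k hk => ?_) (fun k hk => ?_)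
      · have hk' : k ≤ r + s := le_trans (by exact_mod_cast hk) (hj p hp)
        have h1 : (1, k) ∈ sigmaSet (r + 1) s := ⟨by simp, by simp only; omega⟩
        have hc : ContinuousOn (fun q : E × X => fderiv ℝ
            (fun x => iteratedFDeriv ℝ k (fun z' => g z' x) q.1) q.2) (U ×ˢ univ) := by
          refine ((continuousMultilinearCurryFin1 ℝ X _).continuous.comp_continuousOn
            (hg.cont _ h1)).congr ?_
          intro q _
          exact (curryFin1_iteratedFDeriv_one _ _).symm
        have hc' : ContinuousOn (fun z : E => fderiv ℝ
            (fun x => iteratedFDeriv ℝ k (fun z' => g z' x) z) x b) U :=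
          (hc.comp (f := fun z : E => (z, x)) (by fun_prop)
            (fun z hz => ⟨hz, mem_univ _⟩)).clm_apply continuousOn_const
        refine hc'.congr fun z hz => ?_
        simp only
        rw [iteratedFDerivWithin_of_isOpen k hU hz, iteratedFDeriv_derivX hU hg b hk' z hz]
      · have hk' : k + 1 ≤ r + s := le_trans (by exact_mod_cast hk) (hj p hp)
        have hd : DifferentiableOn ℝ (fun z : E => fderiv ℝ
            (fun x => iteratedFDeriv ℝ k (fun z' => g z' x) z) x b) U := fun z hz =>
          ((hasFDerivAt_fderiv_iteratedFDeriv hU hg hk' hz x).clm_apply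
            (hasFDerivAt_const b z)).differentiableAt.differentiableWithinAt
        refine hd.congr fun z hz => ?_
        rw [iteratedFDerivWithin_of_isOpen k hU hz, iteratedFDeriv_derivX hU hg b (by omega) z hz]
    exact h.contDiffAt (hU.mem_nhds hz)
  · simp only [iteratedFDeriv_derivX hU hg b (hj p hp) z hz]
    exact ((hg.diff_x _ (hS p hp) z hz).fderiv_right (by norm_cast)).clm_apply contDiff_const
  · refine ContinuousOn.congr ?_ fun q hq => hg.mixedD_derivX hU b hp hq.1 q.2
    exact (evalLast _ p.1 b).continuous.comp_continuousOn (hg.cont _ (hS p hp))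
  · rw [hg.mixedD_derivX hU b hp hz]
    refine (norm_evalLast_apply_le (V := ContinuousMultilinearMap ℝ (fun _ : Fin p.2 => E) V)
      p.1 b _).trans ?_
    have := hg.bound _ (hS p hp) z hz x
    exact (mul_le_of_le_one_left (norm_nonneg _) hb).trans this

theorem MixedModulus.derivX (hU : IsOpen U) (hg : MixedRegular (sigmaSet (r + 1) s) U A g)
    (hm : MixedModulus (sigmaSet (r + 1) s) U τ R g) {b : X} (hb : ‖b‖ ≤ 1) :
    MixedModulus (sigmaSet r s) U τ R (derivX b g) := by
  intro p hp x z w hzw hτ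
  have hS : (p.1 + 1, p.2) ∈ sigmaSet (r + 1) s :=
    ⟨Nat.succ_le_succ hp.1, by have := hp.2; simp only; omega⟩
  rw [hg.mixedD_derivX hU b hp (hzw (left_mem_segment ℝ z w)),
    hg.mixedD_derivX hU b hp (hzw (right_mem_segment ℝ z w)), ← map_sub]
  refine (norm_evalLast_apply_le (V := ContinuousMultilinearMap ℝ (fun _ : Fin p.2 => E) V)
      p.1 b _).trans ?_
  exact (mul_le_of_le_one_left (norm_nonneg _) hb).trans (hm _ hS x z w hzw hτ)

theorem MixedRegular.differentiableAt_z (hg : MixedRegular (sigmaSet r (s + 1)) U A g) {z : E}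
    (hz : z ∈ U) (x : X) : DifferentiableAt ℝ (fun z' => g z' x) z :=
  (hg.diff_z (0, 1) ⟨by simp, by simp only; omega⟩ x z hz).differentiableAt (by simp)

theorem MixedRegular.differentiable_x (hg : MixedRegular (sigmaSet (r + 1) s) U A g) {z : E}
    (hz : z ∈ U) : Differentiable ℝ (g z) := by
  intro x
  have h2 := (hg.diff_x (1, 0) ⟨by simp, by simp only; omega⟩ z hz).differentiable (by simp) x
  simp only [iteratedFDeriv_zero_eq_comp, Function.comp_def] at h2
  exact (HasFDerivAt.clm_comp_left (V := ContinuousMultilinearMap ℝ (fun _ : Fin 0 => E) V)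
    ((continuousMultilinearCurryFin0 ℝ E V).toContinuousLinearEquiv :
      ContinuousMultilinearMap ℝ (fun _ : Fin 0 => E) V →L[ℝ] V)
    h2.hasFDerivAt).differentiableAt

theorem norm_mixedD_zero_zero (g : E → X → V) (z : E) (x : X) : ‖mixedD 0 0 g z x‖ = ‖g z x‖ := by
  simp [mixedD]

theorem norm_mixedD_zero_zero_sub (g : E → X → V) (z w : E) (x : X) :
    ‖mixedD 0 0 g z x - mixedD 0 0 g w x‖ = ‖g z x - g w x‖ := by
  have h : mixedD 0 0 g z x - mixedD 0 0 g w x = mixedD 0 0 (fun z' x => g z' x - g w x) z x := by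
    ext u v
    simp [mixedD]
  rw [h, norm_mixedD_zero_zero]

theorem zero_mem_sigmaSet (r s : ℕ) : (0, 0) ∈ sigmaSet r s := ⟨by simp, by simp⟩

theorem MixedRegular.continuousOn (hg : MixedRegular (sigmaSet r s) U A g) :
    ContinuousOn (fun q : E × X => g q.1 q.2) (U ×ˢ univ) := by
  have h := hg.cont _ (zero_mem_sigmaSet r s)
  have h' := ((continuousMultilinearCurryFin0 ℝ E V).continuous.comp
    (continuousMultilinearCurryFin0 ℝ X _).continuous).comp_continuousOn h
  refine h'.congr fun q _ => ?_
  simp [mixedD]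

theorem MixedRegular.norm_le (hg : MixedRegular (sigmaSet r s) U A g) {z : E} (hz : z ∈ U)
    (x : X) : ‖g z x‖ ≤ A := by
  have := hg.bound _ (zero_mem_sigmaSet r s) z hz x
  rwa [norm_mixedD_zero_zero] at this

theorem MixedModulus.norm_sub_le (hm : MixedModulus (sigmaSet r s) U τ R g) {z w : E}
    (hzw : segment ℝ z w ⊆ U) (hτ : ‖z - w‖ ≤ τ) (x : X) : ‖g z x - g w x‖ ≤ R := by
  have := hm _ (zero_mem_sigmaSet r s) x z w hzw hτ
  rwa [norm_mixedD_zero_zero_sub] at this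

theorem MixedRegular.continuousOn_fderiv_z (hg : MixedRegular (sigmaSet r (s + 1)) U A g) :
    ContinuousOn (fun q : E × X => fderiv ℝ (fun z' => g z' q.2) q.1) (U ×ˢ univ) := by
  have h := hg.cont (0, 1) ⟨by simp, by simp only; omega⟩
  have h' := (continuousMultilinearCurryFin1 ℝ E V).continuous.comp_continuousOn
    ((continuousMultilinearCurryFin0 ℝ X _).continuous.comp_continuousOn h)
  refine h'.congr fun q _ => ?_
  rw [← curryFin1_iteratedFDeriv_one]
  simp [mixedD]

theorem MixedRegular.continuousOn_fderiv_x (hU : IsOpen U)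
    (hg : MixedRegular (sigmaSet (r + 1) s) U A g) :
    ContinuousOn (fun q : E × X => fderiv ℝ (g q.1) q.2) (U ×ˢ univ) := by
  have h := hg.cont (1, 0) ⟨by simp, by simp only; omega⟩
  have h1 : ContinuousOn (fun q : E × X => fderiv ℝ
      (fun x => iteratedFDeriv ℝ 0 (fun z' => g z' x) q.1) q.2) (U ×ˢ univ) := by
    refine ((continuousMultilinearCurryFin1 ℝ X _).continuous.comp_continuousOn h).congr ?_
    intro q _
    exact (curryFin1_iteratedFDeriv_one _ _).symm
  let e : ContinuousMultilinearMap ℝ (fun _ : Fin 0 => E) V →L[ℝ] V :=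
    (continuousMultilinearCurryFin0 ℝ E V).toContinuousLinearEquiv
  refine (ContinuousOn.clm_comp_left (V := ContinuousMultilinearMap ℝ (fun _ : Fin 0 => E) V)
    e h1).congr fun q hq => ?_
  have h2 : DifferentiableAt ℝ (fun x => iteratedFDeriv ℝ 0 (fun z' => g z' x) q.1) q.2 :=
    (hg.diff_x (1, 0) ⟨by simp, by simp only; omega⟩ q.1 hq.1).differentiable (by simp) q.2
  have h3 := HasFDerivAt.clm_comp_left (V := ContinuousMultilinearMap ℝ (fun _ : Fin 0 => E) V)
    e h2.hasFDerivAt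
  exact h3.fderiv

theorem sigmaSet_succ_zero_subset (r : ℕ) : sigmaSet r 0 ⊆ sigmaSet r 1 := fun p hp =>
  ⟨hp.1, hp.2.trans (by omega)⟩

theorem sigmaSet_one_subset_succ (r s : ℕ) : sigmaSet r (s + 1) ⊆ sigmaSet (r + 1) s := fun p hp =>
  ⟨hp.1.trans (by omega), by have := hp.2; omega⟩

/-- Derivative of `x ↦ g (K x, x)`. -/
theorem MixedRegular.hasFDerivAt_comp (hU : IsOpen U)
    (hg : MixedRegular (sigmaSet (r + 1) s) U A g) {K : X → E} {K' : X →L[ℝ] E} {x : X}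
    (hK : HasFDerivAt K K' x) (hx : K x ∈ U) :
    HasFDerivAt (fun x => g (K x) x)
      ((fderiv ℝ (fun z' => g z' x) (K x)) ∘L K' + fderiv ℝ (g (K x)) x) x := by
  have hg1 : MixedRegular (sigmaSet r (s + 1)) U A g := hg.mono (sigmaSet_one_subset_succ r s)
  have hn : U ×ˢ univ ∈ 𝓝 (K x, x) := (hU.prod isOpen_univ).mem_nhds ⟨hx, mem_univ _⟩
  have h1 := hasStrictFDerivAt_uncurry_coprod (𝕜 := ℝ) (u := (K x, x)) (f := g)
    (f₁ := fun z x => fderiv ℝ (fun z' => g z' x) z) (f₂ := fun z x => fderiv ℝ (g z) x)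
    (by filter_upwards [hn] with v hv using (hg1.differentiableAt_z hv.1 v.2).hasFDerivAt)
    (by filter_upwards [hn] with v hv using (hg.differentiable_x hv.1 v.2).hasFDerivAt)
    (hg1.continuousOn_fderiv_z.continuousAt hn)
    ((hg.continuousOn_fderiv_x hU).continuousAt hn)
  have h2 := HasFDerivAt.comp (f := fun x => (K x, x)) x h1.hasFDerivAt
    (hK.prodMk (show HasFDerivAt (fun x : X => x) (ContinuousLinearMap.id ℝ X) x from
      hasFDerivAt_id x))
  refine HasFDerivAt.congr_fderiv h2 ?_
  ext b
  simp [Function.HasUncurry.uncurry]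

/-- This and `derivZ_comm` let the derivative of a Taylor remainder be regrouped into Taylor
remainders of partial derivatives. The indices `(1, 1)` and `(0, 2)` are available because `s = 1`.
-/
theorem MixedRegular.derivZ_derivX (hU : IsOpen U) (hg : MixedRegular (sigmaSet (r + 1) 1) U A g)
    (a : E) (b : X) {z : E} (hz : z ∈ U) (x : X) :
    _root_.derivZ a (_root_.derivX b g) z x = _root_.derivX b (_root_.derivZ a g) z x := by
  have m11 : (1, 1) ∈ sigmaSet (r + 1) 1 := ⟨by simp, by simp only; omega⟩
  let e : ContinuousMultilinearMap ℝ (fun _ : Fin 1 => E) V →L[ℝ] E →L[ℝ] V :=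
    (continuousMultilinearCurryFin1 ℝ E V).toContinuousLinearEquiv
  have he : ∀ z x, fderiv ℝ (fun z' => g z' x) z
      = e (iteratedFDeriv ℝ 1 (fun z' => g z' x) z) := fun z x =>
    (curryFin1_iteratedFDeriv_one _ _).symm
  have hD : ∀ z ∈ U, ∀ x, HasFDerivAt (fun x => fderiv ℝ (fun z' => g z' x) z)
      (e ∘L fderiv ℝ (fun x => iteratedFDeriv ℝ 1 (fun z' => g z' x) z) x) x := by
    intro z hz x
    simp only [he]
    have h2 : DifferentiableAt ℝ (fun x => iteratedFDeriv ℝ 1 (fun z' => g z' x) z) x :=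
      (hg.diff_x _ m11 z hz).differentiable (by simp) x
    exact HasFDerivAt.clm_comp_left (V := ContinuousMultilinearMap ℝ (fun _ : Fin 1 => E) V)
      e h2.hasFDerivAt
  have hc : ContinuousOn (fun q : E × X => fderiv ℝ
      (fun x => iteratedFDeriv ℝ 1 (fun z' => g z' x) q.1) q.2) (U ×ˢ univ) := by
    refine ((continuousMultilinearCurryFin1 ℝ X _).continuous.comp_continuousOn
      (hg.cont _ m11)).congr ?_
    intro q _
    exact (curryFin1_iteratedFDeriv_one _ _).symm
  have hc' := (ContinuousOn.clm_comp_left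
    (V := ContinuousMultilinearMap ℝ (fun _ : Fin 1 => E) V) e hc).congr
    fun q hq => (hD q.1 hq.1 q.2).fderiv
  have h := hasFDerivAt_fderiv_swap hU (g := g) (D := fun z x => fderiv ℝ (fun z' => g z' x) z)
    (fun z hz x => (hg.differentiableAt_z hz x).hasFDerivAt)
    (fun z hz => hg.differentiable_x hz) (fun z hz x => (hD z hz x).differentiableAt) hc' hz x
  have h1 := (h.clm_apply (hasFDerivAt_const b z)).fderiv
  have h2 := ((hD z hz x).differentiableAt.hasFDerivAt.clm_apply (hasFDerivAt_const a x)).fderiv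
  unfold _root_.derivX _root_.derivZ
  rw [h1, h2]
  simp

theorem MixedRegular.derivZ_comm (hg : MixedRegular (sigmaSet (r + 1) 1) U A g)
    (a b : E) {z : E} (hz : z ∈ U) (x : X) :
    _root_.derivZ a (_root_.derivZ b g) z x = _root_.derivZ b (_root_.derivZ a g) z x := by
  have h2 : ContDiffAt ℝ 2 (fun z' => g z' x) z :=
    hg.diff_z (0, 2) ⟨by simp, by simp only; omega⟩ x z hz
  have h3 : DifferentiableAt ℝ (fderiv ℝ fun z' => g z' x) z :=
    (h2.fderiv_right (m := 1) (by norm_num)).differentiableAt (by simp)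
  have hs := h2.isSymmSndFDerivAt (by simp)
  unfold _root_.derivZ
  have e1 := (h3.hasFDerivAt.clm_apply (hasFDerivAt_const b z)).fderiv
  have e2 := (h3.hasFDerivAt.clm_apply (hasFDerivAt_const a z)).fderiv
  rw [e1, e2]
  simpa using hs a b

end MixedDerivativesX

/-! ### Calculus with `C^r` bounds -/

/-- `φ` is of class `C^r` with derivatives up to order `r` bounded by `C`. -/
structure CrBound {X V : Type*} [NormedAddCommGroup X] [NormedSpace ℝ X] [NormedAddCommGroup V]
    [NormedSpace ℝ V] (r : ℕ) (φ : X → V) (C : ℝ) : Prop where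
  smooth : ContDiff ℝ r φ
  bound : ∀ i ≤ r, ∀ x, ‖iteratedFDeriv ℝ i φ x‖ ≤ C

namespace CrBound

variable {X V V' W : Type*} [NormedAddCommGroup X] [NormedSpace ℝ X] [NormedAddCommGroup V]
  [NormedSpace ℝ V] [NormedAddCommGroup V'] [NormedSpace ℝ V'] [NormedAddCommGroup W]
  [NormedSpace ℝ W] {r : ℕ} {φ ψ : X → V} {C D : ℝ}

theorem mono (h : CrBound r φ C) (hCD : C ≤ D) : CrBound r φ D :=
  ⟨h.smooth, fun i hi x => (h.bound i hi x).trans hCD⟩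

theorem of_le {s : ℕ} (h : CrBound r φ C) (hs : s ≤ r) : CrBound s φ C :=
  ⟨h.smooth.of_le (by exact_mod_cast hs), fun i hi x => h.bound i (hi.trans hs) x⟩

theorem norm_le (h : CrBound r φ C) (x : X) : ‖φ x‖ ≤ C := by
  simpa using h.bound 0 (Nat.zero_le r) x

theorem nonneg (h : CrBound r φ C) : 0 ≤ C := (norm_nonneg _).trans (h.norm_le 0)

theorem add (h : CrBound r φ C) (h' : CrBound r ψ D) : CrBound r (fun x => φ x + ψ x) (C + D) := by
  refine ⟨h.smooth.add h'.smooth, fun i hi x => ?_⟩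
  have hi' : (i : WithTop ℕ∞) ≤ r := by exact_mod_cast hi
  have e : iteratedFDeriv ℝ i (fun x => φ x + ψ x) x
      = iteratedFDeriv ℝ i φ x + iteratedFDeriv ℝ i ψ x :=
    iteratedFDeriv_add_apply (h.smooth.of_le hi').contDiffAt (h'.smooth.of_le hi').contDiffAt
  rw [e]
  exact (norm_add_le _ _).trans (add_le_add (h.bound i hi x) (h'.bound i hi x))

theorem clm_comp (L : V →L[ℝ] W) (h : CrBound r φ C) : CrBound r (fun x => L (φ x)) (‖L‖ * C) := by
  refine ⟨L.contDiff.comp h.smooth, fun i hi x => ?_⟩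
  have hi' : (i : WithTop ℕ∞) ≤ r := by exact_mod_cast hi
  refine (L.norm_iteratedFDeriv_comp_left (f := φ) h.smooth.contDiffAt hi').trans ?_
  gcongr
  exact h.bound i hi x

theorem zero : CrBound r (fun _ : X => (0 : V)) 0 := by
  refine ⟨contDiff_const, fun i _ x => ?_⟩
  have e : iteratedFDeriv ℝ i (fun _ : X => (0 : V)) x = 0 := congrFun iteratedFDeriv_fun_zero x
  rw [e, norm_zero]

theorem sum {ι : Type*} (s : Finset ι) {f : ι → X → V} {D : ι → ℝ}
    (h : ∀ i ∈ s, CrBound r (f i) (D i)) :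
    CrBound r (fun x => ∑ i ∈ s, f i x) (∑ i ∈ s, D i) := by
  classical
  induction s using Finset.induction_on with
  | empty => simpa using zero
  | insert a s ha ih =>
    simp only [Finset.sum_insert ha]
    exact (h a (Finset.mem_insert_self a s)).add
      (ih fun i hi => h i (Finset.mem_insert_of_mem hi))

/-- The factor `2 ^ r` bounds the sum of the binomial coefficients in Leibniz's rule. -/
theorem bilinear (B : V →L[ℝ] V' →L[ℝ] W) {χ : X → V'} (h : CrBound r φ C) (h' : CrBound r χ D) :
    CrBound r (fun x => B (φ x) (χ x)) (2 ^ r * ‖B‖ * C * D) := by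
  have hC := h.nonneg
  have hD := h'.nonneg
  refine ⟨(B.isBoundedBilinearMap.contDiff).comp (h.smooth.prodMk h'.smooth), fun i hi x => ?_⟩
  have hi' : (i : WithTop ℕ∞) ≤ r := by exact_mod_cast hi
  refine (B.norm_iteratedFDeriv_le_of_bilinear h.smooth h'.smooth x hi').trans ?_
  have h1 : ∑ k ∈ Finset.range (i + 1), (i.choose k : ℝ) * ‖iteratedFDeriv ℝ k φ x‖ *
      ‖iteratedFDeriv ℝ (i - k) χ x‖ ≤ ∑ k ∈ Finset.range (i + 1), (i.choose k : ℝ) * C * D := by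
    refine Finset.sum_le_sum fun k hk => ?_
    have hk' : k ≤ i := by simpa [Nat.lt_succ_iff] using hk
    gcongr
    · exact h.bound k (hk'.trans hi) x
    · exact h'.bound (i - k) (by omega) x
  have h2 : ∑ k ∈ Finset.range (i + 1), (i.choose k : ℝ) * C * D = 2 ^ i * (C * D) := by
    simp only [mul_assoc]
    rw [← Finset.sum_mul]
    congr 1
    exact_mod_cast Nat.sum_range_choose i
  have h3 : (2 : ℝ) ^ i ≤ 2 ^ r := pow_le_pow_right₀ (by norm_num) hi
  calc _ ≤ ‖B‖ * (2 ^ i * (C * D)) := by rw [← h2]; gcongr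
    _ ≤ ‖B‖ * (2 ^ r * (C * D)) := by gcongr
    _ = _ := by ring

theorem smul {f : X → ℝ} (h : CrBound r f C) (h' : CrBound r φ D) :
    CrBound r (fun x => f x • φ x) (2 ^ r * C * D) := by
  have := bilinear (ContinuousLinearMap.lsmul ℝ ℝ : ℝ →L[ℝ] V →L[ℝ] V) h h'
  refine this.mono ?_
  have h1 : ‖(ContinuousLinearMap.lsmul ℝ ℝ : ℝ →L[ℝ] V →L[ℝ] V)‖ ≤ 1 :=
    ContinuousLinearMap.opNorm_lsmul_le
  have hC := h.nonneg
  have hD := h'.nonneg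
  calc 2 ^ r * ‖(ContinuousLinearMap.lsmul ℝ ℝ : ℝ →L[ℝ] V →L[ℝ] V)‖ * C * D
      ≤ 2 ^ r * 1 * C * D := by gcongr
    _ = _ := by ring

theorem zero_iff (hc : Continuous φ) (h : ∀ x, ‖φ x‖ ≤ C) : CrBound 0 φ C := by
  refine ⟨contDiff_zero.2 hc, fun i hi x => ?_⟩
  obtain rfl : i = 0 := by omega
  simpa using h x

theorem fderiv_apply (h : CrBound (r + 1) φ C) {b : X} (hb : ‖b‖ ≤ 1) :
    CrBound r (fun x => fderiv ℝ φ x b) C := by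
  refine ⟨(h.smooth.fderiv_right (by norm_cast)).clm_apply contDiff_const, fun i hi x => ?_⟩
  rw [iteratedFDeriv_fderiv_apply h.smooth.contDiffAt (by exact_mod_cast Nat.succ_le_succ hi)]
  refine (norm_evalLast_apply_le i b _).trans ?_
  exact (mul_le_of_le_one_left (norm_nonneg _) hb).trans (h.bound (i + 1) (Nat.succ_le_succ hi) x)

/-- Induction on the order through directional derivatives. It takes the place of a higher order
chain rule, and loses nothing in the bound, since the norm of a multilinear map is tested on unit
vectors in its last argument. -/
theorem succ_of_fderiv_apply [FiniteDimensional ℝ X] (hd : Differentiable ℝ φ)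
    (h0 : ∀ x, ‖φ x‖ ≤ C) (h : ∀ b, ‖b‖ ≤ 1 → CrBound r (fun x => fderiv ℝ φ x b) C) :
    CrBound (r + 1) φ C := by
  have hC : 0 ≤ C := (norm_nonneg _).trans (h0 0)
  have hsm : ContDiff ℝ (r + 1 : ℕ) φ := by
    push_cast
    rw [contDiff_succ_iff_fderiv_apply]
    refine ⟨hd, by simp, fun y => ?_⟩
    rcases eq_or_ne y 0 with rfl | hy
    · simpa using contDiff_const
    · have hy' : ‖y‖ ≠ 0 := norm_ne_zero_iff.2 hy
      have h1 := (h (‖y‖⁻¹ • y) (by rw [norm_smul, norm_inv, norm_norm,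
        inv_mul_cancel₀ hy'])).smooth.const_smul ‖y‖
      have e : (fun x => fderiv ℝ φ x y) = fun x => ‖y‖ • fderiv ℝ φ x (‖y‖⁻¹ • y) := by
        funext x
        rw [map_smul, smul_smul, mul_inv_cancel₀ hy', one_smul]
      rw [e]
      exact h1
  refine ⟨hsm, fun i hi x => ?_⟩
  rcases i with _ | i
  · simpa using h0 x
  · refine ContinuousMultilinearMap.opNorm_le_bound hC fun v => ?_
    rw [iteratedFDeriv_succ_apply_right]
    have hsf : ContDiffAt ℝ i (fderiv ℝ φ) x :=
      (hsm.fderiv_right (by exact_mod_cast hi)).contDiffAt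
    have key : ∀ w : Fin i → X, ∀ b, ‖b‖ ≤ 1 →
        ‖iteratedFDeriv ℝ i (fderiv ℝ φ) x w b‖ ≤ C * ∏ k, ‖w k‖ := by
      intro w b hb
      have e : iteratedFDeriv ℝ i (fun x => fderiv ℝ φ x b) x w
          = iteratedFDeriv ℝ i (fderiv ℝ φ) x w b := by
        have := (ContinuousLinearMap.apply ℝ V b).iteratedFDeriv_comp_left hsf le_rfl
        exact DFunLike.congr_fun this w
      rw [← e]
      refine (ContinuousMultilinearMap.le_opNorm _ _).trans ?_
      gcongr
      exact (h b hb).bound i (by omega) x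
    have h2 : ‖iteratedFDeriv ℝ i (fderiv ℝ φ) x (Fin.init v)‖ ≤ C * ∏ k, ‖Fin.init v k‖ :=
      ContinuousLinearMap.opNorm_le_of_unit_norm (by positivity) fun b hb =>
        key _ b hb.le
    rw [Fin.prod_univ_castSucc, ← mul_assoc]
    exact (ContinuousLinearMap.le_opNorm _ _).trans (by gcongr; exact h2)

end CrBound

theorem sigmaSet_mono_left {r r' s : ℕ} (h : r ≤ r') : sigmaSet r s ⊆ sigmaSet r' s :=
  fun _ hp => ⟨hp.1.trans h, hp.2.trans (by omega)⟩

/-! ### Composition with a section: bound, continuity and Taylor expansion in `C^r` -/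

section Composition

variable {X V : Type*} [NormedAddCommGroup X] [NormedSpace ℝ X] [FiniteDimensional ℝ X]
  [NormedAddCommGroup V] [NormedSpace ℝ V] {n : ℕ}

theorem sum_smul_single (v : Eu n) :
    v = ∑ i, v i • (EuclideanSpace.single i (1 : ℝ) : Eu n) := by
  ext k
  simp [Finset.sum_apply, Pi.single_apply]

theorem norm_single_one_le (i : Fin n) : ‖(EuclideanSpace.single i (1 : ℝ) : Eu n)‖ ≤ 1 := by
  simp

theorem CrBound.coord {r : ℕ} {K : X → Eu n} {B : ℝ} (h : CrBound r K B) (i : Fin n) :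
    CrBound r (fun x => K x i) B := by
  have h1 := h.clm_comp (EuclideanSpace.proj i : Eu n →L[ℝ] ℝ)
  refine h1.mono ?_
  have h2 : ‖(EuclideanSpace.proj i : Eu n →L[ℝ] ℝ)‖ ≤ 1 :=
    ContinuousLinearMap.opNorm_le_bound _ zero_le_one fun v => by
      simpa using PiLp.norm_apply_le v i
  exact mul_le_of_le_one_left h.nonneg h2

/-- The partial derivative in the direction of the `i`-th coordinate. -/
noncomputable def partialZ (i : Fin n) (g : Eu n → X → V) : Eu n → X → V :=
  derivZ (EuclideanSpace.single i 1) g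

theorem fderiv_apply_eq_sum_partialZ (g : Eu n → X → V) (z : Eu n) (x : X) (v : Eu n) :
    fderiv ℝ (fun z' => g z' x) z v = ∑ i, v i • partialZ i g z x := by
  conv_lhs => rw [sum_smul_single v, map_sum]
  simp [partialZ, derivZ]

theorem fderiv_coord {K : X → Eu n} {x : X} (hK : DifferentiableAt ℝ K x) (i : Fin n) (b : X) :
    fderiv ℝ (fun x => K x i) x b = fderiv ℝ K x b i := by
  have := ((EuclideanSpace.proj i : Eu n →L[ℝ] ℝ).hasFDerivAt.comp x hK.hasFDerivAt).fderiv
  exact DFunLike.congr_fun this b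

variable {U : Set (Eu n)} {A τ R : ℝ} {g : Eu n → X → V} {r s : ℕ}

/-- A `z`-derivative may be paid for with `r`, as here and in the inductions, or with `s`, as in
`MixedRegular.partialZ`, which keeps the order in `x`. -/
theorem MixedRegular.partialZ_of_succ (hU : IsOpen U)
    (hg : MixedRegular (sigmaSet (r + 1) s) U A g) (i : Fin n) :
    MixedRegular (sigmaSet r s) U A (partialZ i g) :=
  hg.derivZ hU (fun p hp => ⟨hp.1.trans (by omega), by have := hp.2; simp only; omega⟩)
    (norm_single_one_le i)

theorem MixedRegular.partialZ (hU : IsOpen U)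
    (hg : MixedRegular (sigmaSet r (s + 1)) U A g) (i : Fin n) :
    MixedRegular (sigmaSet r s) U A (partialZ i g) :=
  hg.derivZ hU (fun p hp => ⟨hp.1, by have := hp.2; simp only; omega⟩) (norm_single_one_le i)

theorem MixedModulus.partialZ_of_succ
    (hg : MixedRegular (sigmaSet (r + 1) s) U A g)
    (hm : MixedModulus (sigmaSet (r + 1) s) U τ R g) (i : Fin n) :
    MixedModulus (sigmaSet r s) U τ R (_root_.partialZ i g) :=
  hm.derivZ hg (fun p hp => ⟨hp.1.trans (by omega), by have := hp.2; simp only; omega⟩)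
    (norm_single_one_le i)

theorem MixedModulus.partialZ
    (hg : MixedRegular (sigmaSet r (s + 1)) U A g)
    (hm : MixedModulus (sigmaSet r (s + 1)) U τ R g) (i : Fin n) :
    MixedModulus (sigmaSet r s) U τ R (_root_.partialZ i g) :=
  hm.derivZ hg (fun p hp => ⟨hp.1, by have := hp.2; simp only; omega⟩) (norm_single_one_le i)

theorem MixedRegular.fderiv_comp_apply (hU : IsOpen U)
    (hg : MixedRegular (sigmaSet (r + 1) s) U A g) {K : X → Eu n} {x : X}
    (hK : DifferentiableAt ℝ K x) (hx : K x ∈ U) (b : X) :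
    fderiv ℝ (fun x => g (K x) x) x b
      = ∑ i, fderiv ℝ (fun x => K x i) x b • _root_.partialZ i g (K x) x
        + _root_.derivX b g (K x) x := by
  rw [(hg.hasFDerivAt_comp hU hK.hasFDerivAt hx).fderiv]
  simp only [add_apply, ContinuousLinearMap.comp_apply, fderiv_apply_eq_sum_partialZ,
    fderiv_coord hK]
  rfl

theorem MixedRegular.continuous_comp (hg : MixedRegular (sigmaSet r s) U A g) {K : X → Eu n}
    (hK : Continuous K) (hx : ∀ x, K x ∈ U) : Continuous fun x => g (K x) x :=
  hg.continuousOn.comp_continuous (f := fun x => (K x, x)) (by fun_prop)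
    fun x => ⟨hx x, mem_univ _⟩

/-- Composition of a `C^r` map with a `C^r` section. -/
theorem exists_crBound_comp (X V : Type*) [NormedAddCommGroup X] [NormedSpace ℝ X]
    [FiniteDimensional ℝ X] [NormedAddCommGroup V] [NormedSpace ℝ V] {U : Set (Eu n)}
    (hU : IsOpen U) (B : ℝ) (r : ℕ) :
    ∃ c : ℝ, 1 ≤ c ∧ ∀ (g : Eu n → X → V) (A : ℝ) (K : X → Eu n),
      MixedRegular (sigmaSet r 0) U A g → CrBound r K B → (∀ x, K x ∈ U) →
      CrBound r (fun x => g (K x) x) (c * A) := by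
  induction r with
  | zero =>
    refine ⟨1, le_rfl, fun g A K hg hK hKU => ?_⟩
    exact CrBound.zero_iff (hg.continuous_comp hK.smooth.continuous hKU)
      fun x => by rw [one_mul]; exact hg.norm_le (hKU x) x
  | succ r ih =>
    obtain ⟨c, hc, ih⟩ := ih
    have hB' : (0 : ℝ) ≤ 2 ^ r * |B| := by positivity
    have hcc : (1 : ℝ) ≤ n * (2 ^ r * |B| * c) + c := by
      have : (0 : ℝ) ≤ n * (2 ^ r * |B| * c) := by positivity
      linarith
    refine ⟨n * (2 ^ r * |B| * c) + c, hcc, fun g A K hg hK hKU => ?_⟩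
    have hA : 0 ≤ A := (norm_nonneg _).trans (hg.norm_le (hKU 0) 0)
    have hBp : |B| = B := abs_of_nonneg hK.nonneg
    have hKd : Differentiable ℝ K := hK.smooth.differentiable (by simp)
    have hK' := hK.of_le (Nat.le_succ r)
    refine CrBound.succ_of_fderiv_apply
      (fun x => (hg.hasFDerivAt_comp hU (hKd x).hasFDerivAt (hKU x)).differentiableAt)
      (fun x => ?_) (fun b hb => ?_)
    · exact (hg.norm_le (hKU x) x).trans (le_mul_of_one_le_left hA hcc)
    -- By the chain rule the directional derivative consists of compositions of the first partial
    -- derivatives of `g` with the same `K`, multiplied by derivatives of `K`. They belong to the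
    -- class of order `r` with the same bounds.
    · simp only [hg.fderiv_comp_apply hU (hKd _) (hKU _)]
      have h1 := CrBound.sum Finset.univ (fun i _ =>
        ((hK.coord i).fderiv_apply hb).smul
          (ih _ A K (hg.partialZ_of_succ hU i) hK' hKU))
      have h2 := ih _ A K (hg.derivX hU hb) hK' hKU
      refine (h1.add h2).mono (le_of_eq ?_)
      simp [hBp]
      ring

/-- Continuity of composition with a `C^r` map in the section. -/
theorem exists_crBound_comp_sub (X V : Type*) [NormedAddCommGroup X] [NormedSpace ℝ X]
    [FiniteDimensional ℝ X] [NormedAddCommGroup V] [NormedSpace ℝ V] {U : Set (Eu n)}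
    (hU : IsOpen U) (B : ℝ) (r : ℕ) :
    ∃ c : ℝ, 1 ≤ c ∧ ∀ (g : Eu n → X → V) (A τ R : ℝ) (K K' : X → Eu n),
      MixedRegular (sigmaSet r 0) U A g → MixedModulus (sigmaSet r 0) U τ R g →
      CrBound r K B → CrBound r K' B → CrBound r (fun x => K' x - K x) τ →
      (∀ x, segment ℝ (K' x) (K x) ⊆ U) →
      CrBound r (fun x => g (K' x) x - g (K x) x) (c * (R + A * τ)) := by
  induction r with
  | zero =>
    refine ⟨1, le_rfl, fun g A τ R K K' hg hm hK hK' hKK hseg => ?_⟩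
    have hKU : ∀ x, K x ∈ U := fun x => hseg x (right_mem_segment ℝ _ _)
    have hKU' : ∀ x, K' x ∈ U := fun x => hseg x (left_mem_segment ℝ _ _)
    have hA : 0 ≤ A := (norm_nonneg _).trans (hg.norm_le (hKU 0) 0)
    refine CrBound.zero_iff ((hg.continuous_comp hK'.smooth.continuous hKU').sub
      (hg.continuous_comp hK.smooth.continuous hKU)) fun x => ?_
    have := hm.norm_sub_le (hseg x) (hKK.norm_le x) x
    have := mul_nonneg hA hKK.nonneg
    linarith
  | succ r ih =>
    obtain ⟨c, hc, ih⟩ := ih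
    obtain ⟨c₁, hc₁, h₁⟩ := exists_crBound_comp X V hU B r
    set k : ℝ := n * (2 ^ r * |B| * c + 2 ^ r * c₁) + c with hk
    have hck : 1 ≤ k := by
      have : (0 : ℝ) ≤ n * (2 ^ r * |B| * c + 2 ^ r * c₁) := by positivity
      linarith
    refine ⟨k, hck, fun g A τ R K K' hg hm hK hK' hKK hseg => ?_⟩
    have hKU : ∀ x, K x ∈ U := fun x => hseg x (right_mem_segment ℝ _ _)
    have hKU' : ∀ x, K' x ∈ U := fun x => hseg x (left_mem_segment ℝ _ _)
    have hA : 0 ≤ A := (norm_nonneg _).trans (hg.norm_le (hKU 0) 0)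
    have hτ := hKK.nonneg
    have hBp : |B| = B := abs_of_nonneg hK.nonneg
    have hR : 0 ≤ R := (norm_nonneg _).trans (hm.norm_sub_le (hseg 0) (hKK.norm_le 0) 0)
    have hKd : Differentiable ℝ K := hK.smooth.differentiable (by simp)
    have hKd' : Differentiable ℝ K' := hK'.smooth.differentiable (by simp)
    have hKr := hK.of_le (Nat.le_succ r)
    have hKr' := hK'.of_le (Nat.le_succ r)
    have hKKr := hKK.of_le (Nat.le_succ r)
    have hd : ∀ x, DifferentiableAt ℝ (fun x => g (K x) x) x := fun x =>
      (hg.hasFDerivAt_comp hU (hKd x).hasFDerivAt (hKU x)).differentiableAt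
    have hd' : ∀ x, DifferentiableAt ℝ (fun x => g (K' x) x) x := fun x =>
      (hg.hasFDerivAt_comp hU (hKd' x).hasFDerivAt (hKU' x)).differentiableAt
    refine CrBound.succ_of_fderiv_apply (fun x => (hd' x).sub (hd x)) (fun x => ?_)
      (fun b hb => ?_)
    · have h1 := hm.norm_sub_le (hseg x) (hKK.norm_le x) x
      have h2 : R + A * τ ≤ k * (R + A * τ) := le_mul_of_one_le_left (by positivity) hck
      have h3 := mul_nonneg hA hτ
      linarith
    -- Difference of products: a difference of partial derivatives of `g` falls under the induction
    -- hypothesis, and a derivative of `K' - K` brings the factor `τ` directly.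
    · have e : (fun x => fderiv ℝ (fun x => g (K' x) x - g (K x) x) x b) = fun x =>
          (∑ i, (fderiv ℝ (fun x => K' x i) x b • (partialZ i g (K' x) x - partialZ i g (K x) x)
            + fderiv ℝ (fun x => (K' x - K x) i) x b • partialZ i g (K x) x))
          + (derivX b g (K' x) x - derivX b g (K x) x) := by
        funext x
        have e1 : fderiv ℝ (fun x => g (K' x) x - g (K x) x) x b
            = fderiv ℝ (fun x => g (K' x) x) x b - fderiv ℝ (fun x => g (K x) x) x b := by
          rw [fderiv_fun_sub (hd' x) (hd x)]; rfl
        have e2 : ∀ i, fderiv ℝ (fun x => (K' x - K x) i) x b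
            = fderiv ℝ (fun x => K' x i) x b - fderiv ℝ (fun x => K x i) x b := by
          intro i
          have := fderiv_fun_sub (𝕜 := ℝ) (f := fun x => K' x i) (g := fun x => K x i)
            (((hK'.coord i).smooth.differentiable (by simp)) x)
            (((hK.coord i).smooth.differentiable (by simp)) x)
          exact DFunLike.congr_fun this b
        rw [e1, hg.fderiv_comp_apply hU (hKd' x) (hKU' x), hg.fderiv_comp_apply hU (hKd x) (hKU x)]
        simp only [e2]
        rw [add_sub_add_comm, ← Finset.sum_sub_distrib]
        congr 1
        refine Finset.sum_congr rfl fun i _ => ?_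
        rw [smul_sub, sub_smul]
        abel
      rw [e]
      have h1 := CrBound.sum Finset.univ (fun i _ =>
        (((hK'.coord i).fderiv_apply hb).smul (ih _ A τ R K K' (hg.partialZ_of_succ hU i)
          (hm.partialZ_of_succ hg i) hKr hKr' hKKr hseg)).add
        (((hKK.coord i).fderiv_apply hb).smul (h₁ _ A K (hg.partialZ_of_succ hU i) hKr hKU)))
      have h2 := ih _ A τ R K K' (hg.derivX hU hb) (hm.derivX hU hg hb) hKr hKr' hKKr hseg
      refine (h1.add h2).mono ?_
      simp only [Finset.sum_const, Finset.card_univ, Fintype.card_fin, nsmul_eq_mul, hk, hBp]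
      have h3 : 2 ^ r * τ * (c₁ * A) ≤ 2 ^ r * c₁ * (R + A * τ) := by
        have : 0 ≤ 2 ^ r * c₁ * R := by positivity
        nlinarith
      have h4 : (n : ℝ) * (2 ^ r * τ * (c₁ * A)) ≤ n * (2 ^ r * c₁ * (R + A * τ)) := by gcongr
      linarith

/-- Mean value inequality along the segment. Each partial derivative varies by at most `R` there;
the sum over coordinates gives the factor `n`. -/
theorem MixedRegular.norm_remainder_le (hg : MixedRegular (sigmaSet r 1) U A g)
    (hm : MixedModulus (sigmaSet r 1) U τ R g) {z v : Eu n} (hseg : segment ℝ (z + v) z ⊆ U)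
    (hv : ‖v‖ ≤ τ) (x : X) :
    ‖g (z + v) x - g z x - ∑ i, v i • _root_.partialZ i g z x‖ ≤ n * R * ‖v‖ := by
  have hz : z ∈ U := hseg (right_mem_segment ℝ _ _)
  have hR : 0 ≤ R := (norm_nonneg _).trans (hm.norm_sub_le hseg (by simpa using hv) x)
  have h1 : ∀ w ∈ segment ℝ (z + v) z,
      ‖fderiv ℝ (fun z' => g z' x) w - fderiv ℝ (fun z' => g z' x) z‖ ≤ n * R := by
    intro w hw
    have hwz : segment ℝ w z ⊆ segment ℝ (z + v) z :=
      (convex_segment (z + v) z).segment_subset hw (right_mem_segment ℝ _ _)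
    have hn : ‖w - z‖ ≤ τ := by
      have := (convex_closedBall z ‖v‖).segment_subset (x := z + v) (y := z)
        (by simp) (by simp) hw
      rw [mem_closedBall_iff_norm] at this
      exact this.trans hv
    refine ContinuousLinearMap.opNorm_le_bound _ (by positivity) fun u => ?_
    rw [sub_apply, fderiv_apply_eq_sum_partialZ, fderiv_apply_eq_sum_partialZ,
      ← Finset.sum_sub_distrib]
    calc _ ≤ ∑ i : Fin n, ‖u‖ * R := by
          refine norm_sum_le_of_le _ fun i _ => ?_
          rw [← smul_sub, norm_smul]
          gcongr
          · exact PiLp.norm_apply_le u i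
          · exact (hm.partialZ hg i).norm_sub_le (hwz.trans hseg) hn x
      _ = _ := by simp; ring
  have h2 := (convex_segment (z + v) z).norm_image_sub_le_of_norm_hasFDerivWithin_le'
    (fun w hw => (hg.differentiableAt_z (hseg hw) x).hasFDerivAt.hasFDerivWithinAt) h1
    (right_mem_segment ℝ _ _) (left_mem_segment ℝ _ _)
  rwa [add_sub_cancel_left, fderiv_apply_eq_sum_partialZ] at h2

/-- First order Taylor expansion, in `C^r`, of composition with a map in the section. -/
theorem exists_crBound_comp_remainder (X V : Type*) [NormedAddCommGroup X] [NormedSpace ℝ X]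
    [FiniteDimensional ℝ X] [NormedAddCommGroup V] [NormedSpace ℝ V] {U : Set (Eu n)}
    (hU : IsOpen U) (B : ℝ) (r : ℕ) :
    ∃ c : ℝ, n + 1 ≤ c ∧ ∀ (g : Eu n → X → V) (A τ R : ℝ) (K κ : X → Eu n),
      MixedRegular (sigmaSet r 1) U A g → MixedModulus (sigmaSet r 1) U τ R g →
      CrBound r K B → CrBound r (fun x => K x + κ x) B → CrBound r κ τ →
      (∀ x, segment ℝ (K x + κ x) (K x) ⊆ U) →
      CrBound r (fun x => g (K x + κ x) x - g (K x) x - ∑ i, κ x i • partialZ i g (K x) x)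
        (c * (R + A * τ) * τ) := by
  -- The sup-norm bound, stated for every order because it is used again in the induction step.
  have base : ∀ (r : ℕ) (c : ℝ), n + 1 ≤ c → ∀ (g : Eu n → X → V) (A τ R : ℝ) (K κ : X → Eu n),
      MixedRegular (sigmaSet r 1) U A g → MixedModulus (sigmaSet r 1) U τ R g →
      CrBound r κ τ → (∀ x, segment ℝ (K x + κ x) (K x) ⊆ U) → ∀ x,
      ‖g (K x + κ x) x - g (K x) x - ∑ i, κ x i • partialZ i g (K x) x‖
        ≤ c * (R + A * τ) * τ := by
    intro r c hc g A τ R K κ hg hm hκ hseg x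
    have hA : 0 ≤ A := (norm_nonneg _).trans (hg.norm_le (hseg x (right_mem_segment ℝ _ _)) x)
    have hτ := hκ.nonneg
    have hR : 0 ≤ R := (norm_nonneg _).trans
      (hm.norm_sub_le (hseg x) (by simpa using hκ.norm_le x) x)
    refine (hg.norm_remainder_le hm (hseg x) (hκ.norm_le x) x).trans ?_
    have hAτ : 0 ≤ A * τ := by positivity
    have hn : (0 : ℝ) ≤ n := by positivity
    have hc0 : 0 ≤ c := by linarith
    exact mul_le_mul (mul_le_mul (by linarith) (by linarith) hR hc0) (hκ.norm_le x)
      (norm_nonneg _) (mul_nonneg hc0 (by linarith))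
  induction r with
  | zero =>
    refine ⟨n + 1, le_rfl, fun g A τ R K κ hg hm hK hKκ hκ hseg => ?_⟩
    have hKU : ∀ x, K x ∈ U := fun x => hseg x (right_mem_segment ℝ _ _)
    have hKU' : ∀ x, K x + κ x ∈ U := fun x => hseg x (left_mem_segment ℝ _ _)
    refine CrBound.zero_iff ?_ (base 0 _ le_rfl g A τ R K κ hg hm hκ hseg)
    refine ((hg.continuous_comp hKκ.smooth.continuous hKU').sub
      (hg.continuous_comp hK.smooth.continuous hKU)).sub (continuous_finsetSum _ fun i _ => ?_)
    exact (hκ.coord i).smooth.continuous.smul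
      ((hg.partialZ hU i).continuous_comp hK.smooth.continuous hKU)
  | succ r ih =>
    obtain ⟨c, hc, ih⟩ := ih
    obtain ⟨c₁, hc₁, h₁⟩ := exists_crBound_comp_sub X V hU B r
    have hc0 : 0 ≤ c := by
      have : (0 : ℝ) ≤ n := by positivity
      linarith
    set k : ℝ := n * (2 ^ r * |B| * c + 2 ^ r * c₁) + c with hk
    have hck : n + 1 ≤ k := by
      have : (0 : ℝ) ≤ n * (2 ^ r * |B| * c + 2 ^ r * c₁) := by positivity
      linarith
    refine ⟨k, hck, fun g A τ R K κ hg hm hK hKκ hκ hseg => ?_⟩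
    have hKU : ∀ x, K x ∈ U := fun x => hseg x (right_mem_segment ℝ _ _)
    have hKU' : ∀ x, K x + κ x ∈ U := fun x => hseg x (left_mem_segment ℝ _ _)
    have hBp : |B| = B := abs_of_nonneg hK.nonneg
    have hKd : Differentiable ℝ K := hK.smooth.differentiable (by simp)
    have hκd : Differentiable ℝ κ := hκ.smooth.differentiable (by simp)
    have hκi : ∀ i, Differentiable ℝ fun x => κ x i := fun i =>
      (hκ.coord i).smooth.differentiable (by simp)
    have hKi : ∀ i, Differentiable ℝ fun x => K x i := fun i =>
      (hK.coord i).smooth.differentiable (by simp)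
    have hKr := hK.of_le (Nat.le_succ r)
    have hKκr := hKκ.of_le (Nat.le_succ r)
    have hκr := hκ.of_le (Nat.le_succ r)
    have hg0 : MixedRegular (sigmaSet (r + 1) 0) U A g := hg.mono (sigmaSet_succ_zero_subset _)
    have hd : ∀ x, DifferentiableAt ℝ (fun x => g (K x) x) x := fun x =>
      (hg0.hasFDerivAt_comp hU (hKd x).hasFDerivAt (hKU x)).differentiableAt
    have hd' : ∀ x, DifferentiableAt ℝ (fun x => g (K x + κ x) x) x := fun x =>
      (hg0.hasFDerivAt_comp hU ((hKd x).add (hκd x)).hasFDerivAt (hKU' x)).differentiableAt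
    have hp := fun i => hg.partialZ hU i
    have hdi : ∀ i x, DifferentiableAt ℝ (fun x => partialZ i g (K x) x) x := fun i x =>
      ((hp i).hasFDerivAt_comp hU (hKd x).hasFDerivAt (hKU x)).differentiableAt
    have hds : ∀ x, DifferentiableAt ℝ (fun x => ∑ i, κ x i • partialZ i g (K x) x) x := fun x =>
      DifferentiableAt.fun_sum fun i _ => (hκi i x).smul (hdi i x)
    refine CrBound.succ_of_fderiv_apply (fun x => ((hd' x).sub (hd x)).sub (hds x))
      (base _ k hck g A τ R K κ hg hm hκ hseg) (fun b hb => ?_)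
    -- The derivative of the remainder is made of the remainders of `∂_i g` and of `∂_b g`, for the
    -- induction hypothesis, and of `∂_b κ_i` times a difference of `∂_i g`, where continuity of
    -- composition gives the second small factor.
    have e : (fun x => fderiv ℝ (fun x => g (K x + κ x) x - g (K x) x
          - ∑ i, κ x i • partialZ i g (K x) x) x b) = fun x =>
        (∑ i, (fderiv ℝ (fun x => K x i) x b • (partialZ i g (K x + κ x) x - partialZ i g (K x) x
            - ∑ l, κ x l • partialZ l (partialZ i g) (K x) x)
          + fderiv ℝ (fun x => κ x i) x b • (partialZ i g (K x + κ x) x - partialZ i g (K x) x)))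
        + (derivX b g (K x + κ x) x - derivX b g (K x) x
          - ∑ l, κ x l • partialZ l (derivX b g) (K x) x) := by
      funext x
      have e1 : fderiv ℝ (fun x => g (K x + κ x) x - g (K x) x
          - ∑ i, κ x i • partialZ i g (K x) x) x b
          = fderiv ℝ (fun x => g (K x + κ x) x) x b - fderiv ℝ (fun x => g (K x) x) x b
            - fderiv ℝ (fun x => ∑ i, κ x i • partialZ i g (K x) x) x b := by
        have f1 := fderiv_fun_sub (𝕜 := ℝ) (f := fun x => g (K x + κ x) x - g (K x) x)
          (g := fun x => ∑ i, κ x i • partialZ i g (K x) x) ((hd' x).sub (hd x)) (hds x)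
        have f2 := fderiv_fun_sub (𝕜 := ℝ) (f := fun x => g (K x + κ x) x)
          (g := fun x => g (K x) x) (hd' x) (hd x)
        rw [f2] at f1
        exact DFunLike.congr_fun f1 b
      have e2 : ∀ i, fderiv ℝ (fun x => (K x + κ x) i) x b
          = fderiv ℝ (fun x => K x i) x b + fderiv ℝ (fun x => κ x i) x b := by
        intro i
        exact DFunLike.congr_fun (fderiv_fun_add (𝕜 := ℝ) (f := fun x => K x i)
          (g := fun x => κ x i) (hKi i x) (hκi i x)) b
      have e3 : fderiv ℝ (fun x => ∑ l, κ x l • partialZ l g (K x) x) x b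
          = ∑ l, (κ x l • (∑ i, fderiv ℝ (fun x => K x i) x b • partialZ l (partialZ i g) (K x) x
              + partialZ l (derivX b g) (K x) x)
            + fderiv ℝ (fun x => κ x l) x b • partialZ l g (K x) x) := by
        have f1 := fderiv_fun_sum (𝕜 := ℝ) (u := Finset.univ) (x := x)
          (A := fun i x => κ x i • partialZ i g (K x) x)
          fun i _ => (hκi i x).smul (hdi i x)
        rw [f1, sum_apply]
        refine Finset.sum_congr rfl fun l _ => ?_
        rw [fderiv_fun_smul (hκi l x) (hdi l x)]
        simp only [add_apply, smul_apply, ContinuousLinearMap.smulRight_apply]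
        rw [(hp l).fderiv_comp_apply hU (hKd x) (hKU x)]
        have c1 : ∀ i, partialZ i (partialZ l g) (K x) x = partialZ l (partialZ i g) (K x) x :=
          fun i => hg.derivZ_comm _ _ (hKU x) x
        have c2 : derivX b (partialZ l g) (K x) x = partialZ l (derivX b g) (K x) x :=
          (hg.derivZ_derivX hU _ b (hKU x) x).symm
        rw [c2]
        simp only [c1]
      rw [e1, hg0.fderiv_comp_apply (K := fun x => K x + κ x) hU
          (hKκ.smooth.differentiable (by simp) x) (hKU' x),
        hg0.fderiv_comp_apply hU (hKd x) (hKU x), e3]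
      simp only [e2, add_smul, smul_sub, smul_add, Finset.sum_add_distrib, Finset.sum_sub_distrib,
        Finset.smul_sum]
      rw [Finset.sum_comm (f := fun l i => κ x l • fderiv ℝ (fun x => K x i) x b •
        partialZ l (partialZ i g) (K x) x)]
      simp only [smul_comm (κ x _) (fderiv ℝ _ x b)]
      abel
    rw [e]
    have hseg' : ∀ x, segment ℝ (K x + κ x) (K x) ⊆ U := hseg
    have h1 := CrBound.sum Finset.univ (fun i _ =>
      (((hK.coord i).fderiv_apply hb).smul (ih _ A τ R K κ (hg.partialZ_of_succ hU i)
        (hm.partialZ_of_succ hg i) hKr hKκr hκr hseg)).add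
      (((hκ.coord i).fderiv_apply hb).smul (h₁ _ A τ R K (fun x => K x + κ x)
        ((hp i).mono (sigmaSet_mono_left (Nat.le_succ r)))
        ((hm.partialZ hg i).mono (sigmaSet_mono_left (Nat.le_succ r))) hKr hKκr
        (by simpa using hκr) hseg)))
    have h2 := ih _ A τ R K κ (hg.derivX hU hb) (hm.derivX hU hg hb) hKr hKκr hκr hseg
    refine (h1.add h2).mono (le_of_eq ?_)
    simp only [Finset.sum_const, Finset.card_univ, Fintype.card_fin, nsmul_eq_mul, hk, hBp]
    ring

end Composition

/-! ### Random sections modulo null sets as a Banach space -/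

namespace RandomTorus

section TorusCover

variable {m : ℕ}

theorem toTorus_add (x y : Eu m) : toTorus (x + y) = toTorus x + toTorus y := by
  funext k
  simp [toTorus]

theorem toTorus_neg (x : Eu m) : toTorus (-x) = -toTorus x := by
  funext k
  simp [toTorus]

theorem toTorus_zsmul (k : ℤ) (x : Eu m) : toTorus (k • x) = k • toTorus x :=
  map_zsmul (AddMonoidHom.mk' (toTorus (m := m)) toTorus_add) k x

theorem toTorus_surjective : Function.Surjective (toTorus (m := m)) := by
  intro θ
  choose y hy using fun k => QuotientAddGroup.mk_surjective (θ k)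
  exact ⟨WithLp.toLp 2 y, funext fun k => hy k⟩

theorem isOpenQuotientMap_toTorus : IsOpenQuotientMap (toTorus (m := m)) := by
  have h : IsOpenQuotientMap fun (y : Fin m → ℝ) (k : Fin m) => ((y k : ℝ) : UnitAddCircle) :=
    IsOpenQuotientMap.piMap fun _ => QuotientAddGroup.isOpenQuotientMap_mk
  exact h.comp (PiLp.homeomorph 2 (fun _ : Fin m => ℝ)).isOpenQuotientMap

end TorusCover

theorem _root_.CrBound.tsum {X V : Type*} [NormedAddCommGroup X] [NormedSpace ℝ X] [NormedAddCommGroup V]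
    [NormedSpace ℝ V] [CompleteSpace V] {r : ℕ} {φ : ℕ → X → V} {v : ℕ → ℝ}
    (h : ∀ k, CrBound r (φ k) (v k)) (hv : Summable v) :
    CrBound r (fun x => ∑' k, φ k x) (∑' k, v k) := by
  have h1 : ∀ (i : ℕ), (i : ℕ∞) ≤ (r : ℕ∞) → Summable ((fun _ => v : ℕ → ℕ → ℝ) i) := fun _ _ => hv
  have h2 : ∀ (i : ℕ) (k : ℕ) (x : X), (i : ℕ∞) ≤ (r : ℕ∞) →
      ‖iteratedFDeriv ℝ i (φ k) x‖ ≤ (fun _ => v : ℕ → ℕ → ℝ) i k := fun i k x hi =>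
    (h k).bound i (by exact_mod_cast hi) x
  refine ⟨by exact_mod_cast contDiff_tsum (N := (r : ℕ∞)) (fun k => (h k).smooth) h1 h2,
    fun i hi x => ?_⟩
  have e : iteratedFDeriv ℝ i (fun x => ∑' k, φ k x) x = ∑' k, iteratedFDeriv ℝ i (φ k) x :=
    iteratedFDeriv_tsum_apply (N := (r : ℕ∞)) (fun k => (h k).smooth) h1 h2
      (by exact_mod_cast hi) x
  rw [e]
  exact tsum_of_norm_bounded hv.hasSum fun k => (h k).bound i hi x

theorem _root_.CrBound.comp_add_right {X V : Type*} [NormedAddCommGroup X] [NormedSpace ℝ X]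
    [NormedAddCommGroup V] [NormedSpace ℝ V] {r : ℕ} {φ : X → V} {C : ℝ} (h : CrBound r φ C)
    (t : X) : CrBound r (fun x => φ (x + t)) C :=
  ⟨h.smooth.comp (contDiff_id.add contDiff_const), fun i hi x => by
    rw [iteratedFDeriv_comp_add_right]
    exact h.bound i hi (x + t)⟩

theorem _root_.CrBound.const {X V : Type*} [NormedAddCommGroup X] [NormedSpace ℝ X]
    [NormedAddCommGroup V] [NormedSpace ℝ V] {r : ℕ} (v : V) :
    CrBound r (fun _ : X => v) ‖v‖ := by
  refine ⟨contDiff_const, fun i hi x => ?_⟩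
  rcases Nat.eq_zero_or_pos i with rfl | h
  · simp
  · rw [iteratedFDeriv_const_of_ne (by omega)]
    simp

section Sections

variable {Ω : Type*} [MeasurableSpace Ω] {P : Measure Ω}
  {V : Type*} [NormedAddCommGroup V] [NormedSpace ℝ V] {m r : ℕ}

/-- This and `ae_crBound_of_secENorm_le` translate between the essential supremum and an almost sure
`C^r` bound on the universal cover, so that the deterministic estimates apply for almost every `ω`.
-/
theorem secENorm_le_of_ae {κ : Torus m → Ω → V} {C : ℝ}
    (h : ∀ᵐ ω ∂P, CrBound r (fun x : Eu m => κ (toTorus x) ω) C) :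
    secENorm P r κ ≤ ENNReal.ofReal C := by
  refine essSup_le_of_ae_le _ ?_
  filter_upwards [h] with ω hω
  refine iSup_le fun i => iSup_le fun hi => iSup_le fun x => ?_
  have h1 := ENNReal.ofReal_le_ofReal (hω.bound i hi x)
  rw [ofReal_norm] at h1
  exact h1

theorem ae_crBound_of_secENorm_le {κ : Torus m → Ω → V} {C : ℝ} (hC : 0 ≤ C)
    (hs : ∀ᵐ ω ∂P, ContDiff ℝ r fun x : Eu m => κ (toTorus x) ω)
    (h : secENorm P r κ ≤ ENNReal.ofReal C) :
    ∀ᵐ ω ∂P, CrBound r (fun x : Eu m => κ (toTorus x) ω) C := by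
  filter_upwards [hs, ENNReal.ae_le_essSup (μ := P) (fun ω => ⨆ i : ℕ, ⨆ _ : i ≤ r, ⨆ x : Eu m,
    ‖torusDeriv i (fun θ => κ θ ω) x‖ₑ)] with ω h1 h2
  refine ⟨h1, fun i hi x => ?_⟩
  have h3 : ‖torusDeriv i (fun θ => κ θ ω) x‖ₑ ≤ ENNReal.ofReal C :=
    (le_trans (le_trans (le_iSup (fun x : Eu m => ‖torusDeriv i (fun θ => κ θ ω) x‖ₑ) x)
      (le_iSup₂ (f := fun (i : ℕ) (_ : i ≤ r) => ⨆ x : Eu m,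
        ‖torusDeriv i (fun θ => κ θ ω) x‖ₑ) i hi)) h2).trans h
  rw [← ofReal_norm] at h3
  exact (ENNReal.ofReal_le_ofReal_iff hC).1 h3

variable [MeasurableSpace V]

theorem isRandomSection_of_ae {κ : Torus m → Ω → V} {C : ℝ}
    (hm : Measurable fun p : Torus m × Ω => κ p.1 p.2)
    (h : ∀ᵐ ω ∂P, CrBound r (fun x : Eu m => κ (toTorus x) ω) C) : IsRandomSection P r κ :=
  ⟨hm, h.mono fun _ hω => hω.smooth, ne_top_of_le_ne_top ENNReal.ofReal_ne_top
    (secENorm_le_of_ae h)⟩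

variable [BorelSpace V] [SecondCountableTopology V]

namespace RSection

theorem ae_crBound (κ : RSection P V m r) :
    ∀ᵐ ω ∂P, CrBound r (fun x : Eu m => κ (toTorus x) ω) ‖κ‖ := by
  refine ae_crBound_of_secENorm_le (norm_nonneg κ) κ.2.smooth ?_
  rw [RSection.norm_def, ENNReal.ofReal_toReal κ.2.bdd]

theorem norm_le_of_ae {κ : RSection P V m r} {C : ℝ} (hC : 0 ≤ C)
    (h : ∀ᵐ ω ∂P, CrBound r (fun x : Eu m => κ (toTorus x) ω) C) : ‖κ‖ ≤ C := by
  rw [RSection.norm_def]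
  exact ENNReal.toReal_le_of_le_ofReal hC (secENorm_le_of_ae h)

theorem ae_norm_le (κ : RSection P V m r) : ∀ᵐ ω ∂P, ∀ θ, ‖κ θ ω‖ ≤ ‖κ‖ := by
  filter_upwards [κ.ae_crBound] with ω h θ
  obtain ⟨x, rfl⟩ := toTorus_surjective θ
  exact h.norm_le x

theorem coe_sub (κ κ' : RSection P V m r) (θ : Torus m) (ω : Ω) :
    (κ - κ' : RSection P V m r) θ ω = κ θ ω - κ' θ ω := rfl

theorem coe_add (κ κ' : RSection P V m r) (θ : Torus m) (ω : Ω) :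
    (κ + κ' : RSection P V m r) θ ω = κ θ ω + κ' θ ω := rfl

theorem coe_smul (c : ℝ) (κ : RSection P V m r) (θ : Torus m) (ω : Ω) :
    (c • κ : RSection P V m r) θ ω = c • κ θ ω := rfl

/-- Construct a random section from a measurable map with almost everywhere `C^r` bounds. -/
noncomputable def ofAE (κ : Torus m → Ω → V) {C : ℝ}
    (hm : Measurable fun p : Torus m × Ω => κ p.1 p.2)
    (h : ∀ᵐ ω ∂P, CrBound r (fun x : Eu m => κ (toTorus x) ω) C) : RSection P V m r :=
  ⟨κ, isRandomSection_of_ae hm h⟩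

theorem mk_eq_mk_iff {κ κ' : RSection P V m r} :
    (SeparationQuotient.mk κ : LInfC P V m r) = SeparationQuotient.mk κ' ↔
      ∀ᵐ ω ∂P, ∀ θ, κ θ ω = κ' θ ω := by
  rw [SeparationQuotient.mk_eq_mk, Metric.inseparable_iff, dist_eq_norm]
  constructor
  · intro h
    filter_upwards [(κ - κ').ae_norm_le] with ω hω θ
    have := hω θ
    rw [h, norm_le_zero_iff] at this
    exact sub_eq_zero.1 this
  · intro h
    refine le_antisymm (norm_le_of_ae le_rfl ?_) (norm_nonneg _)
    filter_upwards [h] with ω hω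
    have e : (fun x : Eu m => (κ - κ' : RSection P V m r) (toTorus x) ω) = fun _ => 0 := by
      funext x
      rw [coe_sub, hω, sub_self]
    rw [e]
    exact CrBound.zero

end RSection

/-- `f` agrees almost everywhere with a random section. -/
def AESection (P : Measure Ω) (r : ℕ) (f : Torus m → Ω → V) : Prop :=
  ∃ κ : RSection P V m r, ∀ᵐ ω ∂P, ∀ θ, κ θ ω = f θ ω

variable (P r) in
open Classical in
/-- The class of a function which agrees almost everywhere with a random section. -/
noncomputable def toLInf (f : Torus m → Ω → V) : LInfC P V m r :=
  if h : AESection P r f then SeparationQuotient.mk h.choose else 0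

theorem toLInf_eq_mk {f : Torus m → Ω → V} {κ : RSection P V m r}
    (h : ∀ᵐ ω ∂P, ∀ θ, κ θ ω = f θ ω) : toLInf P r f = SeparationQuotient.mk κ := by
  have h' : AESection P r f := ⟨κ, h⟩
  rw [toLInf, dif_pos h', RSection.mk_eq_mk_iff]
  filter_upwards [h, h'.choose_spec] with ω h1 h2 θ
  rw [h1, h2]

theorem AESection.exists_mk {f : Torus m → Ω → V} (h : AESection P r f) :
    ∃ κ : RSection P V m r, toLInf P r f = SeparationQuotient.mk κ ∧
      ∀ᵐ ω ∂P, ∀ θ, κ θ ω = f θ ω :=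
  let ⟨κ, hκ⟩ := h
  ⟨κ, toLInf_eq_mk hκ, hκ⟩

theorem toLInf_congr {f g : Torus m → Ω → V} (hf : AESection P r f)
    (h : ∀ᵐ ω ∂P, ∀ θ, f θ ω = g θ ω) : toLInf P r f = toLInf P r g := by
  obtain ⟨κ, h1, h2⟩ := hf.exists_mk
  rw [h1, toLInf_eq_mk]
  filter_upwards [h, h2] with ω h3 h4 θ
  rw [h4, h3]

theorem toLInf_coe (κ : RSection P V m r) :
    toLInf P r (fun θ ω => κ θ ω) = SeparationQuotient.mk κ :=
  toLInf_eq_mk (Eventually.of_forall fun _ _ => rfl)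

theorem aeSection_coe (κ : RSection P V m r) : AESection P r fun θ ω => κ θ ω :=
  ⟨κ, Eventually.of_forall fun _ _ => rfl⟩

theorem ae_eq_of_toLInf_eq {f g : Torus m → Ω → V} (hf : AESection P r f) (hg : AESection P r g)
    (h : toLInf P r f = toLInf P r g) : ∀ᵐ ω ∂P, ∀ θ, f θ ω = g θ ω := by
  obtain ⟨κ, h1, h2⟩ := hf.exists_mk
  obtain ⟨κ', h1', h2'⟩ := hg.exists_mk
  rw [h1, h1', RSection.mk_eq_mk_iff] at h
  filter_upwards [h, h2, h2'] with ω a b c θ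
  rw [← b, ← c, a]

/-- Measurability and bounds are carried by different functions: `g` is a measurable modification of
`f` on a null set of `ω`. -/
theorem aeSection_of_ae {f g : Torus m → Ω → V} {C : ℝ}
    (hm : Measurable fun p : Torus m × Ω => g p.1 p.2)
    (h : ∀ᵐ ω ∂P, CrBound r (fun x : Eu m => f (toTorus x) ω) C)
    (hgf : ∀ᵐ ω ∂P, ∀ θ, g θ ω = f θ ω) : AESection P r f := by
  refine ⟨RSection.ofAE g (C := C) hm ?_, hgf⟩
  filter_upwards [h, hgf] with ω h1 h2
  simpa only [h2] using h1

theorem norm_toLInf_le {f : Torus m → Ω → V} {C : ℝ} (hC : 0 ≤ C)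
    (h : ∀ᵐ ω ∂P, CrBound r (fun x : Eu m => f (toTorus x) ω) C) : ‖toLInf P r f‖ ≤ C := by
  by_cases hf : AESection P r f
  · obtain ⟨κ, h1, h2⟩ := hf.exists_mk
    rw [h1, SeparationQuotient.norm_mk]
    refine RSection.norm_le_of_ae hC ?_
    filter_upwards [h, h2] with ω h3 h4
    simpa only [h4] using h3
  · rw [toLInf, dif_neg hf, norm_zero]
    exact hC

theorem ae_crBound_of_aeSection {f : Torus m → Ω → V} (hf : AESection P r f) :
    ∀ᵐ ω ∂P, CrBound r (fun x : Eu m => f (toTorus x) ω) ‖toLInf P r f‖ := by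
  obtain ⟨κ, h1, h2⟩ := hf.exists_mk
  rw [h1, SeparationQuotient.norm_mk]
  filter_upwards [κ.ae_crBound, h2] with ω h3 h4
  simpa only [h4] using h3

theorem AESection.add {f g : Torus m → Ω → V} (hf : AESection P r f) (hg : AESection P r g) :
    AESection P r (fun θ ω => f θ ω + g θ ω) ∧
      toLInf P r (fun θ ω => f θ ω + g θ ω) = toLInf P r f + toLInf P r g := by
  obtain ⟨κ, h1, h2⟩ := hf.exists_mk
  obtain ⟨κ', h1', h2'⟩ := hg.exists_mk
  have h : ∀ᵐ ω ∂P, ∀ θ, (κ + κ' : RSection P V m r) θ ω = f θ ω + g θ ω := by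
    filter_upwards [h2, h2'] with ω b c θ
    rw [RSection.coe_add, b, c]
  exact ⟨⟨_, h⟩, by rw [h1, h1', toLInf_eq_mk h]; rfl⟩

theorem AESection.smul {f : Torus m → Ω → V} (c : ℝ) (hf : AESection P r f) :
    AESection P r (fun θ ω => c • f θ ω) ∧
      toLInf P r (fun θ ω => c • f θ ω) = c • toLInf P r f := by
  obtain ⟨κ, h1, h2⟩ := hf.exists_mk
  have h : ∀ᵐ ω ∂P, ∀ θ, (c • κ : RSection P V m r) θ ω = c • f θ ω := by
    filter_upwards [h2] with ω b θ
    rw [RSection.coe_smul, b]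
  exact ⟨⟨_, h⟩, by rw [h1, toLInf_eq_mk h]; rfl⟩

theorem AESection.sub {f g : Torus m → Ω → V} (hf : AESection P r f) (hg : AESection P r g) :
    AESection P r (fun θ ω => f θ ω - g θ ω) ∧
      toLInf P r (fun θ ω => f θ ω - g θ ω) = toLInf P r f - toLInf P r g := by
  obtain ⟨h1, h2⟩ := hf.add (hg.smul (-1)).1
  rw [(hg.smul (-1)).2] at h2
  simpa only [neg_one_smul, ← sub_eq_add_neg] using And.intro h1 h2

theorem AESection.sum {ι : Type*} (s : Finset ι) {f : ι → Torus m → Ω → V}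
    (hf : ∀ i ∈ s, AESection P r (f i)) :
    AESection P r (fun θ ω => ∑ i ∈ s, f i θ ω) ∧
      toLInf P r (fun θ ω => ∑ i ∈ s, f i θ ω) = ∑ i ∈ s, toLInf P r (f i) := by
  classical
  induction s using Finset.induction_on with
  | empty =>
    simp only [Finset.sum_empty]
    exact ⟨aeSection_coe 0, toLInf_coe 0⟩
  | insert a s ha ih =>
    simp only [Finset.sum_insert ha]
    obtain ⟨h1, h2⟩ := ih fun i hi => hf i (Finset.mem_insert_of_mem hi)
    rw [← h2]
    exact (hf a (Finset.mem_insert_self a s)).add h1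

/-- A representative of a class of random sections. -/
noncomputable def LInfC.rep (k : LInfC P V m r) : RSection P V m r :=
  SeparationQuotient.outCLM ℝ (RSection P V m r) k

theorem LInfC.mk_rep (k : LInfC P V m r) : SeparationQuotient.mk (LInfC.rep k) = k :=
  SeparationQuotient.mk_outCLM (K := ℝ) k

theorem LInfC.norm_rep (k : LInfC P V m r) : ‖LInfC.rep k‖ = ‖k‖ := by
  conv_rhs => rw [← LInfC.mk_rep k]
  rfl

theorem LInfC.ae_rep_mk (κ : RSection P V m r) :
    ∀ᵐ ω ∂P, ∀ θ, LInfC.rep (SeparationQuotient.mk κ) θ ω = κ θ ω :=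
  RSection.mk_eq_mk_iff.1 (LInfC.mk_rep _)

/-- It suffices to sum absolutely convergent series. All terms satisfy their bounds off a single
null set; put equal to zero there, they can be summed pointwise, with a measurable sum of class
`C^r`. -/
instance [CompleteSpace V] : CompleteSpace (LInfC P V m r) := by
  refine NormedAddCommGroup.completeSpace_of_summable_imp_tendsto fun u hu => ?_
  set κ : ℕ → RSection P V m r := fun k => LInfC.rep (u k) with hκ
  have hae : ∀ᵐ ω ∂P, ∀ k, CrBound r (fun x : Eu m => κ k (toTorus x) ω) ‖u k‖ := by
    rw [ae_all_iff]
    intro k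
    rw [← LInfC.norm_rep]
    exact (κ k).ae_crBound
  obtain ⟨N, hN, hNm, hgood⟩ := hae.exists_measurable_mem
  classical
  set f : ℕ → Torus m → Ω → V := fun k θ ω => if ω ∈ N then κ k θ ω else 0 with hf
  have hfm : ∀ k, Measurable fun p : Torus m × Ω => f k p.1 p.2 := fun k =>
    Measurable.ite (measurable_snd hNm) (κ k).2.meas measurable_const
  have hfC : ∀ k ω, CrBound r (fun x : Eu m => f k (toTorus x) ω) ‖u k‖ := by
    intro k ω
    by_cases h : ω ∈ N
    · simpa only [hf, if_pos h] using hgood ω h k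
    · simpa only [hf, if_neg h] using CrBound.zero.mono (norm_nonneg _)
  have hfs : ∀ θ ω, Summable fun k => f k θ ω := by
    intro θ ω
    obtain ⟨x, rfl⟩ := toTorus_surjective θ
    exact Summable.of_norm_bounded hu fun k => (hfC k ω).norm_le x
  have hfu : ∀ k, toLInf P r (f k) = u k := by
    intro k
    have : ∀ᵐ ω ∂P, ∀ θ, κ k θ ω = f k θ ω := by
      filter_upwards [hN] with ω h θ
      rw [hf]
      exact (if_pos h).symm
    rw [toLInf_eq_mk this]
    exact LInfC.mk_rep _
  have hfa : ∀ k, AESection P r (f k) := fun k =>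
    aeSection_of_ae (hfm k) (Eventually.of_forall fun ω => hfC k ω)
      (Eventually.of_forall fun _ _ => rfl)
  set g : Torus m → Ω → V := fun θ ω => ∑' k, f k θ ω with hg
  have hga : AESection P r g := by
    refine aeSection_of_ae (g := g) (C := ∑' k, ‖u k‖) ?_ (Eventually.of_forall fun ω =>
      CrBound.tsum (fun k => hfC k ω) hu) (Eventually.of_forall fun _ _ => rfl)
    refine measurable_of_tendsto_metrizable (f := fun N (p : Torus m × Ω) =>
      ∑ k ∈ Finset.range N, f k p.1 p.2) (fun N => Finset.measurable_sum _ fun k _ => hfm k) ?_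
    exact tendsto_pi_nhds.2 fun p => (hfs p.1 p.2).hasSum.tendsto_sum_nat
  refine ⟨toLInf P r g, ?_⟩
  rw [tendsto_iff_norm_sub_tendsto_zero]
  refine squeeze_zero (fun _ => norm_nonneg _) (fun N => ?_) (tendsto_sum_nat_add fun k => ‖u k‖)
  obtain ⟨h1, h2⟩ := AESection.sum (Finset.range N) fun k _ => hfa k
  simp only [hfu] at h2
  rw [norm_sub_rev, ← h2, ← (hga.sub h1).2]
  refine norm_toLInf_le (tsum_nonneg fun _ => norm_nonneg _) (Eventually.of_forall fun ω => ?_)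
  have := CrBound.tsum (fun k => hfC (k + N) ω) ((summable_nat_add_iff N).2 hu)
  have e : (fun x : Eu m => g (toTorus x) ω - ∑ i ∈ Finset.range N, f i (toTorus x) ω)
      = fun x => ∑' k, f (k + N) (toTorus x) ω := by
    funext x
    simp only [hg]
    rw [← (hfs (toTorus x) ω).sum_add_tsum_nat_add N, add_sub_cancel_left]
  rw [e]
  exact this

end Sections

end RandomTorus

/-! ### Bounded operators: transport, linear maps, multiplication -/

namespace RandomTorus

section Operators

variable {Ω : Type*} [MeasurableSpace Ω] {P : Measure Ω} {m r : ℕ}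
  {V : Type*} [NormedAddCommGroup V] [NormedSpace ℝ V] [MeasurableSpace V] [BorelSpace V]
  [SecondCountableTopology V]
  {W : Type*} [NormedAddCommGroup W] [NormedSpace ℝ W] [MeasurableSpace W] [BorelSpace W]
  [SecondCountableTopology W]

theorem LInfC.toLInf_rep (k : LInfC P V m r) : toLInf P r (fun θ ω => LInfC.rep k θ ω) = k :=
  (toLInf_coe _).trans (LInfC.mk_rep k)

theorem LInfC.exists_toLInf (k : LInfC P V m r) :
    ∃ f : Torus m → Ω → V, AESection P r f ∧ toLInf P r f = k :=
  ⟨_, aeSection_coe (LInfC.rep k), LInfC.toLInf_rep k⟩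

theorem LInfC.ae_rep_toLInf {f : Torus m → Ω → V} (hf : AESection P r f) :
    ∀ᵐ ω ∂P, ∀ θ, LInfC.rep (toLInf P r f) θ ω = f θ ω :=
  ae_eq_of_toLInf_eq (aeSection_coe _) hf (LInfC.toLInf_rep _)

variable (P r) in
/-- A linear map of functions which induces a bounded operator on random sections. -/
structure InducesOp (op : (Torus m → Ω → V) → Torus m → Ω → W) (C : ℝ) : Prop where
  nonneg : 0 ≤ C
  map_add : ∀ f g, op (fun θ ω => f θ ω + g θ ω) = fun θ ω => op f θ ω + op g θ ω
  map_smul : ∀ (c : ℝ) f, op (fun θ ω => c • f θ ω) = fun θ ω => c • op f θ ω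
  congr : ∀ f g, (∀ᵐ ω ∂P, ∀ θ, f θ ω = g θ ω) → ∀ᵐ ω ∂P, ∀ θ, op f θ ω = op g θ ω
  aeSection : ∀ κ : RSection P V m r, AESection P r (op fun θ ω => κ θ ω)
  bound : ∀ κ : RSection P V m r,
    ∀ᵐ ω ∂P, CrBound r (fun x : Eu m => op (fun θ ω => κ θ ω) (toTorus x) ω) (C * ‖κ‖)

namespace InducesOp

variable {op : (Torus m → Ω → V) → Torus m → Ω → W} {C : ℝ}

theorem aeSection' (h : InducesOp P r op C) {f : Torus m → Ω → V} (hf : AESection P r f) :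
    AESection P r (op f) := by
  obtain ⟨κ, hκ⟩ := hf
  obtain ⟨η, hη⟩ := h.aeSection κ
  refine ⟨η, ?_⟩
  filter_upwards [hη, h.congr _ _ hκ] with ω h1 h2 θ
  rw [h1, h2]

/-- The induced bounded operator. -/
noncomputable def toCLM (h : InducesOp P r op C) : LInfC P V m r →L[ℝ] LInfC P W m r :=
  LinearMap.mkContinuous
    { toFun := fun k => toLInf P r (op fun θ ω => LInfC.rep k θ ω)
      map_add' := fun k k' => by
        rw [← ((h.aeSection _).add (h.aeSection _)).2, ← h.map_add]
        congr 2
        funext θ ω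
        simp only [LInfC.rep, _root_.map_add]
        rfl
      map_smul' := fun c k => by
        rw [RingHom.id_apply, ← ((h.aeSection _).smul c).2, ← h.map_smul]
        congr 2
        funext θ ω
        simp only [LInfC.rep, _root_.map_smul]
        rfl } C fun k => by
    refine norm_toLInf_le (mul_nonneg h.nonneg (norm_nonneg _)) ?_
    rw [← LInfC.norm_rep k]
    exact h.bound _

theorem norm_toCLM_le (h : InducesOp P r op C) : ‖h.toCLM‖ ≤ C :=
  LinearMap.mkContinuous_norm_le _ h.nonneg _

theorem toCLM_toLInf (h : InducesOp P r op C) {f : Torus m → Ω → V} (hf : AESection P r f) :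
    h.toCLM (toLInf P r f) = toLInf P r (op f) :=
  toLInf_congr (h.aeSection _) (h.congr _ _ (LInfC.ae_rep_toLInf hf))

end InducesOp

/-- Translations of the torus leave `C^r` bounds unchanged, and preimages of null sets under `ψ` are
null. -/
theorem inducesOp_pull (t : Eu m) {ψ : Ω → Ω} (hψ : MeasurePreserving ψ P P) :
    InducesOp P r (fun (f : Torus m → Ω → V) θ ω => f (θ + toTorus t) (ψ ω)) 1 where
  nonneg := zero_le_one
  map_add _ _ := rfl
  map_smul _ _ := rfl
  congr f g h := by
    filter_upwards [hψ.quasiMeasurePreserving.ae h] with ω h1 θ using h1 _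
  aeSection κ := by
    refine aeSection_of_ae (C := ‖κ‖) (g := fun θ ω => κ (θ + toTorus t) (ψ ω)) ?_ ?_
      (Eventually.of_forall fun _ _ => rfl)
    · exact κ.2.meas.comp ((measurable_fst.add_const _).prodMk (hψ.measurable.comp measurable_snd))
    · filter_upwards [hψ.quasiMeasurePreserving.ae κ.ae_crBound] with ω h1
      simpa only [toTorus_add] using h1.comp_add_right t
  bound κ := by
    filter_upwards [hψ.quasiMeasurePreserving.ae κ.ae_crBound] with ω h1
    simpa only [toTorus_add, one_mul] using h1.comp_add_right t

theorem inducesOp_postcomp (L : V →L[ℝ] W) :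
    InducesOp P r (fun (f : Torus m → Ω → V) θ ω => L (f θ ω)) ‖L‖ where
  nonneg := norm_nonneg _
  map_add _ _ := by simp
  map_smul _ _ := by simp
  congr f g h := h.mono fun ω h1 θ => by rw [h1]
  aeSection κ := by
    refine aeSection_of_ae (C := ‖L‖ * ‖κ‖) (g := fun θ ω => L (κ θ ω)) ?_ ?_
      (Eventually.of_forall fun _ _ => rfl)
    · exact L.measurable.comp κ.2.meas
    · exact κ.ae_crBound.mono fun ω h => h.clm_comp L
  bound κ := κ.ae_crBound.mono fun ω h => h.clm_comp L

/-- Precomposition with a translation of the torus and a measure preserving map. -/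
noncomputable def pullOp (V : Type*) [NormedAddCommGroup V] [NormedSpace ℝ V] [MeasurableSpace V]
    [BorelSpace V] [SecondCountableTopology V] (r : ℕ) (t : Eu m) {ψ : Ω → Ω}
    (hψ : MeasurePreserving ψ P P) : LInfC P V m r →L[ℝ] LInfC P V m r :=
  (inducesOp_pull t hψ).toCLM

/-- Postcomposition with a bounded linear map. -/
noncomputable def postOp (P : Measure Ω) (m r : ℕ) (L : V →L[ℝ] W) :
    LInfC P V m r →L[ℝ] LInfC P W m r :=
  (inducesOp_postcomp L).toCLM

theorem norm_pullOp_le (t : Eu m) {ψ : Ω → Ω} (hψ : MeasurePreserving ψ P P) :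
    ‖pullOp V r t hψ‖ ≤ 1 :=
  (inducesOp_pull t hψ).norm_toCLM_le

theorem norm_postOp_le (L : V →L[ℝ] W) : ‖postOp P m r L‖ ≤ ‖L‖ :=
  (inducesOp_postcomp L).norm_toCLM_le

theorem AESection.pull {f : Torus m → Ω → V} (hf : AESection P r f) (t : Eu m) {ψ : Ω → Ω}
    (hψ : MeasurePreserving ψ P P) : AESection P r fun θ ω => f (θ + toTorus t) (ψ ω) :=
  (inducesOp_pull t hψ).aeSection' hf

theorem AESection.postcomp {f : Torus m → Ω → V} (hf : AESection P r f) (L : V →L[ℝ] W) :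
    AESection P r fun θ ω => L (f θ ω) :=
  (inducesOp_postcomp L).aeSection' hf

theorem pullOp_toLInf {f : Torus m → Ω → V} (hf : AESection P r f) (t : Eu m) {ψ : Ω → Ω}
    (hψ : MeasurePreserving ψ P P) :
    pullOp V r t hψ (toLInf P r f) = toLInf P r fun θ ω => f (θ + toTorus t) (ψ ω) :=
  (inducesOp_pull t hψ).toCLM_toLInf hf

theorem postOp_toLInf {f : Torus m → Ω → V} (hf : AESection P r f) (L : V →L[ℝ] W) :
    postOp P m r L (toLInf P r f) = toLInf P r fun θ ω => L (f θ ω) :=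
  (inducesOp_postcomp L).toCLM_toLInf hf

theorem AESection.mul {f : Torus m → Ω → ℝ} {g : Torus m → Ω → V} (hf : AESection P r f)
    (hg : AESection P r g) : AESection P r fun θ ω => f θ ω • g θ ω := by
  obtain ⟨κ, hκ⟩ := hf
  obtain ⟨η, hη⟩ := hg
  have h : ∀ᵐ ω ∂P, ∀ θ, κ θ ω • η θ ω = f θ ω • g θ ω := by
    filter_upwards [hκ, hη] with ω h1 h2 θ
    rw [h1, h2]
  refine aeSection_of_ae (C := 2 ^ r * ‖κ‖ * ‖η‖) (κ.2.meas.smul η.2.meas) ?_ h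
  filter_upwards [κ.ae_crBound, η.ae_crBound, h] with ω h1 h2 h3
  simpa only [h3] using h1.smul h2

theorem norm_toLInf_mul_le {f : Torus m → Ω → ℝ} {g : Torus m → Ω → V} (hf : AESection P r f)
    (hg : AESection P r g) :
    ‖toLInf P r fun θ ω => f θ ω • g θ ω‖ ≤ 2 ^ r * ‖toLInf P r f‖ * ‖toLInf P r g‖ := by
  refine norm_toLInf_le (by positivity) ?_
  filter_upwards [ae_crBound_of_aeSection hf, ae_crBound_of_aeSection hg] with ω h1 h2
  exact h1.smul h2

/-- Multiplication of random sections by random functions. -/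
noncomputable def mulOp (P : Measure Ω) (V : Type*) [NormedAddCommGroup V] [NormedSpace ℝ V]
    [MeasurableSpace V] [BorelSpace V] [SecondCountableTopology V] (m r : ℕ) :
    LInfC P ℝ m r →L[ℝ] LInfC P V m r →L[ℝ] LInfC P V m r :=
  LinearMap.mkContinuous₂
    (LinearMap.mk₂ ℝ (fun a b => toLInf P r fun θ ω => LInfC.rep a θ ω • LInfC.rep b θ ω)
      (fun a a' b => by
        rw [← (((aeSection_coe _).mul (aeSection_coe _)).add
          ((aeSection_coe _).mul (aeSection_coe _))).2]
        congr 1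
        funext θ ω
        simp only [LInfC.rep, map_add]
        exact add_smul _ _ _)
      (fun c a b => by
        rw [← (((aeSection_coe _).mul (aeSection_coe _)).smul c).2]
        congr 1
        funext θ ω
        simp only [LInfC.rep, map_smul]
        exact smul_assoc (M := ℝ) (N := ℝ) (α := V) _ _ _)
      (fun a b b' => by
        rw [← (((aeSection_coe _).mul (aeSection_coe _)).add
          ((aeSection_coe _).mul (aeSection_coe _))).2]
        congr 1
        funext θ ω
        simp only [LInfC.rep, map_add]
        exact smul_add _ _ _)
      (fun c a b => by
        rw [← (((aeSection_coe _).mul (aeSection_coe _)).smul c).2]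
        congr 1
        funext θ ω
        simp only [LInfC.rep, map_smul]
        exact smul_comm _ _ _)) (2 ^ r) fun a b => by
    refine (norm_toLInf_mul_le (aeSection_coe _) (aeSection_coe _)).trans_eq ?_
    rw [LInfC.toLInf_rep, LInfC.toLInf_rep]

theorem mulOp_toLInf {f : Torus m → Ω → ℝ} {g : Torus m → Ω → V} (hf : AESection P r f)
    (hg : AESection P r g) :
    mulOp P V m r (toLInf P r f) (toLInf P r g) = toLInf P r fun θ ω => f θ ω • g θ ω := by
  refine toLInf_congr ((aeSection_coe _).mul (aeSection_coe _)) ?_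
  filter_upwards [LInfC.ae_rep_toLInf hf, LInfC.ae_rep_toLInf hg] with ω h1 h2 θ
  rw [h1, h2]

theorem norm_mulOp_le (a : LInfC P ℝ m r) : ‖mulOp P V m r a‖ ≤ 2 ^ r * ‖a‖ := by
  refine ContinuousLinearMap.opNorm_le_bound _ (by positivity) fun b => ?_
  obtain ⟨f, hf, rfl⟩ := a.exists_toLInf
  obtain ⟨g, hg, rfl⟩ := b.exists_toLInf
  rw [mulOp_toLInf hf hg]
  exact norm_toLInf_mul_le hf hg

end Operators

/-! ### Integer iterates of the base map -/

section Powers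

variable {Ω : Type*} [MeasurableSpace Ω] {P : Measure Ω}

/-- The integer powers of a bimeasurable bijection. -/
def zpowMap (Φ : Ω ≃ᵐ Ω) (k : ℤ) (ω : Ω) : Ω := ((Φ.toEquiv : Equiv.Perm Ω) ^ k) ω

variable (Φ : Ω ≃ᵐ Ω)

theorem zpowMap_zero (ω : Ω) : zpowMap Φ 0 ω = ω := rfl

theorem zpowMap_add (j k : ℤ) (ω : Ω) : zpowMap Φ (j + k) ω = zpowMap Φ j (zpowMap Φ k ω) := by
  rw [zpowMap, zpow_add]
  rfl

theorem zpowMap_one (ω : Ω) : zpowMap Φ 1 ω = Φ ω := by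
  rw [zpowMap, zpow_one]
  rfl

theorem zpowMap_neg_one (ω : Ω) : zpowMap Φ (-1) ω = Φ.symm ω := by
  rw [zpowMap, zpow_neg_one]
  rfl

theorem zpowMap_natCast (N : ℕ) (ω : Ω) : zpowMap Φ N ω = Φ^[N] ω := by
  induction N generalizing ω with
  | zero => rfl
  | succ N ih =>
    push_cast
    rw [zpowMap_add, zpowMap_one, ih, Function.iterate_succ_apply]

theorem zpowMap_neg_natCast (N : ℕ) (ω : Ω) : zpowMap Φ (-N) ω = Φ.symm^[N] ω := by
  induction N generalizing ω with
  | zero => rfl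
  | succ N ih =>
    push_cast
    rw [neg_add, zpowMap_add, zpowMap_neg_one, ih, Function.iterate_succ_apply]

theorem measurePreserving_zpowMap {Φ : Ω ≃ᵐ Ω} (hΦ : MeasurePreserving Φ P P) (k : ℤ) :
    MeasurePreserving (zpowMap Φ k) P P := by
  rcases k.eq_nat_or_neg with ⟨N, rfl | rfl⟩
  · rw [show zpowMap Φ N = Φ^[N] from funext (zpowMap_natCast Φ N)]
    exact hΦ.iterate N
  · rw [show zpowMap Φ (-N) = Φ.symm^[N] from funext (zpowMap_neg_natCast Φ N)]
    exact (hΦ.symm Φ).iterate N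

end Powers

end RandomTorus

/-! ### Composition of random maps with random sections -/

namespace RandomTorus

section RandomMaps

variable {Ω : Type*} [MeasurableSpace Ω] {P : Measure Ω} {n m r : ℕ} {S : Set (ℕ × ℕ)}
  {U : Set (Eu n)}

theorem RMap.ae_mixedRegular (G : RMap P m S U) :
    ∀ᵐ ω ∂P, MixedRegular S U ‖G‖ fun z (x : Eu m) => G z (toTorus x) ω := by
  filter_upwards [G.2.smooth, ENNReal.ae_le_essSup (μ := P) (fun ω => ⨆ p : ℕ × ℕ, ⨆ _ : p ∈ S,
    ⨆ z : Eu n, ⨆ _ : z ∈ U, ⨆ x : Eu m,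
      ‖mixedDeriv p.1 p.2 (fun z θ => G z θ ω) z x‖ₑ)] with ω h1 h2
  refine ⟨h1.diff_z, h1.diff_x, h1.cont, fun p hp z hz x => ?_⟩
  have h3 : ‖mixedDeriv p.1 p.2 (fun z θ => G z θ ω) z x‖ₑ ≤ ENNReal.ofReal ‖G‖ := by
    rw [RMap.norm_def, ENNReal.ofReal_toReal G.2.bdd]
    refine le_trans (le_trans (le_iSup (fun x : Eu m =>
      ‖mixedDeriv p.1 p.2 (fun z θ => G z θ ω) z x‖ₑ) x) ?_) h2
    refine le_trans (le_iSup₂ (f := fun (z : Eu n) (_ : z ∈ U) => ⨆ x : Eu m,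
      ‖mixedDeriv p.1 p.2 (fun z θ => G z θ ω) z x‖ₑ) z hz) ?_
    exact le_iSup₂ (f := fun (p : ℕ × ℕ) (_ : p ∈ S) => ⨆ z : Eu n, ⨆ _ : z ∈ U, ⨆ x : Eu m,
      ‖mixedDeriv p.1 p.2 (fun z θ => G z θ ω) z x‖ₑ) p hp
  rw [← ofReal_norm] at h3
  exact (ENNReal.ofReal_le_ofReal_iff (norm_nonneg G)).1 h3

theorem _root_.MixedRegular.mono_right {E X V : Type*} [NormedAddCommGroup E] [NormedSpace ℝ E]
    [NormedAddCommGroup X] [NormedSpace ℝ X] [NormedAddCommGroup V] [NormedSpace ℝ V]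
    {S : Set (ℕ × ℕ)} {U : Set E} {A A' : ℝ} {g : E → X → V} (h : MixedRegular S U A g)
    (hA : A ≤ A') : MixedRegular S U A' g :=
  ⟨h.diff_z, h.diff_x, h.cont, fun p hp z hz x => (h.bound p hp z hz x).trans hA⟩

theorem HasModulus.ae_mixedModulus {F : Eu n → Torus m → Ω → Eu n} {ρ : ℝ → ℝ}
    (h : HasModulus P S U F ρ) {τ R : ℝ} (hR : 0 ≤ R) (hρ : ∀ t, 0 < t → t ≤ τ → ρ t ≤ R) :
    ∀ᵐ ω ∂P, MixedModulus S U τ R fun z (x : Eu m) => F z (toTorus x) ω := by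
  filter_upwards [h] with ω hω p hp x z w hzw hτ
  rcases eq_or_ne z w with rfl | hne
  · rw [sub_self]
    refine le_trans (le_of_eq ?_) hR
    exact norm_zero (E := ContinuousMultilinearMap ℝ (fun _ : Fin p.1 => Eu m)
      (ContinuousMultilinearMap ℝ (fun _ : Fin p.2 => Eu n) (Eu n)))
  · exact (hω p hp x z w hzw).trans (hρ _ (norm_pos_iff.2 (sub_ne_zero.2 hne)) hτ)

theorem exists_modulus_le {ρ : ℝ → ℝ} (hρ : Tendsto ρ (𝓝[>] 0) (𝓝 0)) {R : ℝ} (hR : 0 < R) :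
    ∃ τ > 0, ∀ t, 0 < t → t ≤ τ → ρ t ≤ R := by
  obtain ⟨τ, hτ, h⟩ := mem_nhdsGT_iff_exists_Ioc_subset.1 (hρ.eventually_le_const hR)
  exact ⟨τ, hτ, fun t h1 h2 => h ⟨h1, h2⟩⟩

theorem RMap.exists_ae_mixedModulus (G : RMap P m S U) {R : ℝ} (hR : 0 < R) :
    ∃ τ > 0, ∀ᵐ ω ∂P, MixedModulus S U τ R fun z (x : Eu m) => G z (toTorus x) ω := by
  obtain ⟨ρ, hρ, h⟩ := G.2.modulus
  obtain ⟨τ, hτ, h'⟩ := exists_modulus_le hρ hR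
  exact ⟨τ, hτ, HasModulus.ae_mixedModulus h hR.le h'⟩

-- A random map is measurable only on `U × 𝕋ᵐ × Ω`, and a section has its values in `U` only almost
-- surely; hence the cut-off by zero.
open Classical in
theorem RMap.measurable_comp_ite (G : RMap P m S U) (hU : IsOpen U) {K : Torus m → Ω → Eu n}
    (hK : Measurable fun p : Torus m × Ω => K p.1 p.2) :
    Measurable fun p : Torus m × Ω => if K p.1 p.2 ∈ U then G (K p.1 p.2) p.1 p.2 else 0 := by
  have hs : MeasurableSet {p : Torus m × Ω | K p.1 p.2 ∈ U} := hK hU.measurableSet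
  refine measurable_of_restrict_of_restrict_compl hs ?_ ?_
  · have h1 : Measurable fun p : {p : Torus m × Ω | K p.1 p.2 ∈ U} =>
        ((⟨K p.1.1 p.1.2, p.2⟩ : U), p.1.1, p.1.2) :=
      (Measurable.subtype_mk (hK.comp measurable_subtype_coe)).prodMk
        ((measurable_fst.comp measurable_subtype_coe).prodMk
          (measurable_snd.comp measurable_subtype_coe))
    refine Eq.subst ?_ (G.2.meas.comp h1)
    exact funext fun p => (if_pos p.2).symm
  · refine Eq.subst ?_ (measurable_const (a := (0 : Eu n)))
    exact funext fun p => (if_neg p.2).symm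

/-- The composition of a random map with a random section. -/
def compSec (K : Torus m → Ω → Eu n) (G : Eu n → Torus m → Ω → Eu n) : Torus m → Ω → Eu n :=
  fun θ ω => G (K θ ω) θ ω

/-- The composition of the `i`-th partial derivative of a random map with a random section. -/
noncomputable def partialSec (i : Fin n) (K : Torus m → Ω → Eu n)
    (G : Eu n → Torus m → Ω → Eu n) : Torus m → Ω → Eu n :=
  fun θ ω => fderiv ℝ (fun z => G z θ ω) (K θ ω) (EuclideanSpace.single i 1)

/-- Norm estimates for the composition of random maps with sections of norm at most `B`. -/
structure CompBounds (U : Set (Eu n)) (m r : ℕ) (B c : ℝ) : Prop where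
  one_le : 1 ≤ c
  comp : ∀ (g : Eu n → Eu m → Eu n) (A : ℝ) (K : Eu m → Eu n),
    MixedRegular (sigmaSet r 0) U A g → CrBound r K B → (∀ x, K x ∈ U) →
    CrBound r (fun x => g (K x) x) (c * A)
  comp_sub : ∀ (g : Eu n → Eu m → Eu n) (A τ R : ℝ) (K K' : Eu m → Eu n),
    MixedRegular (sigmaSet r 0) U A g → MixedModulus (sigmaSet r 0) U τ R g →
    CrBound r K B → CrBound r K' B → CrBound r (fun x => K' x - K x) τ →
    (∀ x, segment ℝ (K' x) (K x) ⊆ U) →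
    CrBound r (fun x => g (K' x) x - g (K x) x) (c * (R + A * τ))
  remainder : ∀ (g : Eu n → Eu m → Eu n) (A τ R : ℝ) (K κ : Eu m → Eu n),
    MixedRegular (sigmaSet r 1) U A g → MixedModulus (sigmaSet r 1) U τ R g →
    CrBound r K B → CrBound r (fun x => K x + κ x) B → CrBound r κ τ →
    (∀ x, segment ℝ (K x + κ x) (K x) ⊆ U) →
    CrBound r (fun x => g (K x + κ x) x - g (K x) x - ∑ i, κ x i • partialZ i g (K x) x)
      (c * (R + A * τ) * τ)

theorem exists_compBounds (hU : IsOpen U) (m r : ℕ) (B : ℝ) : ∃ c, CompBounds U m r B c := by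
  obtain ⟨c₁, h₁, k₁⟩ := exists_crBound_comp (Eu m) (Eu n) hU B r
  obtain ⟨c₂, h₂, k₂⟩ := exists_crBound_comp_sub (Eu m) (Eu n) hU B r
  obtain ⟨c₃, h₃, k₃⟩ := exists_crBound_comp_remainder (Eu m) (Eu n) hU B r
  have hn : (0 : ℝ) ≤ n := by positivity
  refine ⟨c₁ + c₂ + c₃, by linarith, fun g A K hg hK hKU => ?_,
    fun g A τ R K K' hg hm hK hK' hKK hseg => ?_, fun g A τ R K κ hg hm hK hK' hκ hseg => ?_⟩
  · have hA : 0 ≤ A := (norm_nonneg _).trans (hg.norm_le (hKU 0) 0)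
    refine (k₁ g A K hg hK hKU).mono ?_
    gcongr
    linarith
  · refine (k₂ g A τ R K K' hg hm hK hK' hKK hseg).mono ?_
    have hKU := hseg 0 (right_mem_segment ℝ _ _)
    have hA : 0 ≤ A := (norm_nonneg _).trans (hg.norm_le hKU 0)
    have hR : 0 ≤ R := (norm_nonneg _).trans (hm.norm_sub_le (hseg 0) (hKK.norm_le 0) 0)
    have hτ := hKK.nonneg
    gcongr
    linarith
  · refine (k₃ g A τ R K κ hg hm hK hK' hκ hseg).mono ?_
    have hKU := hseg 0 (right_mem_segment ℝ _ _)
    have hA : 0 ≤ A := (norm_nonneg _).trans (hg.norm_le hKU 0)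
    have hR : 0 ≤ R := (norm_nonneg _).trans
      (hm.norm_sub_le (hseg 0) (by simpa using hκ.norm_le 0) 0)
    have hτ := hκ.nonneg
    gcongr
    linarith

theorem RMap.ae_crBound_comp {B c : ℝ} (hc : CompBounds U m r B c)
    (G : RMap P m (sigmaSet r 1) U) {K : Torus m → Ω → Eu n}
    (hK : ∀ᵐ ω ∂P, CrBound r (fun x : Eu m => K (toTorus x) ω) B)
    (hKU : ∀ᵐ ω ∂P, ∀ θ, K θ ω ∈ U) :
    ∀ᵐ ω ∂P, CrBound r (fun x : Eu m => compSec K G (toTorus x) ω) (c * ‖G‖) := by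
  filter_upwards [G.ae_mixedRegular, hK, hKU] with ω h1 h2 h3
  exact hc.comp _ _ (fun x => K (toTorus x) ω) (h1.mono (sigmaSet_succ_zero_subset r)) h2
    fun x => h3 _

theorem RMap.ae_crBound_partial (hU : IsOpen U) {B c : ℝ} (hc : CompBounds U m r B c) (i : Fin n)
    (G : RMap P m (sigmaSet r 1) U) {K : Torus m → Ω → Eu n}
    (hK : ∀ᵐ ω ∂P, CrBound r (fun x : Eu m => K (toTorus x) ω) B)
    (hKU : ∀ᵐ ω ∂P, ∀ θ, K θ ω ∈ U) :
    ∀ᵐ ω ∂P, CrBound r (fun x : Eu m => partialSec i K G (toTorus x) ω) (c * ‖G‖) := by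
  filter_upwards [G.ae_mixedRegular, hK, hKU] with ω h1 h2 h3
  exact hc.comp _ _ (fun x => K (toTorus x) ω) (h1.partialZ hU i) h2 fun x => h3 _

theorem RMap.aeSection_comp (hU : IsOpen U) (G : RMap P m (sigmaSet r 1) U)
    (K : RSection P (Eu n) m r) (hKU : ∀ᵐ ω ∂P, ∀ θ, K θ ω ∈ U) :
    AESection P r (compSec K G) := by
  classical
  obtain ⟨c, hc⟩ := exists_compBounds hU m r ‖K‖
  refine aeSection_of_ae (g := fun θ ω => if K θ ω ∈ U then G (K θ ω) θ ω else 0)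
    (G.measurable_comp_ite hU K.2.meas)
    (G.ae_crBound_comp hc K.ae_crBound hKU) ?_
  filter_upwards [hKU] with ω h θ
  exact if_pos (h θ)

theorem tendsto_difference_quotient {E F : Type*} [NormedAddCommGroup E] [NormedSpace ℝ E]
    [NormedAddCommGroup F] [NormedSpace ℝ F] {f : E → F} {z : E}
    (hf : DifferentiableAt ℝ f z) (v : E) :
    Tendsto (fun k : ℕ => ((k : ℝ) + 1) • (f (z + ((k : ℝ) + 1)⁻¹ • v) - f z)) atTop
      (𝓝 (fderiv ℝ f z v)) := by
  exact (hf.hasFDerivAt.lim_real v).comp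
    (tendsto_atTop_add_const_right _ (1 : ℝ) tendsto_natCast_atTop_atTop)

/-- Measurability of the derivatives is not part of being a random map. It is obtained from
difference quotients, as a pointwise limit on a measurable set of full measure. -/
theorem RMap.aeSection_partial (hU : IsOpen U) (i : Fin n) (G : RMap P m (sigmaSet r 1) U)
    (K : RSection P (Eu n) m r) (hKU : ∀ᵐ ω ∂P, ∀ θ, K θ ω ∈ U) :
    AESection P r (partialSec i K G) := by
  classical
  obtain ⟨c, hc⟩ := exists_compBounds hU m r ‖K‖
  obtain ⟨N, hN, hNm, hgood⟩ := (G.ae_mixedRegular.and hKU).exists_measurable_mem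
  set e : Eu n := EuclideanSpace.single i 1 with he
  set q : (Torus m → Ω → Eu n) → Torus m × Ω → Eu n := fun L p =>
    if L p.1 p.2 ∈ U then G (L p.1 p.2) p.1 p.2 else 0 with hq
  have hqm : ∀ k : ℕ, Measurable fun p : Torus m × Ω => if p.2 ∈ N then
      ((k : ℝ) + 1) • (q (fun θ ω => K θ ω + ((k : ℝ) + 1)⁻¹ • e) p - q K p) else 0 := fun k =>
    Measurable.ite (measurable_snd hNm) (((G.measurable_comp_ite hU (K := fun θ ω =>
      K θ ω + ((k : ℝ) + 1)⁻¹ • e) (K.2.meas.add_const _)).sub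
      (G.measurable_comp_ite hU K.2.meas)).const_smul ((k : ℝ) + 1)) measurable_const
  -- Since `U` is open, the cut-off in `q` affects only finitely many `k` at each point over `N`.
  have hlim : ∀ p : Torus m × Ω, Tendsto (fun k : ℕ => if p.2 ∈ N then
      ((k : ℝ) + 1) • (q (fun θ ω => K θ ω + ((k : ℝ) + 1)⁻¹ • e) p - q K p) else 0) atTop
      (𝓝 (if p.2 ∈ N then partialSec i K G p.1 p.2 else 0)) := by
    rintro ⟨θ, ω⟩
    by_cases hω : ω ∈ N
    · simp only [if_pos hω]
      obtain ⟨x, rfl⟩ := toTorus_surjective θ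
      have hKx := (hgood ω hω).2 (toTorus x)
      have hd := (hgood ω hω).1.differentiableAt_z (s := 0) hKx x
      refine (tendsto_difference_quotient hd e).congr' ?_
      have hlim : Tendsto (fun k : ℕ => K (toTorus x) ω + ((k : ℝ) + 1)⁻¹ • e) atTop
          (𝓝 (K (toTorus x) ω)) := by
        have h0 : Tendsto (fun k : ℕ => ((k : ℝ) + 1)⁻¹) atTop (𝓝 0) :=
          (tendsto_atTop_add_const_right _ _ tendsto_natCast_atTop_atTop).inv_tendsto_atTop
        simpa using tendsto_const_nhds.add (h0.smul_const e)
      filter_upwards [hlim.eventually_mem (hU.mem_nhds hKx)] with k hk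
      simp only [hq]
      rw [if_pos hk, if_pos hKx]
    · simp only [if_neg hω]
      exact tendsto_const_nhds
  refine aeSection_of_ae (g := fun θ ω => if ω ∈ N then partialSec i K G θ ω else 0)
    (measurable_of_tendsto_metrizable hqm (tendsto_pi_nhds.2 hlim))
    (G.ae_crBound_partial hU hc i K.ae_crBound hKU) ?_
  filter_upwards [hN] with ω h θ
  exact if_pos h

/-- A bounded linear map on the seminormed space identifies inseparable random maps, so it factors
through the quotient. -/
theorem exists_clm_of_ae {op : (Eu n → Torus m → Ω → Eu n) → Torus m → Ω → Eu n} {C : ℝ}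
    (hC : 0 ≤ C) (hs : ∀ G : RMap P m S U, AESection P r (op G))
    (hadd : ∀ G G' : RMap P m S U, ∀ᵐ ω ∂P, ∀ θ,
      op (fun z θ ω => G z θ ω + G' z θ ω) θ ω = op G θ ω + op G' θ ω)
    (hsmul : ∀ (a : ℝ) (G : RMap P m S U), ∀ᵐ ω ∂P, ∀ θ,
      op (fun z θ ω => a • G z θ ω) θ ω = a • op G θ ω)
    (hb : ∀ G : RMap P m S U, ∀ᵐ ω ∂P, CrBound r (fun x : Eu m => op G (toTorus x) ω) (C * ‖G‖)) :
    ∃ A : LInfCSigma P m S U →L[ℝ] LInfC P (Eu n) m r, ∀ G : RMap P m S U,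
      A (SeparationQuotient.mk G) = toLInf P r (op G) := by
  let L : RMap P m S U →L[ℝ] LInfC P (Eu n) m r := LinearMap.mkContinuous
    { toFun := fun G => toLInf P r (op G)
      map_add' := fun G G' => by
        rw [← ((hs G).add (hs G')).2]
        exact toLInf_congr (hs (G + G')) (hadd G G')
      map_smul' := fun a G => by
        rw [RingHom.id_apply, ← ((hs G).smul a).2]
        exact toLInf_congr (hs (a • G)) (hsmul a G) } C
    fun G => norm_toLInf_le (mul_nonneg hC (norm_nonneg _)) (hb G)
  refine ⟨L.comp (SeparationQuotient.outCLM ℝ (RMap P m S U)), fun G => ?_⟩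
  have h : Inseparable (SeparationQuotient.outCLM ℝ (RMap P m S U) (SeparationQuotient.mk G)) G :=
    SeparationQuotient.mk_eq_mk.1 (SeparationQuotient.mk_outCLM (K := ℝ) _)
  exact (h.map L.continuous).eq

open Classical in
/-- The bounded operator on random maps induced by `op`. -/
noncomputable def mapOp (P : Measure Ω) (r : ℕ) (S : Set (ℕ × ℕ)) (U : Set (Eu n))
    (op : (Eu n → Torus m → Ω → Eu n) → Torus m → Ω → Eu n) :
    LInfCSigma P m S U →L[ℝ] LInfC P (Eu n) m r :=
  if h : ∃ A : LInfCSigma P m S U →L[ℝ] LInfC P (Eu n) m r, ∀ G : RMap P m S U,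
      A (SeparationQuotient.mk G) = toLInf P r (op G) then h.choose else 0

theorem mapOp_compSec_mk (hU : IsOpen U) (K : RSection P (Eu n) m r)
    (hKU : ∀ᵐ ω ∂P, ∀ θ, K θ ω ∈ U) (G : RMap P m (sigmaSet r 1) U) :
    mapOp P r (sigmaSet r 1) U (compSec K) (SeparationQuotient.mk G)
      = toLInf P r (compSec K G) := by
  obtain ⟨c, hc⟩ := exists_compBounds hU m r ‖K‖
  have h := exists_clm_of_ae (op := compSec K) (zero_le_one.trans hc.one_le)
    (fun G => G.aeSection_comp hU K hKU)
    (fun G G' => Eventually.of_forall fun ω θ => rfl)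
    (fun a G => Eventually.of_forall fun ω θ => rfl)
    (fun G => G.ae_crBound_comp hc K.ae_crBound hKU)
  rw [mapOp, dif_pos h]
  exact h.choose_spec G

theorem mapOp_partialSec_mk (hU : IsOpen U) (i : Fin n) (K : RSection P (Eu n) m r)
    (hKU : ∀ᵐ ω ∂P, ∀ θ, K θ ω ∈ U) (G : RMap P m (sigmaSet r 1) U) :
    mapOp P r (sigmaSet r 1) U (partialSec i K) (SeparationQuotient.mk G)
      = toLInf P r (partialSec i K G) := by
  obtain ⟨c, hc⟩ := exists_compBounds hU m r ‖K‖
  have hd : ∀ G : RMap P m (sigmaSet r 1) U, ∀ᵐ ω ∂P, ∀ θ,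
      DifferentiableAt ℝ (fun z => G z θ ω) (K θ ω) := by
    intro G
    filter_upwards [G.ae_mixedRegular, hKU] with ω h1 h2 θ
    obtain ⟨x, rfl⟩ := toTorus_surjective θ
    exact h1.differentiableAt_z (s := 0) (h2 _) x
  have h := exists_clm_of_ae (op := partialSec i K) (zero_le_one.trans hc.one_le)
    (fun G => G.aeSection_partial hU i K hKU)
    (fun G G' => by
      filter_upwards [hd G, hd G'] with ω h1 h2 θ
      exact DFunLike.congr_fun (fderiv_fun_add (h1 θ) (h2 θ)) _)
    (fun a G => by
      filter_upwards [hd G] with ω h1 θ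
      exact DFunLike.congr_fun (fderiv_fun_const_smul (h1 θ) a) _)
    (fun G => G.ae_crBound_partial hU hc i K.ae_crBound hKU)
  rw [mapOp, dif_pos h]
  exact h.choose_spec G

end RandomMaps

end RandomTorus

/-! ### The fixed point map and its derivative in the section -/

namespace RandomTorus

section Representatives

variable {Ω : Type*} [MeasurableSpace Ω] {P : Measure Ω} {m r : ℕ}
  {V : Type*} [NormedAddCommGroup V] [NormedSpace ℝ V] [MeasurableSpace V] [BorelSpace V]
  [SecondCountableTopology V]

/-- The identity holds everywhere and not merely almost surely, because representatives are chosen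
by a linear section of the quotient map. -/
theorem LInfC.rep_add (k h : LInfC P V m r) (θ : Torus m) (ω : Ω) :
    LInfC.rep (k + h) θ ω = LInfC.rep k θ ω + LInfC.rep h θ ω := by
  simp only [LInfC.rep, map_add]
  rfl

theorem LInfC.rep_sub (k h : LInfC P V m r) (θ : Torus m) (ω : Ω) :
    LInfC.rep (k - h) θ ω = LInfC.rep k θ ω - LInfC.rep h θ ω := by
  simp only [LInfC.rep, map_sub]
  rfl

theorem LInfC.ae_crBound_rep (k : LInfC P V m r) :
    ∀ᵐ ω ∂P, CrBound r (fun x : Eu m => LInfC.rep k (toTorus x) ω) ‖k‖ := by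
  rw [← LInfC.norm_rep]
  exact (LInfC.rep k).ae_crBound

theorem LInfC.ae_norm_rep_sub_le (k h : LInfC P V m r) :
    ∀ᵐ ω ∂P, ∀ θ, ‖LInfC.rep k θ ω - LInfC.rep h θ ω‖ ≤ ‖k - h‖ := by
  filter_upwards [(LInfC.rep (k - h)).ae_norm_le] with ω hω θ
  rw [← LInfC.rep_sub, ← LInfC.norm_rep]
  exact hω θ

end Representatives

section InvarianceMap

variable {Ω : Type*} [MeasurableSpace Ω] {P : Measure Ω} {n m r : ℕ}
  {U : Set (Eu n)} {Φ : Ω ≃ᵐ Ω} (hΦ : MeasurePreserving Φ P P) (α : Eu m)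

/-- The transport of random sections by the skew-product over `Φ`. -/
noncomputable def shiftOp (V : Type*) [NormedAddCommGroup V] [NormedSpace ℝ V] [MeasurableSpace V]
    [BorelSpace V] [SecondCountableTopology V] (r : ℕ) : LInfC P V m r →L[ℝ] LInfC P V m r :=
  pullOp V r (-α) (hΦ.symm Φ)

/-- The `i`-th coordinate of random sections. -/
noncomputable def coordOp (P : Measure Ω) (m r : ℕ) (i : Fin n) :
    LInfC P (Eu n) m r →L[ℝ] LInfC P ℝ m r :=
  postOp P m r (EuclideanSpace.proj i : Eu n →L[ℝ] ℝ)

/-- The operator `κ ↦ S (κ_i v)`, where `S` is the transport. -/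
noncomputable def partialMulOp (r : ℕ) (i : Fin n) :
    LInfC P (Eu n) m r →L[ℝ] LInfC P (Eu n) m r →L[ℝ] LInfC P (Eu n) m r :=
  (ContinuousLinearMap.compL ℝ (LInfC P (Eu n) m r) (LInfC P (Eu n) m r) (LInfC P (Eu n) m r)
    (shiftOp hΦ α (Eu n) r)).comp
  (((ContinuousLinearMap.compL ℝ (LInfC P (Eu n) m r) (LInfC P ℝ m r) (LInfC P (Eu n) m r)).flip
    (coordOp P m r i)).comp (mulOp P (Eu n) m r).flip)

theorem partialMulOp_apply (i : Fin n) (v κ : LInfC P (Eu n) m r) :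
    partialMulOp hΦ α r i v κ
      = shiftOp hΦ α (Eu n) r (mulOp P (Eu n) m r (coordOp P m r i κ) v) := rfl

/-- The map `(k, G) ↦ G(k) ∘ T⁻¹`, whose fixed points are the invariant tori. -/
noncomputable def transportMap (U : Set (Eu n)) (k : LInfC P (Eu n) m r) :
    LInfCSigma P m (sigmaSet r 1) U →L[ℝ] LInfC P (Eu n) m r :=
  (shiftOp hΦ α (Eu n) r).comp (mapOp P r (sigmaSet r 1) U (compSec (LInfC.rep k)))

/-- The derivative of `transportMap` in the section. -/
noncomputable def transportDeriv (U : Set (Eu n)) (k : LInfC P (Eu n) m r) :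
    LInfCSigma P m (sigmaSet r 1) U →L[ℝ] LInfC P (Eu n) m r →L[ℝ] LInfC P (Eu n) m r :=
  ∑ i, (partialMulOp hΦ α r i).comp
    (mapOp P r (sigmaSet r 1) U (partialSec i (LInfC.rep k)))

theorem norm_shiftOp_le {V : Type*} [NormedAddCommGroup V] [NormedSpace ℝ V] [MeasurableSpace V]
    [BorelSpace V] [SecondCountableTopology V] : ‖shiftOp hΦ α V r‖ ≤ 1 :=
  norm_pullOp_le _ _

theorem transportDeriv_apply (k : LInfC P (Eu n) m r) (G : LInfCSigma P m (sigmaSet r 1) U) :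
    transportDeriv hΦ α U k G
      = ∑ i, partialMulOp hΦ α r i (mapOp P r (sigmaSet r 1) U (partialSec i (LInfC.rep k)) G) := by
  simp only [transportDeriv, sum_apply, ContinuousLinearMap.comp_apply]

variable {B c A τ R : ℝ}

theorem norm_mapOp_compSec_le (hU : IsOpen U) (hc : CompBounds U m r B c)
    {k : LInfC P (Eu n) m r} (hk : ‖k‖ ≤ B) (hkU : ∀ᵐ ω ∂P, ∀ θ, LInfC.rep k θ ω ∈ U) :
    ‖mapOp P r (sigmaSet r 1) U (compSec (LInfC.rep k))‖ ≤ c := by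
  have hc0 : 0 ≤ c := zero_le_one.trans hc.one_le
  refine ContinuousLinearMap.opNorm_le_bound _ hc0 fun G => ?_
  obtain ⟨G, rfl⟩ := SeparationQuotient.surjective_mk G
  rw [mapOp_compSec_mk hU _ hkU]
  exact norm_toLInf_le (mul_nonneg hc0 (norm_nonneg _)) (G.ae_crBound_comp hc
    (k.ae_crBound_rep.mono fun ω h => h.mono hk) hkU)

theorem norm_mapOp_partialSec_le (hU : IsOpen U) (hc : CompBounds U m r B c) (i : Fin n)
    {k : LInfC P (Eu n) m r} (hk : ‖k‖ ≤ B) (hkU : ∀ᵐ ω ∂P, ∀ θ, LInfC.rep k θ ω ∈ U) :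
    ‖mapOp P r (sigmaSet r 1) U (partialSec i (LInfC.rep k))‖ ≤ c := by
  have hc0 : 0 ≤ c := zero_le_one.trans hc.one_le
  refine ContinuousLinearMap.opNorm_le_bound _ hc0 fun G => ?_
  obtain ⟨G, rfl⟩ := SeparationQuotient.surjective_mk G
  rw [mapOp_partialSec_mk hU i _ hkU]
  exact norm_toLInf_le (mul_nonneg hc0 (norm_nonneg _)) (G.ae_crBound_partial hU hc i
    (k.ae_crBound_rep.mono fun ω h => h.mono hk) hkU)

theorem norm_transportMap_le (hU : IsOpen U) (hc : CompBounds U m r B c)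
    {k : LInfC P (Eu n) m r} (hk : ‖k‖ ≤ B) (hkU : ∀ᵐ ω ∂P, ∀ θ, LInfC.rep k θ ω ∈ U) :
    ‖transportMap hΦ α U k‖ ≤ c := by
  refine (ContinuousLinearMap.opNorm_comp_le _ _).trans ?_
  have := norm_mapOp_compSec_le hU hc hk hkU
  calc _ ≤ 1 * c := by
        gcongr
        exact norm_shiftOp_le hΦ α
    _ = c := one_mul c

theorem norm_transportDeriv_le (hU : IsOpen U) (hc : CompBounds U m r B c)
    {k : LInfC P (Eu n) m r} (hk : ‖k‖ ≤ B) (hkU : ∀ᵐ ω ∂P, ∀ θ, LInfC.rep k θ ω ∈ U) :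
    ‖transportDeriv hΦ α U k‖ ≤ (∑ i : Fin n, ‖partialMulOp hΦ α (P := P) r i‖) * c := by
  have hc0 : 0 ≤ c := zero_le_one.trans hc.one_le
  have hD : 0 ≤ ∑ i : Fin n, ‖partialMulOp hΦ α (P := P) r i‖ :=
    Finset.sum_nonneg fun i _ => (partialMulOp hΦ α r i).opNorm_nonneg
  refine ContinuousLinearMap.opNorm_le_bound _ (mul_nonneg hD hc0) fun G => ?_
  rw [transportDeriv_apply, mul_assoc, Finset.sum_mul]
  refine norm_sum_le_of_le _ fun i _ => ((partialMulOp hΦ α r i).le_opNorm _).trans ?_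
  gcongr
  exact (ContinuousLinearMap.le_of_opNorm_le _ (norm_mapOp_partialSec_le hU hc i hk hkU) G)

/-- The bound involves the modulus of continuity of `G` itself. It is therefore not uniform over a
ball of maps, and the derivative is continuous in `k` only for fixed `G`. -/
theorem norm_transportDeriv_sub_le (hU : IsOpen U) (hc : CompBounds U m r B c)
    {k k' : LInfC P (Eu n) m r} (hk : ‖k‖ ≤ B) (hk' : ‖k'‖ ≤ B)
    (hseg : ∀ᵐ ω ∂P, ∀ θ, segment ℝ (LInfC.rep k' θ ω) (LInfC.rep k θ ω) ⊆ U)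
    {G : RMap P m (sigmaSet r 1) U} (hG : ‖G‖ ≤ A)
    (hm : ∀ᵐ ω ∂P, MixedModulus (sigmaSet r 1) U τ R fun z (x : Eu m) => G z (toTorus x) ω)
    (hτ : ‖k' - k‖ ≤ τ) (hR : 0 ≤ R) :
    ‖transportDeriv hΦ α U k' (SeparationQuotient.mk G)
        - transportDeriv hΦ α U k (SeparationQuotient.mk G)‖
      ≤ (∑ i : Fin n, ‖partialMulOp hΦ α (P := P) r i‖) * (c * (R + A * τ)) := by
  have hkU : ∀ᵐ ω ∂P, ∀ θ, LInfC.rep k θ ω ∈ U :=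
    hseg.mono fun ω h θ => h θ (right_mem_segment ℝ _ _)
  have hkU' : ∀ᵐ ω ∂P, ∀ θ, LInfC.rep k' θ ω ∈ U :=
    hseg.mono fun ω h θ => h θ (left_mem_segment ℝ _ _)
  have hτ0 : 0 ≤ τ := (norm_nonneg _).trans hτ
  have hA0 : 0 ≤ A := (norm_nonneg _).trans hG
  have hc0 : 0 ≤ c := zero_le_one.trans hc.one_le
  rw [transportDeriv_apply, transportDeriv_apply, ← Finset.sum_sub_distrib, Finset.sum_mul]
  refine norm_sum_le_of_le _ fun i _ => ?_
  rw [← map_sub]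
  refine ((partialMulOp hΦ α r i).le_opNorm _).trans ?_
  gcongr
  rw [mapOp_partialSec_mk hU i _ hkU, mapOp_partialSec_mk hU i _ hkU',
    ← ((G.aeSection_partial hU i _ hkU').sub (G.aeSection_partial hU i _ hkU)).2]
  refine norm_toLInf_le (by positivity) ?_
  filter_upwards [G.ae_mixedRegular, hm, k.ae_crBound_rep, k'.ae_crBound_rep,
    (k' - k).ae_crBound_rep, hseg] with ω h1 h2 h3 h4 h5 h6
  have h1' := h1.mono_right hG
  simp only [LInfC.rep_sub] at h5
  exact hc.comp_sub (partialZ i fun z (x : Eu m) => G z (toTorus x) ω) A τ R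
    (fun x => LInfC.rep k (toTorus x) ω) (fun x => LInfC.rep k' (toTorus x) ω)
    (h1'.partialZ hU i) (h2.partialZ h1' i) (h3.mono hk) (h4.mono hk') (h5.mono hτ) fun x => h6 _

theorem norm_transportMap_remainder_le (hU : IsOpen U) (hc : CompBounds U m r B c)
    {k h : LInfC P (Eu n) m r} (hk : ‖k‖ ≤ B) (hk' : ‖k + h‖ ≤ B)
    (hseg : ∀ᵐ ω ∂P, ∀ θ, segment ℝ (LInfC.rep (k + h) θ ω) (LInfC.rep k θ ω) ⊆ U)
    {G : RMap P m (sigmaSet r 1) U}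
    (hm : ∀ᵐ ω ∂P, MixedModulus (sigmaSet r 1) U ‖h‖ R fun z (x : Eu m) => G z (toTorus x) ω)
    (hR : 0 ≤ R) :
    ‖transportMap hΦ α U (k + h) (SeparationQuotient.mk G)
        - transportMap hΦ α U k (SeparationQuotient.mk G)
        - transportDeriv hΦ α U k (SeparationQuotient.mk G) h‖
      ≤ c * (R + ‖G‖ * ‖h‖) * ‖h‖ := by
  have hkU : ∀ᵐ ω ∂P, ∀ θ, LInfC.rep k θ ω ∈ U :=
    hseg.mono fun ω h θ => h θ (right_mem_segment ℝ _ _)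
  have hkU' : ∀ᵐ ω ∂P, ∀ θ, LInfC.rep (k + h) θ ω ∈ U :=
    hseg.mono fun ω h θ => h θ (left_mem_segment ℝ _ _)
  have hc0 : 0 ≤ c := zero_le_one.trans hc.one_le
  have hcoord : ∀ i, AESection P r fun θ ω => LInfC.rep h θ ω i := fun i =>
    (aeSection_coe (LInfC.rep h)).postcomp (EuclideanSpace.proj i : Eu n →L[ℝ] ℝ)
  have hco : ∀ i, coordOp P m r i h = toLInf P r fun θ ω => LInfC.rep h θ ω i := by
    intro i
    conv_lhs => rw [← LInfC.toLInf_rep h]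
    exact postOp_toLInf (aeSection_coe (LInfC.rep h)) _
  have hsum := AESection.sum Finset.univ fun i (_ : i ∈ Finset.univ) =>
    (hcoord i).mul (G.aeSection_partial hU i _ hkU)
  rw [transportDeriv_apply, sum_apply]
  simp only [partialMulOp_apply, transportMap, ContinuousLinearMap.comp_apply]
  rw [← map_sum, ← map_sub, ← map_sub]
  refine ((shiftOp hΦ α (Eu n) r).le_of_opNorm_le (norm_shiftOp_le hΦ α) _).trans ?_
  rw [one_mul, mapOp_compSec_mk hU _ hkU, mapOp_compSec_mk hU _ hkU']
  simp only [hco, mapOp_partialSec_mk hU _ _ hkU,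
    mulOp_toLInf (hcoord _) (G.aeSection_partial hU _ _ hkU)]
  have h12 := (G.aeSection_comp hU _ hkU').sub (G.aeSection_comp hU _ hkU)
  rw [← hsum.2, ← h12.2, ← (h12.1.sub hsum.1).2]
  refine norm_toLInf_le (by positivity) ?_
  filter_upwards [G.ae_mixedRegular, hm, k.ae_crBound_rep, (k + h).ae_crBound_rep,
    h.ae_crBound_rep, hseg] with ω h1 h2 h3 h4 h5 h6
  simp only [LInfC.rep_add] at h4 h6
  simp only [compSec, LInfC.rep_add]
  exact hc.remainder (fun z (x : Eu m) => G z (toTorus x) ω) ‖G‖ ‖h‖ R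
    (fun x => LInfC.rep k (toTorus x) ω) (fun x => LInfC.rep h (toTorus x) ω)
    h1 h2 (h3.mono hk) (h4.mono hk') h5 fun x => h6 _

/-- Convexity of the balls about `Ks` replaces convexity of `U`. -/
theorem ae_segment_subset {Ks : RSection P (Eu n) m r} {δ : ℝ}
    (hKs : ∀ᵐ ω ∂P, ∀ θ, Metric.closedBall (Ks θ ω) δ ⊆ U) {k k' : LInfC P (Eu n) m r}
    (hk : ‖k - SeparationQuotient.mk Ks‖ ≤ δ) (hk' : ‖k' - SeparationQuotient.mk Ks‖ ≤ δ) :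
    ∀ᵐ ω ∂P, ∀ θ, segment ℝ (LInfC.rep k' θ ω) (LInfC.rep k θ ω) ⊆ U := by
  filter_upwards [hKs, LInfC.ae_norm_rep_sub_le k (SeparationQuotient.mk Ks),
    LInfC.ae_norm_rep_sub_le k' (SeparationQuotient.mk Ks), LInfC.ae_rep_mk Ks] with ω h1 h2 h3 h4 θ
  have h5 := h2 θ
  have h6 := h3 θ
  rw [h4] at h5 h6
  exact ((convex_closedBall _ _).segment_subset (mem_closedBall_iff_norm.2 (h6.trans hk'))
    (mem_closedBall_iff_norm.2 (h5.trans hk))).trans (h1 θ)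

theorem hasFDerivAt_transportMap (hU : IsOpen U) {Ks : RSection P (Eu n) m r} {δ : ℝ}
    (hKs : ∀ᵐ ω ∂P, ∀ θ, Metric.closedBall (Ks θ ω) δ ⊆ U) {k : LInfC P (Eu n) m r}
    (hk : k ∈ Metric.ball (SeparationQuotient.mk Ks) δ)
    (G : LInfCSigma P m (sigmaSet r 1) U) :
    HasFDerivAt (fun k => transportMap hΦ α U k G) (transportDeriv hΦ α U k G) k := by
  obtain ⟨G, rfl⟩ := SeparationQuotient.surjective_mk G
  obtain ⟨c, hc⟩ := exists_compBounds hU m r (‖k‖ + 1)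
  have hc0 : 0 < c := zero_lt_one.trans_le hc.one_le
  rw [hasFDerivAt_iff_isLittleO_nhds_zero, Asymptotics.isLittleO_iff]
  intro ε hε
  -- Half of `ε` is spent on the modulus of continuity, the other half on the term `‖G‖ * ‖h‖` of
  -- the remainder.
  obtain ⟨τ, hτ, hm⟩ := G.exists_ae_mixedModulus (show 0 < ε / (2 * c) by positivity)
  have h1 : ∀ᶠ h in 𝓝 (0 : LInfC P (Eu n) m r), ‖h‖ ≤ τ :=
    (tendsto_norm_zero (E := LInfC P (Eu n) m r)).eventually_le_const hτ
  have h2 : ∀ᶠ h in 𝓝 (0 : LInfC P (Eu n) m r), ‖h‖ ≤ 1 :=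
    (tendsto_norm_zero (E := LInfC P (Eu n) m r)).eventually_le_const one_pos
  have h3 : ∀ᶠ h in 𝓝 (0 : LInfC P (Eu n) m r), ‖G‖ * ‖h‖ ≤ ε / (2 * c) := by
    have : Tendsto (fun h : LInfC P (Eu n) m r => ‖G‖ * ‖h‖) (𝓝 0) (𝓝 0) := by
      simpa using (tendsto_norm_zero (E := LInfC P (Eu n) m r)).const_mul ‖G‖
    exact this.eventually_le_const (by positivity)
  have h4 : ∀ᶠ h in 𝓝 (0 : LInfC P (Eu n) m r),
      k + h ∈ Metric.ball (SeparationQuotient.mk Ks) δ := by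
    have : Tendsto (fun h : LInfC P (Eu n) m r => k + h) (𝓝 0) (𝓝 k) := by
      simpa using (continuous_const_add k).tendsto (0 : LInfC P (Eu n) m r)
    exact this.eventually_mem (Metric.isOpen_ball.mem_nhds hk)
  filter_upwards [h1, h2, h3, h4] with h h1 h2 h3 h4
  refine (norm_transportMap_remainder_le hΦ α hU hc (R := ε / (2 * c)) (by linarith)
    ((norm_add_le _ _).trans (by linarith))
    (ae_segment_subset hKs (mem_ball_iff_norm.1 hk).le (mem_ball_iff_norm.1 h4).le) ?_
    (by positivity)).trans ?_
  · filter_upwards [hm] with ω hω p hp x z w hzw hh using hω p hp x z w hzw (hh.trans h1)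
  · gcongr
    calc c * (ε / (2 * c) + ‖G‖ * ‖h‖) ≤ c * (ε / (2 * c) + ε / (2 * c)) := by gcongr
      _ = ε := by field_simp; ring

theorem continuousOn_transportDeriv (hU : IsOpen U) {Ks : RSection P (Eu n) m r} {δ : ℝ}
    (hKs : ∀ᵐ ω ∂P, ∀ θ, Metric.closedBall (Ks θ ω) δ ⊆ U)
    (G : LInfCSigma P m (sigmaSet r 1) U) :
    ContinuousOn (fun k => transportDeriv hΦ α U k G)
      (Metric.ball (SeparationQuotient.mk Ks) δ) := by
  intro k hk
  refine ContinuousAt.continuousWithinAt ?_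
  obtain ⟨G, rfl⟩ := SeparationQuotient.surjective_mk G
  obtain ⟨c, hc⟩ := exists_compBounds hU m r (‖k‖ + 1)
  have hc0 : 0 < c := zero_lt_one.trans_le hc.one_le
  rw [Metric.continuousAt_iff']
  intro ε hε
  set D : ℝ := ∑ i : Fin n, ‖partialMulOp hΦ α (P := P) r i‖ with hD
  have hD0 : 0 ≤ D := Finset.sum_nonneg fun i _ => (partialMulOp hΦ α r i).opNorm_nonneg
  set R : ℝ := ε / (4 * c * (D + 1)) with hRdef
  have hR : 0 < R := by positivity
  obtain ⟨τ₀, hτ₀, hm⟩ := G.exists_ae_mixedModulus hR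
  obtain ⟨τ, hτ, hτ1, hτ2, hτ3⟩ : ∃ τ > 0, τ ≤ τ₀ ∧ τ ≤ 1 ∧ ‖G‖ * τ ≤ R := by
    refine ⟨min τ₀ (min 1 (R / (‖G‖ + 1))), by positivity, min_le_left _ _,
      (min_le_right _ _).trans (min_le_left _ _), ?_⟩
    have : min τ₀ (min 1 (R / (‖G‖ + 1))) ≤ R / (‖G‖ + 1) :=
      (min_le_right _ _).trans (min_le_right _ _)
    calc _ ≤ (‖G‖ + 1) * (R / (‖G‖ + 1)) := by gcongr; linarith
      _ = R := by field_simp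
  filter_upwards [Metric.isOpen_ball.mem_nhds hk, Metric.ball_mem_nhds k hτ] with k' h1 h2
  rw [mem_ball_iff_norm] at h2
  have h3 : ‖k'‖ ≤ ‖k‖ + 1 := by
    have := norm_sub_norm_le k' k
    linarith
  rw [dist_eq_norm]
  refine (norm_transportDeriv_sub_le hΦ α hU hc (R := R) (A := ‖G‖) (τ := τ) (by linarith) h3
    (ae_segment_subset hKs (mem_ball_iff_norm.1 hk).le (mem_ball_iff_norm.1 h1).le) le_rfl ?_
    h2.le hR.le).trans_lt ?_
  · filter_upwards [hm] with ω hω p hp x z w hzw hh using hω p hp x z w hzw (hh.trans hτ1)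
  · calc D * (c * (R + ‖G‖ * τ)) ≤ D * (c * (R + R)) := by gcongr
      _ ≤ (D + 1) * (c * (R + R)) := by gcongr; linarith
      _ = ε / 2 := by rw [hRdef]; field_simp; ring
      _ < ε := by linarith

end InvarianceMap

end RandomTorus

/-! ### Green matrices along a single orbit -/

/-- The values along one orbit of the Green matrices of a linear cocycle: `γ k j` is the `k`-th
matrix and `M j` the cocycle at the `j`-th point of the orbit. -/
structure IsGreenAlongOrbit {E : Type*} [NormedAddCommGroup E] [NormedSpace ℝ E]
    (M : ℤ → E →L[ℝ] E) (γ : ℤ → ℤ → E →L[ℝ] E) : Prop where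
  left : ∀ k j, M j * γ k j = γ (k + 1) (j + 1) - if k = -1 then 1 else 0
  right : ∀ k j, γ k j * M (j - k - 1) = γ (k + 1) j - if k = -1 then 1 else 0

namespace IsGreenAlongOrbit

variable {E : Type*} [NormedAddCommGroup E] [NormedSpace ℝ E]
  {M : ℤ → E →L[ℝ] E} {γ : ℤ → ℤ → E →L[ℝ] E}

/-- A priori bound for bounded orbits of the inhomogeneous cocycle. -/
theorem norm_sub_le (hγ : IsGreenAlongOrbit M γ) {p h : ℤ → E} {b H : ℝ}
    (hp : ∀ j, p (j + 1) = M j (p j) + h j) (hb : ∀ k, ‖γ k 0‖ ≤ b) (hH : ∀ j, ‖h j‖ ≤ H) (N : ℕ) :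
    ‖γ N 0 (p (-N)) - γ (-N) 0 (p N) - if N = 0 then 0 else p 0‖ ≤ 2 * N * (b * H) := by
  have hb0 : 0 ≤ b := (norm_nonneg _).trans (hb 0)
  -- Replacing `p (-k)` by its predecessor raises the index of `γ` by one at the price of one
  -- inhomogeneous term. The sum over `-N ≤ k < N` telescopes and meets the impulse `p 0` once, at
  -- `k = -1`.
  have key : ∀ k : ℤ, γ k 0 (p (-k)) = γ (k + 1) 0 (p (-(k + 1)))
      - (if k = -1 then p 0 else 0) + γ k 0 (h (-k - 1)) := by
    intro k
    have h1 := hp (-k - 1)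
    have h2 := DFunLike.congr_fun (hγ.right k 0) (p (-k - 1))
    rw [show -k - 1 + 1 = -k by ring] at h1
    rw [show (0 : ℤ) - k - 1 = -k - 1 by ring] at h2
    rw [h1, map_add, show -(k + 1) = -k - 1 by ring]
    congr 1
    refine h2.trans ?_
    by_cases hk : k = -1
    · subst hk
      simp
    · simp [hk]
  have hh : ∀ k j, ‖γ k 0 (h j)‖ ≤ b * H := fun k j =>
    (γ k 0).le_of_opNorm_le_of_le (hb k) (hH j)
  induction N with
  | zero => simp
  | succ N ih =>
    have k1 := key N
    have k2 := key (-(N + 1))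
    have hN : ¬((N : ℤ) = -1) := by omega
    rw [if_neg hN] at k1
    rw [show -((N : ℤ) + 1) + 1 = -N by ring, neg_neg, neg_neg] at k2
    have e : γ ((N + 1 : ℕ) : ℤ) 0 (p (-((N + 1 : ℕ) : ℤ)))
        - γ (-((N + 1 : ℕ) : ℤ)) 0 (p ((N + 1 : ℕ) : ℤ)) - (if N + 1 = 0 then 0 else p 0)
        = (γ N 0 (p (-N)) - γ (-N) 0 (p N) - if N = 0 then 0 else p 0)
          - γ N 0 (h (-N - 1)) - γ (-(N + 1)) 0 (h ((N : ℤ) + 1 - 1)) := by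
      push_cast
      rw [k1, k2]
      rcases Nat.eq_zero_or_pos N with rfl | hpos
      · simp
        abel
      · have h1 : ¬(-((N : ℤ) + 1) = -1) := by omega
        simp [hpos.ne']
        abel
    rw [e]
    have h1 := hh N (-N - 1)
    have h2 := hh (-(N + 1)) ((N : ℤ) + 1 - 1)
    calc _ ≤ 2 * N * (b * H) + b * H + b * H :=
          (_root_.norm_sub_le _ _).trans (add_le_add ((_root_.norm_sub_le _ _).trans (add_le_add ih h1)) h2)
      _ = _ := by push_cast; ring

theorem norm_le (hγ : IsGreenAlongOrbit M γ) {p h : ℤ → E} {b b' H Q : ℝ}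
    (hp : ∀ j, p (j + 1) = M j (p j) + h j) (hb : ∀ k, ‖γ k 0‖ ≤ b)
    (hb' : ∀ k : ℤ, ‖γ k 0‖ * |(k : ℝ) + 1| ≤ b') (hQ : ∀ j, ‖p j‖ ≤ Q)
    (hH : ∀ j, ‖h j‖ ≤ H) {N : ℕ} (hN0 : 0 < N) (hN : 4 * b' ≤ N) :
    ‖p 0‖ ≤ Q / 2 + 2 * (N + 1) * (b * H) := by
  -- The length is `N + 1` because the decay is measured by `|k + 1|`, which is still `N` at `k =
  -- -(N + 1)`. So each of the two boundary terms is at most `Q / 4`.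
  have h1 := hγ.norm_sub_le hp hb hH (N + 1)
  rw [if_neg (Nat.succ_ne_zero N)] at h1
  have hN' : (0 : ℝ) < N := by exact_mod_cast hN0
  have hQ0 : 0 ≤ Q := (norm_nonneg _).trans (hQ 0)
  have key : ∀ k j : ℤ, (N : ℝ) ≤ |(k : ℝ) + 1| → ‖γ k 0 (p j)‖ ≤ Q / 4 := by
    intro k j hk
    have h2 : ‖γ k 0‖ ≤ 1 / 4 := by
      have h3 : ‖γ k 0‖ * N ≤ ‖γ k 0‖ * |(k : ℝ) + 1| := by gcongr
      have h4 := hb' k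
      by_contra hcon
      have h5 : 1 / 4 * (N : ℝ) < ‖γ k 0‖ * N := by
        gcongr
        exact not_le.1 hcon
      linarith
    exact ((γ k 0).le_of_opNorm_le_of_le h2 (hQ j)).trans_eq (by ring)
  have h2 := key ((N + 1 : ℕ) : ℤ) (-((N + 1 : ℕ) : ℤ)) (by
    push_cast
    rw [abs_of_nonneg (by positivity)]
    linarith)
  have h3 := key (-((N + 1 : ℕ) : ℤ)) ((N + 1 : ℕ) : ℤ) (by
    push_cast
    rw [show (-((N : ℝ) + 1) + 1) = -N by ring, abs_neg, abs_of_nonneg hN'.le])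
  have h4 : ∀ u v w : E, ‖w‖ ≤ ‖u‖ + ‖v‖ + ‖u - v - w‖ := fun u v w => by
    calc ‖w‖ = ‖u - v - (u - v - w)‖ := by congr 1; abel
      _ ≤ _ := (_root_.norm_sub_le _ _).trans (by gcongr; exact _root_.norm_sub_le _ _)
  have h5 := h4 (γ ((N + 1 : ℕ) : ℤ) 0 (p (-((N + 1 : ℕ) : ℤ))))
    (γ (-((N + 1 : ℕ) : ℤ)) 0 (p ((N + 1 : ℕ) : ℤ))) (p 0)
  have h6 : 2 * ((N + 1 : ℕ) : ℝ) * (b * H) = 2 * (N + 1) * (b * H) := by push_cast; ring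
  linarith

/-- The forward products of the cocycle. -/
def fwd (M : ℤ → E →L[ℝ] E) : ℕ → E →L[ℝ] E
  | 0 => 1
  | N + 1 => M N * fwd M N

/-- The backward products of the inverses of the cocycle. -/
noncomputable def bwd (M : ℤ → E →L[ℝ] E) : ℕ → E →L[ℝ] E
  | 0 => 1
  | N + 1 => (M (-((N : ℤ) + 1))).inverse * bwd M N

/-- The products of the cocycle which end at the initial point. -/
def past (M : ℤ → E →L[ℝ] E) : ℕ → E →L[ℝ] E
  | 0 => 1
  | N + 1 => past M N * M (-((N : ℤ) + 1))

/-- This and the next three identities relate products of the cocycle to Green matrices on either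
side; they reduce the growth criteria to the decay of `γ`. -/
theorem fwd_mul (hγ : IsGreenAlongOrbit M γ) (N : ℕ) : fwd M N * γ 0 0 = γ N N := by
  induction N with
  | zero => simp [fwd]
  | succ N ih =>
    have h := hγ.left N N
    rw [if_neg (by omega), sub_zero] at h
    rw [fwd, mul_assoc, ih, h]
    push_cast
    rfl

theorem mul_fwd (hγ : IsGreenAlongOrbit M γ) (N : ℕ) :
    γ (-N) 0 * fwd M N = γ 0 0 - if N = 0 then 0 else 1 := by
  induction N with
  | zero => simp [fwd]
  | succ N ih =>
    have h := hγ.right (-(N + 1)) 0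
    rw [show (0 : ℤ) - -(N + 1) - 1 = N by ring, show -((N : ℤ) + 1) + 1 = -N by ring] at h
    push_cast
    rw [fwd, ← mul_assoc, h, sub_mul, ih]
    rcases Nat.eq_zero_or_pos N with rfl | hpos
    · simp [fwd]
    · have h1 : ¬(-((N : ℤ) + 1) = -1) := by omega
      simp [hpos.ne']

theorem mul_past (hγ : IsGreenAlongOrbit M γ) (N : ℕ) : γ 0 0 * past M N = γ N 0 := by
  induction N with
  | zero => simp [past]
  | succ N ih =>
    have h := hγ.right N 0
    rw [if_neg (by omega), sub_zero, show (0 : ℤ) - N - 1 = -(N + 1) by ring] at h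
    rw [past, ← mul_assoc, ih, h]
    push_cast
    rfl

theorem past_mul (hγ : IsGreenAlongOrbit M γ) (N : ℕ) :
    past M N * γ (-N) (-N) = γ 0 0 - if N = 0 then 0 else 1 := by
  induction N with
  | zero => simp [past]
  | succ N ih =>
    have h := hγ.left (-(N + 1)) (-(N + 1))
    rw [show -((N : ℤ) + 1) + 1 = -N by ring] at h
    push_cast
    rw [past, mul_assoc, h, mul_sub, ih]
    rcases Nat.eq_zero_or_pos N with rfl | hpos
    · simp [past]
    · have h1 : ¬(-((N : ℤ) + 1) = -1) := by omega
      simp [hpos.ne']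

theorem bwd_mul_past (hM : ∀ j, (M j).IsInvertible) (N : ℕ) : bwd M N * past M N = 1 := by
  induction N with
  | zero => simp [bwd, past]
  | succ N ih =>
    have h : (M (-((N : ℤ) + 1))).inverse * M (-((N : ℤ) + 1)) = 1 := (hM _).inverse_comp_self
    rw [bwd, past, mul_assoc, ← mul_assoc (bwd M N), ih, one_mul, h]

theorem past_mul_bwd (hM : ∀ j, (M j).IsInvertible) (N : ℕ) : past M N * bwd M N = 1 := by
  induction N with
  | zero => simp [bwd, past]
  | succ N ih =>
    have h : M (-((N : ℤ) + 1)) * (M (-((N : ℤ) + 1))).inverse = 1 := (hM _).self_comp_inverse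
    rw [bwd, past, mul_assoc, ← mul_assoc (M _), h, one_mul, ih]

variable {D lam : ℝ}

theorem eq_zero_of_norm_le {w : E} {a : ℝ} (hl : 0 < lam) (hl1 : lam < 1)
    (h : ∀ N : ℕ, N ≠ 0 → ‖w‖ ≤ a * (lam ^ N * lam ^ N)) : w = 0 := by
  have h1 : Tendsto (fun N : ℕ => a * (lam ^ N * lam ^ N)) atTop (𝓝 0) := by
    have := tendsto_pow_atTop_nhds_zero_of_lt_one hl.le hl1
    simpa using (this.mul this).const_mul a
  have h2 : ‖w‖ ≤ 0 := ge_of_tendsto h1 ((eventually_ne_atTop 0).mono fun N hN => h N hN)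
  exact norm_le_zero_iff.1 h2

/-- The unstable component of `v` is, up to sign, `γ (-N) 0` applied to the `N`-th iterate. The
matrix and the iterate each contribute a factor `lam ^ N`. -/
theorem apply_eq_self_of_norm_fwd_le (hγ : IsGreenAlongOrbit M γ) (hl : 0 < lam) (hl1 : lam < 1)
    (hD : ∀ (N : ℕ) j, ‖γ (-N) j‖ ≤ D * lam ^ N) {v : E} {a : ℝ}
    (hv : ∀ N : ℕ, ‖fwd M N v‖ ≤ a * lam ^ N) : γ 0 0 v = v := by
  rw [← sub_eq_zero]
  refine eq_zero_of_norm_le (a := D * a) hl hl1 fun N hN => ?_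
  have h := DFunLike.congr_fun (hγ.mul_fwd N) v
  rw [if_neg hN] at h
  have h' : γ 0 0 v - v = γ (-N) 0 (fwd M N v) := h.symm
  rw [h']
  refine ((γ (-N) 0).le_of_opNorm_le_of_le (hD N 0) (hv N)).trans_eq ?_
  ring

theorem mem_stable_iff (hγ : IsGreenAlongOrbit M γ) (hl : 0 < lam) (hl1 : lam < 1)
    (hD : ∀ (N : ℕ) j, ‖γ N j‖ ≤ D * lam ^ N) (hD' : ∀ (N : ℕ) j, ‖γ (-N) j‖ ≤ D * lam ^ N)
    (v : E) : γ 0 0 v = v ↔ ∀ N : ℕ, ‖fwd M N v‖ ≤ D * lam ^ N * ‖v‖ := by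
  refine ⟨fun h N => ?_, fun h => hγ.apply_eq_self_of_norm_fwd_le hl hl1 hD' (a := D * ‖v‖)
    fun N => (h N).trans_eq (by ring)⟩
  have h1 : fwd M N v = γ N N v := by
    conv_lhs => rw [← h]
    exact DFunLike.congr_fun (hγ.fwd_mul N) v
  rw [h1]
  exact (γ N N).le_of_opNorm_le (hD N N) v

/-- The forward orbit of `γ 0 0 v` is `γ N N v`, which decays, so the growth criterion applies to
it. -/
theorem apply_apply (hγ : IsGreenAlongOrbit M γ) (hl : 0 < lam) (hl1 : lam < 1)
    (hD : ∀ (N : ℕ) j, ‖γ N j‖ ≤ D * lam ^ N) (hD' : ∀ (N : ℕ) j, ‖γ (-N) j‖ ≤ D * lam ^ N)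
    (v : E) : γ 0 0 (γ 0 0 v) = γ 0 0 v := by
  refine hγ.apply_eq_self_of_norm_fwd_le hl hl1 hD' (a := D * ‖v‖) fun N => ?_
  have h1 : fwd M N (γ 0 0 v) = γ N N v := DFunLike.congr_fun (hγ.fwd_mul N) v
  rw [h1]
  exact ((γ N N).le_of_opNorm_le (hD N N) v).trans_eq (by ring)

/-- If `γ 0 0 v = 0`, then for `N > 0` the backward iterate of `v` is `-γ (-N) (-N) v`; at `N = 0`
the bound needs `1 ≤ D`. Conversely `γ 0 0 v` is `γ N 0` applied to the backward iterate, again with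
two decaying factors. -/
theorem mem_unstable_iff (hγ : IsGreenAlongOrbit M γ) (hM : ∀ j, (M j).IsInvertible) (hl : 0 < lam)
    (hl1 : lam < 1) (hD1 : 1 ≤ D) (hD : ∀ (N : ℕ) j, ‖γ N j‖ ≤ D * lam ^ N)
    (hD' : ∀ (N : ℕ) j, ‖γ (-N) j‖ ≤ D * lam ^ N) (v : E) :
    γ 0 0 v = 0 ↔ ∀ N : ℕ, ‖bwd M N v‖ ≤ D * (lam⁻¹ ^ N)⁻¹ * ‖v‖ := by
  simp only [inv_pow, inv_inv]
  constructor
  · intro h N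
    rcases Nat.eq_zero_or_pos N with rfl | hN
    · simpa [bwd] using le_mul_of_one_le_left (norm_nonneg v) hD1
    · have h1 := DFunLike.congr_fun (hγ.past_mul N) v
      rw [if_neg hN.ne'] at h1
      have h2 : past M N (γ (-N) (-N) v) = γ 0 0 v - v := h1
      rw [h, zero_sub] at h2
      have h3 : bwd M N (past M N (γ (-N) (-N) v)) = γ (-N) (-N) v :=
        DFunLike.congr_fun (bwd_mul_past hM N) _
      rw [h2, map_neg] at h3
      rw [← norm_neg, h3]
      exact (γ (-N) (-N)).le_of_opNorm_le (hD' N (-N)) v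
  · intro h
    refine eq_zero_of_norm_le (a := D * (D * ‖v‖)) hl hl1 fun N _ => ?_
    have h1 : past M N (bwd M N v) = v := DFunLike.congr_fun (past_mul_bwd hM N) v
    have h2 : γ 0 0 (past M N (bwd M N v)) = γ N 0 (bwd M N v) :=
      DFunLike.congr_fun (hγ.mul_past N) _
    rw [h1] at h2
    rw [h2]
    exact ((γ N 0).le_of_opNorm_le_of_le (hD N 0) (h N)).trans_eq (by ring)

end IsGreenAlongOrbit

/-! ### From operators on sections to matrices along orbits -/

namespace RandomTorus

section Transfer

variable {Ω : Type*} [MeasurableSpace Ω] {P : Measure Ω} {n m r : ℕ} {Φ : Ω ≃ᵐ Ω}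
  {α : Eu m}

/-- The transport of a function along the `k`-th iterate of the skew-product. -/
def orbitShift (Φ : Ω ≃ᵐ Ω) (α : Eu m) {W : Type*} (k : ℤ) (f : Torus m → Ω → W) :
    Torus m → Ω → W :=
  fun θ ω => f (θ - k • toTorus α) (zpowMap Φ (-k) ω)

theorem orbitShift_zero {W : Type*} (f : Torus m → Ω → W) : orbitShift Φ α 0 f = f := by
  funext θ ω
  simp [orbitShift, zpowMap_zero]

theorem orbitShift_add {W : Type*} (f : Torus m → Ω → W) (j k : ℤ) :
    orbitShift Φ α j (orbitShift Φ α k f) = orbitShift Φ α (j + k) f := by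
  funext θ ω
  simp only [orbitShift]
  rw [← zpowMap_add, add_zsmul, sub_sub, neg_add, add_comm (-k)]

theorem orbitShift_one_apply {W : Type*} (f : Torus m → Ω → W) (θ : Torus m) (ω : Ω) :
    orbitShift Φ α 1 f θ ω = f (θ - toTorus α) (Φ.symm ω) := by
  simp only [orbitShift, one_zsmul, zpowMap_neg_one]

section

variable {V : Type*} [NormedAddCommGroup V] [NormedSpace ℝ V] [MeasurableSpace V] [BorelSpace V]
  [SecondCountableTopology V]

theorem orbitShift_eq (f : Torus m → Ω → V) (k : ℤ) :
    orbitShift Φ α k f = fun θ ω => f (θ + toTorus (-(k • α))) (zpowMap Φ (-k) ω) := by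
  funext θ ω
  rw [orbitShift, toTorus_neg, toTorus_zsmul, sub_eq_add_neg]

theorem AESection.orbitShift (hΦ : MeasurePreserving Φ P P) {f : Torus m → Ω → V}
    (hf : AESection P r f) (k : ℤ) : AESection P r (orbitShift Φ α k f) := by
  rw [orbitShift_eq]
  exact hf.pull _ (measurePreserving_zpowMap hΦ (-k))

theorem norm_toLInf_orbitShift_le (hΦ : MeasurePreserving Φ P P) {f : Torus m → Ω → V}
    (hf : AESection P r f) (k : ℤ) :
    ‖toLInf P r (RandomTorus.orbitShift Φ α k f)‖ ≤ ‖toLInf P r f‖ := by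
  rw [orbitShift_eq, ← pullOp_toLInf hf _ (measurePreserving_zpowMap hΦ (-k))]
  exact ((pullOp V r _ _).le_of_opNorm_le (norm_pullOp_le _ _) _).trans_eq (one_mul _)

end

/-- The image of a section under the linear skew-product with matrices `M`. -/
def transport (Φ : Ω ≃ᵐ Ω) (α : Eu m) (M : Torus m → Ω → (Eu n →L[ℝ] Eu n))
    (f : Torus m → Ω → Eu n) : Torus m → Ω → Eu n :=
  orbitShift Φ α 1 fun θ ω => M θ ω (f θ ω)

variable (P r) in
/-- `a` is the transfer operator of the cocycle `M` on random sections. -/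
def IsTransferOp (Φ : Ω ≃ᵐ Ω) (α : Eu m) (M : Torus m → Ω → (Eu n →L[ℝ] Eu n))
    (a : LInfC P (Eu n) m r →L[ℝ] LInfC P (Eu n) m r) : Prop :=
  ∀ f, AESection P r f → AESection P r (transport Φ α M f) ∧
    a (toLInf P r f) = toLInf P r (transport Φ α M f)

/-- The matrix with given columns. -/
noncomputable def matrixOfColumns {n : ℕ} (g : Fin n → Eu n) : Eu n →L[ℝ] Eu n :=
  ∑ i, (EuclideanSpace.proj i : Eu n →L[ℝ] ℝ).smulRight (g i)

theorem matrixOfColumns_apply {n : ℕ} (g : Fin n → Eu n) (v : Eu n) :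
    matrixOfColumns g v = ∑ i, v i • g i := by
  simp [matrixOfColumns]

theorem matrixOfColumns_single {n : ℕ} (g : Fin n → Eu n) (i : Fin n) :
    matrixOfColumns g (EuclideanSpace.single i 1) = g i := by
  rw [matrixOfColumns_apply, Finset.sum_eq_single i] <;> simp +contextual

theorem clm_ext_single {n : ℕ} {A B : Eu n →L[ℝ] Eu n}
    (h : ∀ i, A (EuclideanSpace.single i 1) = B (EuclideanSpace.single i 1)) : A = B := by
  ext1 v
  rw [sum_smul_single v, map_sum, map_sum]
  exact Finset.sum_congr rfl fun i _ => by rw [map_smul, map_smul, h]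

theorem norm_matrixOfColumns_le {n : ℕ} {g : Fin n → Eu n} {C : ℝ} (hC : 0 ≤ C)
    (h : ∀ i, ‖g i‖ ≤ C) : ‖matrixOfColumns g‖ ≤ n * C := by
  refine ContinuousLinearMap.opNorm_le_bound _ (by positivity) fun v => ?_
  rw [matrixOfColumns_apply]
  calc _ ≤ ∑ i : Fin n, ‖v‖ * C := by
        refine norm_sum_le_of_le _ fun i _ => ?_
        rw [norm_smul]
        gcongr
        · exact PiLp.norm_apply_le v i
        · exact h i
    _ = _ := by simp; ring

theorem aeSection_const (v : Eu n) : AESection P r fun (_ : Torus m) (_ : Ω) => v :=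
  aeSection_of_ae (C := ‖v‖) measurable_const (Eventually.of_forall fun _ => CrBound.const v)
    (Eventually.of_forall fun _ _ => rfl)

theorem norm_toLInf_const_le (v : Eu n) :
    ‖toLInf P r fun (_ : Torus m) (_ : Ω) => v‖ ≤ ‖v‖ :=
  norm_toLInf_le (norm_nonneg v) (Eventually.of_forall fun _ => CrBound.const v)

/-- The matrix of an operator on random sections. -/
noncomputable def opMatrix (A : LInfC P (Eu n) m r →L[ℝ] LInfC P (Eu n) m r) (θ : Torus m)
    (ω : Ω) : Eu n →L[ℝ] Eu n :=
  matrixOfColumns fun i =>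
    LInfC.rep (A (toLInf P r fun _ _ => EuclideanSpace.single i (1 : ℝ))) θ ω

theorem measurable_opMatrix (A : LInfC P (Eu n) m r →L[ℝ] LInfC P (Eu n) m r) :
    Measurable fun p : Torus m × Ω => opMatrix A p.1 p.2 := by
  unfold opMatrix matrixOfColumns
  refine Finset.measurable_sum _ fun i _ => ?_
  have : Continuous fun v : Eu n => (EuclideanSpace.proj i : Eu n →L[ℝ] ℝ).smulRight v :=
    (ContinuousLinearMap.smulRightL ℝ (Eu n) (Eu n) (EuclideanSpace.proj i)).continuous
  exact this.measurable.comp (LInfC.rep (A (toLInf P r fun _ _ =>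
    EuclideanSpace.single i (1 : ℝ)))).2.meas

theorem ae_contDiff_opMatrix (A : LInfC P (Eu n) m r →L[ℝ] LInfC P (Eu n) m r) :
    ∀ᵐ ω ∂P, ContDiff ℝ r fun x : Eu m => opMatrix A (toTorus x) ω := by
  have h : ∀ᵐ ω ∂P, ∀ i : Fin n, ContDiff ℝ r fun x : Eu m =>
      LInfC.rep (A (toLInf P r fun _ _ => EuclideanSpace.single i (1 : ℝ))) (toTorus x) ω :=
    ae_all_iff.2 fun i => (LInfC.rep _).2.smooth
  filter_upwards [h] with ω h
  unfold opMatrix matrixOfColumns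
  exact ContDiff.sum fun i _ =>
    (ContinuousLinearMap.smulRightL ℝ (Eu n) (Eu n) (EuclideanSpace.proj i)).contDiff.comp (h i)

theorem ae_norm_opMatrix_le (A : LInfC P (Eu n) m r →L[ℝ] LInfC P (Eu n) m r) :
    ∀ᵐ ω ∂P, ∀ θ, ‖opMatrix A θ ω‖ ≤ n * ‖A‖ := by
  have h : ∀ᵐ ω ∂P, ∀ i : Fin n, ∀ θ,
      ‖LInfC.rep (A (toLInf P r fun _ _ => EuclideanSpace.single i (1 : ℝ))) θ ω‖ ≤ ‖A‖ := by
    refine ae_all_iff.2 fun i => ?_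
    filter_upwards [RSection.ae_norm_le (LInfC.rep (A (toLInf P r fun _ _ =>
      EuclideanSpace.single i (1 : ℝ))))] with ω h θ
    refine (h θ).trans ?_
    rw [LInfC.norm_rep]
    refine (A.le_opNorm_of_le (norm_toLInf_const_le _)).trans ?_
    exact mul_le_of_le_one_right (norm_nonneg A) (norm_single_one_le i)
  filter_upwards [h] with ω h θ
  exact norm_matrixOfColumns_le (norm_nonneg A) fun i => h i θ

/-- The operator `G k` of a Green family of a transfer operator acts by matrices along the `k`-th
iterate of the skew-product. -/
theorem IsTransferOp.greenFamily_apply (hΦ : MeasurePreserving Φ P P)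
    {M : Torus m → Ω → (Eu n →L[ℝ] Eu n)} {a : LInfC P (Eu n) m r →L[ℝ] LInfC P (Eu n) m r}
    (ha : IsTransferOp P r Φ α M a) {G : ℤ → LInfC P (Eu n) m r →L[ℝ] LInfC P (Eu n) m r} {c : ℝ}
    (hG : IsGreenFamily a G c) (k : ℤ) {u : Torus m → Ω → Eu n} (hu : AESection P r u) :
    AESection P r (fun θ ω => opMatrix (G k) θ ω (orbitShift Φ α k u θ ω)) ∧
      G k (toLInf P r u)
        = toLInf P r fun θ ω => opMatrix (G k) θ ω (orbitShift Φ α k u θ ω) := by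
  have hui : ∀ i, AESection P r fun θ ω => u θ ω i := fun i =>
    hu.postcomp (EuclideanSpace.proj i : Eu n →L[ℝ] ℝ)
  set e : Fin n → Eu n := fun i => EuclideanSpace.single i 1 with he
  have hmul : ∀ i, AESection P r (fun θ ω => u θ ω i • e i) := fun i =>
    (hui i).mul (aeSection_const _)
  have hdec : toLInf P r u = ∑ i, mulOp P (Eu n) m r (toLInf P r fun θ ω => u θ ω i)
      (toLInf P r fun _ _ => e i) := by
    simp only [mulOp_toLInf (hui _) (aeSection_const _)]
    rw [← (AESection.sum Finset.univ fun i _ => hmul i).2]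
    congr 1
    funext θ ω
    exact sum_smul_single _
  -- The operator `a` intertwines multiplication by a scalar function with multiplication by its
  -- transport, and `intertwine` hands this on to the Green family. Hence `G k` is determined by its
  -- values on the constant basis sections.
  have hcomm : ∀ i, ∀ w, mulOp P (Eu n) m r
      (toLInf P r (orbitShift Φ α k fun θ ω => u θ ω i)) (G k w)
      = G k (mulOp P (Eu n) m r (toLInf P r fun θ ω => u θ ω i) w) := by
    intro i w
    have h := hG.intertwine (L := fun k => mulOp P (Eu n) m r
      (toLInf P r (orbitShift Φ α k fun θ ω => u θ ω i)))
      (b := 2 ^ r * ‖toLInf P r fun θ ω => u θ ω i‖) (fun k => ?_) (fun k => ?_) k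
    · have h' := DFunLike.congr_fun h w
      simp only [orbitShift_zero] at h'
      exact h'
    · refine (norm_mulOp_le _).trans ?_
      gcongr
      exact norm_toLInf_orbitShift_le hΦ (hui i) k
    · ext1 w
      obtain ⟨f, hf, rfl⟩ := w.exists_toLInf
      have hk := (hui i).orbitShift (α := α) hΦ k
      have hk1 := (hui i).orbitShift (α := α) hΦ (k + 1)
      change a (mulOp P (Eu n) m r _ (toLInf P r f)) = mulOp P (Eu n) m r _ (a (toLInf P r f))
      rw [mulOp_toLInf hk hf, (ha _ (hk.mul hf)).2, (ha f hf).2, mulOp_toLInf hk1 (ha f hf).1]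
      congr 1
      funext θ ω
      rw [add_comm k 1, ← orbitShift_add]
      simp only [transport, orbitShift_one_apply, map_smul]
  have hrep : ∀ i, AESection P r (fun θ ω => LInfC.rep (G k (toLInf P r fun _ _ => e i)) θ ω) :=
    fun i => aeSection_coe _
  have hterm : ∀ i, AESection P r (fun θ ω => orbitShift Φ α k (fun θ ω => u θ ω i) θ ω •
      LInfC.rep (G k (toLInf P r fun _ _ => e i)) θ ω) := fun i =>
    ((hui i).orbitShift hΦ k).mul (hrep i)
  have hsum := AESection.sum Finset.univ fun i (_ : i ∈ Finset.univ) => hterm i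
  have hfun : (fun θ ω => opMatrix (G k) θ ω (orbitShift Φ α k u θ ω)) = fun θ ω =>
      ∑ i, orbitShift Φ α k (fun θ ω => u θ ω i) θ ω •
      LInfC.rep (G k (toLInf P r fun _ _ => e i)) θ ω := by
    funext θ ω
    exact matrixOfColumns_apply _ _
  rw [hfun]
  refine ⟨hsum.1, ?_⟩
  rw [hsum.2, hdec, map_sum]
  refine Finset.sum_congr rfl fun i _ => ?_
  rw [← hcomm, ← mulOp_toLInf ((hui i).orbitShift hΦ k) (hrep i), LInfC.toLInf_rep]

theorem opMatrix_single (A : LInfC P (Eu n) m r →L[ℝ] LInfC P (Eu n) m r) (i : Fin n) (θ : Torus m)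
    (ω : Ω) : opMatrix A θ ω (EuclideanSpace.single i 1)
      = LInfC.rep (A (toLInf P r fun _ _ => EuclideanSpace.single i (1 : ℝ))) θ ω :=
  matrixOfColumns_single _ i

theorem aeSection_opMatrix_single (A : LInfC P (Eu n) m r →L[ℝ] LInfC P (Eu n) m r) (i : Fin n) :
    AESection P r (fun θ ω => opMatrix A θ ω (EuclideanSpace.single i 1)) ∧
      toLInf P r (fun θ ω => opMatrix A θ ω (EuclideanSpace.single i 1))
        = A (toLInf P r fun _ _ => EuclideanSpace.single i (1 : ℝ)) := by
  simp only [opMatrix_single]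
  exact ⟨aeSection_coe _, LInfC.toLInf_rep _⟩

variable {M : Torus m → Ω → (Eu n →L[ℝ] Eu n)} {a : LInfC P (Eu n) m r →L[ℝ] LInfC P (Eu n) m r}
  {G : ℤ → LInfC P (Eu n) m r →L[ℝ] LInfC P (Eu n) m r} {c : ℝ}

theorem aeSection_greenMatrix_sub (k : ℤ) (i : Fin n) :
    AESection P r (fun θ ω => (opMatrix (G (k + 1)) θ ω - if k = -1 then 1 else 0)
        (EuclideanSpace.single i 1)) ∧
      toLInf P r (fun θ ω => (opMatrix (G (k + 1)) θ ω - if k = -1 then 1 else 0)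
        (EuclideanSpace.single i 1))
        = (G (k + 1) - if k = -1 then 1 else 0)
          (toLInf P r fun _ _ => EuclideanSpace.single i (1 : ℝ)) := by
  have h1 := aeSection_opMatrix_single (G (k + 1)) i
  by_cases hk : k = -1
  · simp only [if_pos hk, sub_apply, one_apply_eq_self]
    rw [← h1.2]
    exact h1.1.sub (aeSection_const _)
  · simp only [if_neg hk, sub_zero]
    exact h1

/-- The relation `left` on the constant basis sections. The null set does not depend on `θ`, because
sections are identified on whole fibres. -/
theorem IsTransferOp.ae_mul_greenMatrix (hΦ : MeasurePreserving Φ P P)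
    (ha : IsTransferOp P r Φ α M a) (hG : IsGreenFamily a G c) :
    ∀ᵐ ω ∂P, ∀ θ, ∀ k : ℤ, M θ ω * opMatrix (G k) θ ω
      = opMatrix (G (k + 1)) (θ + toTorus α) (Φ ω) - if k = -1 then 1 else 0 := by
  have key : ∀ᵐ ω ∂P, ∀ (k : ℤ) (i : Fin n), ∀ θ,
      transport Φ α M (fun θ ω => opMatrix (G k) θ ω (EuclideanSpace.single i 1)) θ ω
        = (opMatrix (G (k + 1)) θ ω - if k = -1 then 1 else 0) (EuclideanSpace.single i 1) := by
    refine ae_all_iff.2 fun k => ae_all_iff.2 fun i => ?_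
    have h1 := aeSection_opMatrix_single (G k) i
    have h2 := ha _ h1.1
    have h3 := aeSection_greenMatrix_sub (G := G) k i
    refine ae_eq_of_toLInf_eq h2.1 h3.1 ?_
    rw [h3.2, ← h2.2, h1.2]
    exact DFunLike.congr_fun (hG.left k) _
  filter_upwards [hΦ.quasiMeasurePreserving.ae key] with ω h θ k
  refine clm_ext_single fun i => ?_
  rw [← h k i (θ + toTorus α), transport, orbitShift_one_apply, add_sub_cancel_right,
    Φ.symm_apply_apply]
  rfl

/-- In the relation `right` the operator `G k` acts on a transported basis section, which is no
longer constant; `greenFamily_apply` is what evaluates it. -/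
theorem IsTransferOp.ae_greenMatrix_mul (hΦ : MeasurePreserving Φ P P)
    (ha : IsTransferOp P r Φ α M a) (hG : IsGreenFamily a G c) :
    ∀ᵐ ω ∂P, ∀ θ, ∀ k : ℤ, opMatrix (G k) θ ω * orbitShift Φ α (k + 1) M θ ω
      = opMatrix (G (k + 1)) θ ω - if k = -1 then 1 else 0 := by
  have key : ∀ᵐ ω ∂P, ∀ (k : ℤ) (i : Fin n), ∀ θ,
      opMatrix (G k) θ ω
        (orbitShift Φ α k (transport Φ α M fun _ _ => EuclideanSpace.single i (1 : ℝ)) θ ω)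
        = (opMatrix (G (k + 1)) θ ω - if k = -1 then 1 else 0) (EuclideanSpace.single i 1) := by
    refine ae_all_iff.2 fun k => ae_all_iff.2 fun i => ?_
    have h1 := ha _ (aeSection_const (EuclideanSpace.single i (1 : ℝ)))
    have h2 := ha.greenFamily_apply hΦ hG k h1.1
    have h3 := aeSection_greenMatrix_sub (G := G) k i
    refine ae_eq_of_toLInf_eq h2.1 h3.1 ?_
    rw [h3.2, ← h2.2, ← h1.2]
    exact DFunLike.congr_fun (hG.right k) _
  filter_upwards [key] with ω h θ k
  refine clm_ext_single fun i => ?_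
  rw [← h k i θ, transport, orbitShift_add]
  rfl

/-- The Green matrices along almost every orbit. -/
theorem IsTransferOp.ae_isGreenAlongOrbit (hΦ : MeasurePreserving Φ P P)
    (ha : IsTransferOp P r Φ α M a) (hG : IsGreenFamily a G c) :
    ∀ᵐ ω ∂P, ∀ θ, IsGreenAlongOrbit
      (fun j => M (θ + j • toTorus α) (zpowMap Φ j ω))
      (fun k j => opMatrix (G k) (θ + j • toTorus α) (zpowMap Φ j ω)) := by
  have h : ∀ᵐ ω ∂P, ∀ j : ℤ, (∀ θ, ∀ k : ℤ, M θ (zpowMap Φ j ω) * opMatrix (G k) θ (zpowMap Φ j ω)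
      = opMatrix (G (k + 1)) (θ + toTorus α) (Φ (zpowMap Φ j ω)) - if k = -1 then 1 else 0) ∧
      ∀ θ, ∀ k : ℤ, opMatrix (G k) θ (zpowMap Φ j ω) * orbitShift Φ α (k + 1) M θ (zpowMap Φ j ω)
      = opMatrix (G (k + 1)) θ (zpowMap Φ j ω) - if k = -1 then 1 else 0 :=
    ae_all_iff.2 fun j => (measurePreserving_zpowMap hΦ j).quasiMeasurePreserving.ae
      ((ha.ae_mul_greenMatrix hΦ hG).and (ha.ae_greenMatrix_mul hΦ hG))
  filter_upwards [h] with ω h θ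
  refine ⟨fun k j => ?_, fun k j => ?_⟩
  · rw [(h j).1, ← zpowMap_one, ← zpowMap_add, add_assoc, add_comm 1 j, add_zsmul, one_zsmul]
  · rw [← (h j).2]
    simp only [orbitShift]
    rw [← zpowMap_add, add_sub_assoc, show j - k - 1 = j - (k + 1) by ring, sub_zsmul,
      show -(k + 1) + j = j - (k + 1) by ring, ← sub_eq_add_neg]

end Transfer

end RandomTorus

/-! ### Complexification and resolvents -/

theorem neg_mul_sub_one_of {A : Type*} [Ring A] {x a : A} (h : x - x * a = 1) :
    -x * (a - 1) = 1 := by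
  rw [neg_mul, mul_sub, neg_sub, mul_one, h]

theorem sub_one_mul_neg_of {A : Type*} [Ring A] {x a : A} (h : x - a * x = 1) :
    (a - 1) * -x = 1 := by
  rw [mul_neg, sub_mul, neg_sub, one_mul, h]

namespace RandomTorus

section Complexification

variable {n : ℕ}

/-- The inclusion `ℝⁿ → ℂⁿ`. -/
noncomputable def ofRealVec (n : ℕ) : Eu n →L[ℝ] EuC n :=
  LinearMap.mkContinuous
    { toFun := fun v => WithLp.toLp 2 fun k => (v k : ℂ)
      map_add' := fun v w => by ext k; simp
      map_smul' := fun c v => by ext k; simp } 1 fun v => by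
    rw [one_mul, EuclideanSpace.norm_eq, EuclideanSpace.norm_eq]
    simp

/-- The real part `ℂⁿ → ℝⁿ`. -/
noncomputable def reVec (n : ℕ) : EuC n →L[ℝ] Eu n :=
  LinearMap.mkContinuous
    { toFun := fun v => WithLp.toLp 2 fun k => (v k).re
      map_add' := fun v w => by ext k; simp
      map_smul' := fun c v => by ext k; simp } 1 fun v => by
    rw [one_mul, EuclideanSpace.norm_eq, EuclideanSpace.norm_eq]
    gcongr with k
    exact (v k).abs_re_le_norm

/-- The imaginary part `ℂⁿ → ℝⁿ`. -/
noncomputable def imVec (n : ℕ) : EuC n →L[ℝ] Eu n :=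
  LinearMap.mkContinuous
    { toFun := fun v => WithLp.toLp 2 fun k => (v k).im
      map_add' := fun v w => by ext k; simp
      map_smul' := fun c v => by ext k; simp } 1 fun v => by
    rw [one_mul, EuclideanSpace.norm_eq, EuclideanSpace.norm_eq]
    gcongr with k
    exact (v k).abs_im_le_norm

/-- Multiplication of vectors by a complex number, as a real linear map. -/
noncomputable def smulVec (n : ℕ) (y : ℂ) : EuC n →L[ℝ] EuC n :=
  LinearMap.mkContinuous
    { toFun := fun v => y • v
      map_add' := fun v w => smul_add y v w
      map_smul' := fun c v => smul_comm y c v } ‖y‖ fun v => (norm_smul y v).le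

theorem norm_ofRealVec_le : ‖ofRealVec n‖ ≤ 1 := LinearMap.mkContinuous_norm_le _ zero_le_one _

theorem norm_reVec_le : ‖reVec n‖ ≤ 1 := LinearMap.mkContinuous_norm_le _ zero_le_one _

theorem norm_imVec_le : ‖imVec n‖ ≤ 1 := LinearMap.mkContinuous_norm_le _ zero_le_one _

theorem norm_smulVec_le (y : ℂ) : ‖smulVec n y‖ ≤ ‖y‖ :=
  LinearMap.mkContinuous_norm_le _ (norm_nonneg y) _

theorem ofRealVec_apply (v : Eu n) (k : Fin n) : ofRealVec n v k = (v k : ℂ) := rfl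

theorem reVec_apply (v : EuC n) (k : Fin n) : reVec n v k = (v k).re := rfl

theorem imVec_apply (v : EuC n) (k : Fin n) : imVec n v k = (v k).im := rfl

theorem smulVec_apply (y : ℂ) (v : EuC n) : smulVec n y v = y • v := rfl

theorem reVec_ofRealVec (v : Eu n) : reVec n (ofRealVec n v) = v := by
  ext k
  simp [reVec_apply, ofRealVec_apply]

theorem imVec_ofRealVec (v : Eu n) : imVec n (ofRealVec n v) = 0 := by
  ext k
  simp [imVec_apply, ofRealVec_apply]

theorem complexify_eq (A : Eu n →L[ℝ] Eu n) (v : EuC n) :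
    complexify A v = ofRealVec n (A (reVec n v)) + Complex.I • ofRealVec n (A (imVec n v)) := by
  ext k
  simp only [complexify, PiLp.add_apply, PiLp.smul_apply, ofRealVec_apply, smul_eq_mul]
  rfl

theorem smul_complexify (A : Eu n →L[ℝ] Eu n) (y : ℂ) (v : EuC n) :
    complexify A (y • v) = y • complexify A v := by
  have h1 : reVec n (y • v) = y.re • reVec n v - y.im • imVec n v := by
    ext k
    simp [reVec_apply, imVec_apply]
  have h2 : imVec n (y • v) = y.re • imVec n v + y.im • reVec n v := by
    ext k
    simp [reVec_apply, imVec_apply]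
  simp only [complexify_eq, h1, h2, map_add, map_sub, map_smul]
  ext k
  simp only [PiLp.add_apply, PiLp.sub_apply, PiLp.smul_apply, ofRealVec_apply, smul_eq_mul,
    Complex.real_smul]
  conv_rhs => rw [← Complex.re_add_im y]
  linear_combination (-(y.im : ℂ) * ((A (imVec n v) k : ℝ) : ℂ)) * Complex.I_sq

end Complexification

section ComplexOperators

variable {Ω : Type*} [MeasurableSpace Ω] {P : Measure Ω} {n m r : ℕ} {Φ : Ω ≃ᵐ Ω}
  {α : Eu m}

variable (P n m r) in
/-- The action of the complex numbers on complex random sections. -/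
noncomputable def scalarOp : ℂ →+* (LInfC P (EuC n) m r →L[ℝ] LInfC P (EuC n) m r) where
  toFun y := postOp P m r (smulVec n y)
  map_one' := by
    ext1 k
    obtain ⟨f, hf, rfl⟩ := k.exists_toLInf
    rw [postOp_toLInf hf]
    simp only [smulVec_apply, one_smul]
    rfl
  map_mul' y z := by
    ext1 k
    obtain ⟨f, hf, rfl⟩ := k.exists_toLInf
    change _ = postOp P m r _ (postOp P m r _ _)
    rw [postOp_toLInf hf, postOp_toLInf hf, postOp_toLInf (hf.postcomp _)]
    simp only [smulVec_apply, mul_smul]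
  map_zero' := by
    ext1 k
    obtain ⟨f, hf, rfl⟩ := k.exists_toLInf
    rw [postOp_toLInf hf]
    simp only [smulVec_apply, zero_smul]
    exact toLInf_coe 0
  map_add' y z := by
    ext1 k
    obtain ⟨f, hf, rfl⟩ := k.exists_toLInf
    rw [add_apply, postOp_toLInf hf, postOp_toLInf hf, postOp_toLInf hf,
      ← ((hf.postcomp _).add (hf.postcomp _)).2]
    simp only [smulVec_apply, add_smul]

theorem norm_scalarOp_le (y : ℂ) : ‖scalarOp P n m r y‖ ≤ ‖y‖ :=
  (norm_postOp_le _).trans (norm_smulVec_le y)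

/-- The complexification of an operator on real random sections. -/
noncomputable def complexOp (a : LInfC P (Eu n) m r →L[ℝ] LInfC P (Eu n) m r) :
    LInfC P (EuC n) m r →L[ℝ] LInfC P (EuC n) m r :=
  (postOp P m r (ofRealVec n)).comp (a.comp (postOp P m r (reVec n)))
    + (scalarOp P n m r Complex.I).comp
      ((postOp P m r (ofRealVec n)).comp (a.comp (postOp P m r (imVec n))))

theorem complexOp_apply (a : LInfC P (Eu n) m r →L[ℝ] LInfC P (Eu n) m r)
    (k : LInfC P (EuC n) m r) : complexOp a k = postOp P m r (ofRealVec n)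
      (a (postOp P m r (reVec n) k)) + scalarOp P n m r Complex.I (postOp P m r (ofRealVec n)
      (a (postOp P m r (imVec n) k))) := rfl

/-- The factor `2` comes from estimating real and imaginary parts separately. -/
theorem norm_complexOp_sub_le (a b : LInfC P (Eu n) m r →L[ℝ] LInfC P (Eu n) m r) :
    ‖complexOp a - complexOp b‖ ≤ 2 * ‖a - b‖ := by
  have hι : ‖postOp P m r (ofRealVec n)‖ ≤ 1 := (norm_postOp_le _).trans norm_ofRealVec_le
  have hre : ‖postOp P m r (reVec n)‖ ≤ 1 := (norm_postOp_le _).trans norm_reVec_le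
  have him : ‖postOp P m r (imVec n)‖ ≤ 1 := (norm_postOp_le _).trans norm_imVec_le
  have hI : ‖scalarOp P n m r Complex.I‖ ≤ 1 := (norm_scalarOp_le _).trans (by simp)
  refine ContinuousLinearMap.opNorm_le_bound _ (by positivity) fun k => ?_
  have e : (complexOp a - complexOp b) k = postOp P m r (ofRealVec n)
      ((a - b) (postOp P m r (reVec n) k)) + scalarOp P n m r Complex.I
      (postOp P m r (ofRealVec n) ((a - b) (postOp P m r (imVec n) k))) := by
    simp only [sub_apply, complexOp_apply, map_sub]
    abel
  have h1 : ‖(a - b) (postOp P m r (reVec n) k)‖ ≤ ‖a - b‖ * ‖k‖ :=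
    (a - b).le_opNorm_of_le
      ((ContinuousLinearMap.le_of_opNorm_le _ hre k).trans_eq (one_mul _))
  have h2 : ‖(a - b) (postOp P m r (imVec n) k)‖ ≤ ‖a - b‖ * ‖k‖ :=
    (a - b).le_opNorm_of_le
      ((ContinuousLinearMap.le_of_opNorm_le _ him k).trans_eq (one_mul _))
  have h3 := ContinuousLinearMap.le_of_opNorm_le_of_le _ hι h1
  have h4 := ContinuousLinearMap.le_of_opNorm_le_of_le _ hI
    (ContinuousLinearMap.le_of_opNorm_le_of_le _ hι h2)
  rw [e]
  refine (norm_add_le _ _).trans ?_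
  linarith

theorem re_complexOp (a : LInfC P (Eu n) m r →L[ℝ] LInfC P (Eu n) m r)
    (k : LInfC P (EuC n) m r) :
    postOp P m r (reVec n) (complexOp a k) = a (postOp P m r (reVec n) k) := by
  obtain ⟨f, hf, h1⟩ := (a (postOp P m r (reVec n) k)).exists_toLInf
  obtain ⟨g, hg, h2⟩ := (a (postOp P m r (imVec n) k)).exists_toLInf
  rw [complexOp_apply, ← h1, ← h2, map_add, scalarOp]
  change postOp P m r (reVec n) _ + postOp P m r (reVec n) (postOp P m r (smulVec n Complex.I) _) = _
  rw [postOp_toLInf hf, postOp_toLInf hg, postOp_toLInf (hg.postcomp _),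
    postOp_toLInf (hf.postcomp _), postOp_toLInf ((hg.postcomp _).postcomp _),
    ← ((hf.postcomp _).postcomp _).add (((hg.postcomp _).postcomp _).postcomp _) |>.2]
  congr 1
  funext θ ω
  ext k
  simp [smulVec_apply, reVec_apply, ofRealVec_apply]

theorem re_ofReal (k : LInfC P (Eu n) m r) :
    postOp P m r (reVec n) (postOp P m r (ofRealVec n) k) = k := by
  obtain ⟨f, hf, rfl⟩ := k.exists_toLInf
  rw [postOp_toLInf hf, postOp_toLInf (hf.postcomp _)]
  simp only [reVec_ofRealVec]

theorem complexOp_ofReal (a : LInfC P (Eu n) m r →L[ℝ] LInfC P (Eu n) m r)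
    (k : LInfC P (Eu n) m r) : complexOp a (postOp P m r (ofRealVec n) k)
      = postOp P m r (ofRealVec n) (a k) := by
  have h : postOp P m r (imVec n) (postOp P m r (ofRealVec n) k) = 0 := by
    obtain ⟨f, hf, rfl⟩ := k.exists_toLInf
    rw [postOp_toLInf hf, postOp_toLInf (hf.postcomp _)]
    simp only [imVec_ofRealVec]
    exact toLInf_coe 0
  rw [complexOp_apply, re_ofReal, h, map_zero, map_zero, map_zero, add_zero]

/-- The real part of an operator on complex random sections. -/
noncomputable def reOp (A : LInfC P (EuC n) m r →L[ℝ] LInfC P (EuC n) m r) :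
    LInfC P (Eu n) m r →L[ℝ] LInfC P (Eu n) m r :=
  (postOp P m r (reVec n)).comp (A.comp (postOp P m r (ofRealVec n)))

theorem norm_reOp_le (A : LInfC P (EuC n) m r →L[ℝ] LInfC P (EuC n) m r) : ‖reOp A‖ ≤ ‖A‖ := by
  have hι : ‖postOp P m r (ofRealVec n)‖ ≤ 1 := (norm_postOp_le _).trans norm_ofRealVec_le
  have hre : ‖postOp P m r (reVec n)‖ ≤ 1 := (norm_postOp_le _).trans norm_reVec_le
  refine ContinuousLinearMap.opNorm_le_bound _ (norm_nonneg _) fun k => ?_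
  refine (ContinuousLinearMap.le_of_opNorm_le_of_le _ hre
    (A.le_opNorm_of_le (ContinuousLinearMap.le_of_opNorm_le _ hι k))).trans_eq ?_
  ring

theorem reOp_one : reOp (1 : LInfC P (EuC n) m r →L[ℝ] LInfC P (EuC n) m r) = 1 := by
  ext1 k
  exact re_ofReal k

/-- Taking real parts is multiplicative as soon as one factor is the complexification of a real
operator. This carries the Green relations back to real sections. -/
theorem reOp_complexOp_mul (a : LInfC P (Eu n) m r →L[ℝ] LInfC P (Eu n) m r)
    (A : LInfC P (EuC n) m r →L[ℝ] LInfC P (EuC n) m r) :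
    reOp (complexOp a * A) = a * reOp A := by
  ext1 k
  exact re_complexOp a _

theorem reOp_mul_complexOp (a : LInfC P (Eu n) m r →L[ℝ] LInfC P (Eu n) m r)
    (A : LInfC P (EuC n) m r →L[ℝ] LInfC P (EuC n) m r) :
    reOp (A * complexOp a) = reOp A * a := by
  ext1 k
  exact congrArg (fun z => postOp P m r (reVec n) (A z)) (complexOp_ofReal a k)

theorem reOp_sub (A B : LInfC P (EuC n) m r →L[ℝ] LInfC P (EuC n) m r) :
    reOp (A - B) = reOp A - reOp B := by
  ext1 k
  exact map_sub (postOp P m r (reVec n)) _ _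

theorem reOp_zero : reOp (0 : LInfC P (EuC n) m r →L[ℝ] LInfC P (EuC n) m r) = 0 := by
  ext1 k
  exact map_zero (postOp P m r (reVec n))

theorem IsGreenFamily.reOp {a : LInfC P (Eu n) m r →L[ℝ] LInfC P (Eu n) m r}
    {G : ℤ → LInfC P (EuC n) m r →L[ℝ] LInfC P (EuC n) m r} {c : ℝ}
    (hG : IsGreenFamily (complexOp a) G c) : IsGreenFamily a (fun k => reOp (G k)) c where
  left k := by
    rw [← reOp_complexOp_mul, hG.left, reOp_sub]
    congr 1
    by_cases hk : k = -1
    · simp only [if_pos hk, reOp_one]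
    · simp only [if_neg hk, reOp_zero]
  right k := by
    rw [← reOp_mul_complexOp, hG.right, reOp_sub]
    congr 1
    by_cases hk : k = -1
    · simp only [if_pos hk, reOp_one]
    · simp only [if_neg hk, reOp_zero]
  bound k := (norm_reOp_le _).trans (hG.bound k)
  decay k := le_trans (mul_le_mul_of_nonneg_right (norm_reOp_le _) (abs_nonneg _)) (hG.decay k)

variable {M : Torus m → Ω → (Eu n →L[ℝ] Eu n)} {a : LInfC P (Eu n) m r →L[ℝ] LInfC P (Eu n) m r}

theorem IsTransferOp.complexOp_toLInf (ha : IsTransferOp P r Φ α M a) {f : Torus m → Ω → EuC n}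
    (hf : AESection P r f) : AESection P r (transferOp Φ α M f) ∧
      complexOp a (toLInf P r f) = toLInf P r (transferOp Φ α M f) := by
  have h1 := ha _ (hf.postcomp (reVec n))
  have h2 := ha _ (hf.postcomp (imVec n))
  have h3 := (h2.1.postcomp (ofRealVec n)).postcomp (smulVec n Complex.I)
  have h4 := (h1.1.postcomp (ofRealVec n)).add h3
  have e : transferOp Φ α M f = fun θ ω =>
      ofRealVec n (transport Φ α M (fun θ ω => reVec n (f θ ω)) θ ω)
      + smulVec n Complex.I (ofRealVec n (transport Φ α M (fun θ ω => imVec n (f θ ω)) θ ω)) := by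
    funext θ ω
    rw [transferOp, complexify_eq, transport, transport, orbitShift_one_apply,
      orbitShift_one_apply, smulVec_apply]
  rw [e]
  refine ⟨h4.1, ?_⟩
  rw [h4.2, complexOp_apply, postOp_toLInf hf, postOp_toLInf hf, h1.2, h2.2, postOp_toLInf h1.1,
    postOp_toLInf h2.1]
  congr 1
  exact postOp_toLInf (h2.1.postcomp _) _

theorem IsTransferOp.commute_scalarOp (ha : IsTransferOp P r Φ α M a) (y : ℂ) :
    Commute (scalarOp P n m r y) (complexOp a) := by
  ext1 k
  obtain ⟨f, hf, rfl⟩ := k.exists_toLInf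
  change postOp P m r (smulVec n y) (complexOp a _) = complexOp a (postOp P m r (smulVec n y) _)
  rw [(ha.complexOp_toLInf hf).2, postOp_toLInf hf, postOp_toLInf (ha.complexOp_toLInf hf).1,
    (ha.complexOp_toLInf (hf.postcomp _)).2]
  congr 1
  funext θ ω
  rw [smulVec_apply, transferOp, transferOp, smulVec_apply, smul_complexify]

theorem IsTransferOp.exists_inverse (ha : IsTransferOp P r Φ α M a) {y : ℂ} {c : ℝ}
    (h : ResolventBound P Φ α r M y c) :
    ∃ R : LInfC P (EuC n) m r →L[ℝ] LInfC P (EuC n) m r, ‖R‖ ≤ c ∧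
      R * (scalarOp P n m r y - complexOp a) = 1 ∧ (scalarOp P n m r y - complexOp a) * R = 1 := by
  obtain ⟨R, hR, h⟩ := h
  have key : ∀ κ η : RSection P (EuC n) m r,
      complexOp a (SeparationQuotient.mk κ) - scalarOp P n m r y (SeparationQuotient.mk κ)
        = SeparationQuotient.mk η ↔ SeparationQuotient.mk κ = R (SeparationQuotient.mk η) := by
    intro κ η
    rw [← h κ η]
    have h1 := ha.complexOp_toLInf (aeSection_coe κ)
    have h2 : AESection P r fun θ ω => y • κ θ ω := (aeSection_coe κ).postcomp (smulVec n y)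
    have h3 : scalarOp P n m r y (SeparationQuotient.mk κ)
        = toLInf P r fun θ ω => y • κ θ ω := by
      rw [← toLInf_coe κ]
      exact postOp_toLInf (aeSection_coe κ) _
    rw [h3, ← toLInf_coe κ, h1.2, ← toLInf_coe η, ← (h1.1.sub h2).2]
    exact ⟨fun h => ae_eq_of_toLInf_eq (h1.1.sub h2).1 (aeSection_coe η) h,
      fun h => toLInf_congr (h1.1.sub h2).1 h⟩
  -- The sign appears because `ResolventBound` inverts `𝓜 - y`, whereas the contour integral uses `y
  -- - 𝓜`.
  refine ⟨-R, by rwa [norm_neg], ?_, ?_⟩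
  · ext1 k
    obtain ⟨κ, rfl⟩ := SeparationQuotient.surjective_mk k
    obtain ⟨η, hη⟩ := SeparationQuotient.surjective_mk
      (complexOp a (SeparationQuotient.mk κ) - scalarOp P n m r y (SeparationQuotient.mk κ))
    have h1 := (key κ η).1 hη.symm
    change -R (scalarOp P n m r y (SeparationQuotient.mk κ) - complexOp a (SeparationQuotient.mk κ))
      = SeparationQuotient.mk κ
    rw [← map_neg, neg_sub, ← hη, ← h1]
  · ext1 k
    obtain ⟨η, rfl⟩ := SeparationQuotient.surjective_mk k
    obtain ⟨κ, hκ⟩ := SeparationQuotient.surjective_mk (R (SeparationQuotient.mk η))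
    have h1 := (key κ η).2 hκ
    change scalarOp P n m r y (-R (SeparationQuotient.mk η))
      - complexOp a (-R (SeparationQuotient.mk η)) = SeparationQuotient.mk η
    rw [map_neg, map_neg, ← hκ, ← h1]
    abel

/-- The resolvent at `y = 1`, returned to real sections without increase of the norm: the linear
input of the fixed point theorem. -/
theorem IsTransferOp.exists_inverse_sub_one (ha : IsTransferOp P r Φ α M a) {c : ℝ}
    (h : ResolventBound P Φ α r M 1 c) :
    ∃ L : LInfC P (Eu n) m r →L[ℝ] LInfC P (Eu n) m r, L * (a - 1) = 1 ∧ (a - 1) * L = 1 ∧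
      ‖L‖ ≤ c := by
  obtain ⟨R, hR, h1, h2⟩ := ha.exists_inverse h
  rw [map_one] at h1 h2
  have h3 := congrArg reOp h1
  have h4 := congrArg reOp h2
  rw [mul_sub, mul_one, reOp_sub, reOp_mul_complexOp, reOp_one] at h3
  rw [sub_mul, one_mul, reOp_sub, reOp_complexOp_mul, reOp_one] at h4
  refine ⟨-reOp R, ?_, ?_, by rw [norm_neg]; exact (norm_reOp_le R).trans hR⟩
  · exact neg_mul_sub_one_of h3
  · exact sub_one_mul_neg_of h4

/-- Green families of transfer operators close to a hyperbolic one. -/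
theorem IsTransferOp.exists_greenFamily (ha : IsTransferOp P r Φ α M a) {c : ℝ} (hc : 0 < c)
    (h : ∀ y : ℂ, ‖y‖ = 1 → ResolventBound P Φ α r M y c)
    {M' : Torus m → Ω → (Eu n →L[ℝ] Eu n)} {b : LInfC P (Eu n) m r →L[ℝ] LInfC P (Eu n) m r}
    (hb : IsTransferOp P r Φ α M' b) (hab : ‖b - a‖ ≤ (4 * c)⁻¹) :
    ∃ G : ℤ → LInfC P (Eu n) m r →L[ℝ] LInfC P (Eu n) m r, IsGreenFamily b G (2 * c) := by
  have hR : ∀ y : ℂ, ∃ R : LInfC P (EuC n) m r →L[ℝ] LInfC P (EuC n) m r, ‖y‖ = 1 →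
      R * (scalarOp P n m r y - complexOp b) = 1 ∧ (scalarOp P n m r y - complexOp b) * R = 1 ∧
        ‖R‖ ≤ 2 * c := by
    intro y
    by_cases hy : ‖y‖ = 1
    · obtain ⟨R, hR, h1, h2⟩ := ha.exists_inverse (h y hy)
      -- Complexification doubles the distance of the operators, and `2 * (4 * c)⁻¹ * c = 1 / 2` is
      -- the admissible perturbation.
      obtain ⟨R', h3⟩ := exists_inverse_of_norm_sub_le
        (b := scalarOp P n m r y - complexOp b) h1 h2 hR (by
          rw [sub_sub_sub_cancel_left]
          have h4 : ‖complexOp a - complexOp b‖ ≤ 2 * (4 * c)⁻¹ := by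
            refine (norm_complexOp_sub_le a b).trans ?_
            rw [norm_sub_rev]
            gcongr
          calc _ ≤ 2 * (4 * c)⁻¹ * c := by gcongr
            _ = 1 / 2 := by field_simp; norm_num)
      exact ⟨R', fun _ => h3⟩
    · exact ⟨0, fun h => absurd h hy⟩
  choose R hR using hR
  obtain ⟨G, hG⟩ := _root_.exists_greenFamily (J := scalarOp P n m r) norm_scalarOp_le
    (a := complexOp b) (fun y => hb.commute_scalarOp y) (R := R) (c := 2 * c)
    (fun y hy => ⟨(hR y hy).1, (hR y hy).2.1⟩) fun y hy => (hR y hy).2.2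
  exact ⟨_, hG.reOp⟩

end ComplexOperators

end RandomTorus

/-! ### Uniqueness of bounded almost invariant sections; normal hyperbolicity -/

namespace RandomTorus

section Hyperbolicity

variable {Ω : Type*} [MeasurableSpace Ω] {P : Measure Ω} {n m r : ℕ} {Φ : Ω ≃ᵐ Ω}
  {α : Eu m} {M : Torus m → Ω → (Eu n →L[ℝ] Eu n)}
  {a : LInfC P (Eu n) m r →L[ℝ] LInfC P (Eu n) m r}
  {G : ℤ → LInfC P (Eu n) m r →L[ℝ] LInfC P (Eu n) m r} {c : ℝ}

theorem ae_zpowMap (hΦ : MeasurePreserving Φ P P) {p : Ω → Prop} (h : ∀ᵐ ω ∂P, p ω) :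
    ∀ᵐ ω ∂P, ∀ j : ℤ, p (zpowMap Φ j ω) :=
  ae_all_iff.2 fun j => (measurePreserving_zpowMap hΦ j).quasiMeasurePreserving.ae h

/-- A bounded section which is almost invariant under a hyperbolic cocycle vanishes. -/
theorem IsTransferOp.ae_eq_zero_of_almost_invariant (hΦ : MeasurePreserving Φ P P)
    (ha : IsTransferOp P r Φ α M a) (hG : IsGreenFamily a G c) {N : ℕ} (hN0 : 0 < N)
    (hN : 4 * (n * (2 * c ^ 2)) ≤ N) {q : ℝ} (hq : 2 * (N + 1) * (n * c * q) ≤ 1 / 4)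
    (hq0 : 0 ≤ q) {κ : Torus m → Ω → Eu n} {Q : ℝ} (hQ : ∀ᵐ ω ∂P, ∀ θ, ‖κ θ ω‖ ≤ Q)
    (hκ : ∀ᵐ ω ∂P, ∀ θ, ‖κ (θ + toTorus α) (Φ ω) - M θ ω (κ θ ω)‖ ≤ q * ‖κ θ ω‖) :
    ∀ᵐ ω ∂P, ∀ θ, κ θ ω = 0 := by
  have hb : ∀ᵐ ω ∂P, ∀ k : ℤ, ∀ θ, ‖opMatrix (G k) θ ω‖ ≤ n * ‖G k‖ :=
    ae_all_iff.2 fun k => ae_norm_opMatrix_le (G k)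
  -- The boundary terms contribute `Q / 2`. The defects, each at most `q * Q`, contribute `Q / 4` by
  -- the choice of `q`.
  have step : ∀ Q : ℝ, (∀ᵐ ω ∂P, ∀ θ, ‖κ θ ω‖ ≤ Q) → ∀ᵐ ω ∂P, ∀ θ, ‖κ θ ω‖ ≤ 3 / 4 * Q := by
    intro Q hQ
    filter_upwards [ha.ae_isGreenAlongOrbit hΦ hG, hb, ae_zpowMap hΦ hQ, ae_zpowMap hΦ hκ]
      with ω h1 h2 h3 h4 θ
    have hQ0 : 0 ≤ Q := (norm_nonneg _).trans (h3 0 θ)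
    have h5 := (h1 θ).norm_le (p := fun j => κ (θ + j • toTorus α) (zpowMap Φ j ω))
      (h := fun j => κ (θ + (j + 1) • toTorus α) (zpowMap Φ (j + 1) ω)
        - M (θ + j • toTorus α) (zpowMap Φ j ω) (κ (θ + j • toTorus α) (zpowMap Φ j ω)))
      (b := n * c) (b' := n * (2 * c ^ 2)) (H := q * Q) (Q := Q) (fun j => by abel)
      (fun k => ?_) (fun k => ?_) (fun j => h3 j _) (fun j => ?_) hN0 hN
    · simp only [zero_zsmul, add_zero, zpowMap_zero] at h5
      have : 2 * ((N : ℝ) + 1) * (n * c * (q * Q)) ≤ 1 / 4 * Q := by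
        calc _ = 2 * ((N : ℝ) + 1) * (n * c * q) * Q := by ring
          _ ≤ _ := by gcongr
      linarith
    · simp only [zero_zsmul, add_zero, zpowMap_zero]
      refine (h2 k θ).trans ?_
      gcongr
      exact hG.bound k
    · simp only [zero_zsmul, add_zero, zpowMap_zero]
      calc _ ≤ n * ‖G k‖ * |(k : ℝ) + 1| := by gcongr; exact h2 k θ
        _ ≤ _ := by
          rw [mul_assoc]
          exact mul_le_mul_of_nonneg_left (hG.decay k) (Nat.cast_nonneg n)
    · have h6 := h4 j (θ + j • toTorus α)
      have e : θ + (j + 1) • toTorus α = θ + j • toTorus α + toTorus α := by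
        rw [add_zsmul, one_zsmul, add_assoc]
      rw [e, add_comm j 1, zpowMap_add, zpowMap_one]
      refine h6.trans ?_
      gcongr
      exact h3 j _
  have hall : ∀ᵐ ω ∂P, ∀ i : ℕ, ∀ θ, ‖κ θ ω‖ ≤ (3 / 4) ^ i * Q := by
    refine ae_all_iff.2 fun i => ?_
    induction i with
    | zero => simpa using hQ
    | succ i ih =>
      refine (step _ ih).mono fun ω h θ => (h θ).trans_eq ?_
      rw [pow_succ']
      ring
  filter_upwards [hall] with ω h θ
  have hlim : Tendsto (fun i : ℕ => (3 / 4 : ℝ) ^ i * Q) atTop (𝓝 0) := by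
    simpa using (tendsto_pow_atTop_nhds_zero_of_lt_one (r := (3 / 4 : ℝ)) (by norm_num)
      (by norm_num)).mul_const Q
  exact norm_le_zero_iff.1 (ge_of_tendsto' hlim fun i => h i θ)

theorem cocycleFwd_eq_fwd (M : Torus m → Ω → (Eu n →L[ℝ] Eu n)) (θ : Torus m) (ω : Ω) (N : ℕ) :
    cocycleFwd Φ α M θ ω N
      = IsGreenAlongOrbit.fwd (fun j => M (θ + j • toTorus α) (zpowMap Φ j ω)) N := by
  induction N with
  | zero => rfl
  | succ N ih =>
    rw [cocycleFwd, IsGreenAlongOrbit.fwd, ih, zpowMap_natCast, natCast_zsmul]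
    rfl

theorem cocycleBwd_eq_bwd (M : Torus m → Ω → (Eu n →L[ℝ] Eu n)) (θ : Torus m) (ω : Ω) (N : ℕ) :
    cocycleBwd Φ α M θ ω N
      = IsGreenAlongOrbit.bwd (fun j => M (θ + j • toTorus α) (zpowMap Φ j ω)) N := by
  induction N with
  | zero => rfl
  | succ N ih =>
    have e : -((N : ℤ) + 1) = -((N + 1 : ℕ) : ℤ) := by push_cast; rfl
    rw [cocycleBwd, IsGreenAlongOrbit.bwd, ih, e, zpowMap_neg_natCast, neg_zsmul, natCast_zsmul,
      ← sub_eq_add_neg]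
    rfl

theorem map_ker_eq_of_intertwine {E : Type*} [NormedAddCommGroup E] [NormedSpace ℝ E]
    {A B C : E →L[ℝ] E} (hA : A.IsInvertible) (h : A * B = C * A) :
    (LinearMap.ker (B : E →ₗ[ℝ] E)).map (A : E →ₗ[ℝ] E) = LinearMap.ker (C : E →ₗ[ℝ] E) := by
  obtain ⟨A, rfl⟩ := hA
  have h' : ∀ v, A (B v) = C (A v) := fun v => DFunLike.congr_fun h v
  ext w
  simp only [Submodule.mem_map, LinearMap.mem_ker, ContinuousLinearMap.coe_coe,
    ContinuousLinearEquiv.coe_coe]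
  constructor
  · rintro ⟨v, hv, rfl⟩
    rw [← h', hv, map_zero]
  · intro hw
    refine ⟨A.symm w, ?_, A.apply_symm_apply w⟩
    apply A.injective
    rw [h', A.apply_symm_apply, hw, map_zero]

/-- A cocycle of invertible matrices whose transfer operator has a Green family is normally
hyperbolic. -/
theorem IsTransferOp.isNormallyHyperbolic (hΦ : MeasurePreserving Φ P P)
    (ha : IsTransferOp P r Φ α M a) (hG : IsGreenFamily a G c)
    (hM : ∀ᵐ ω ∂P, ∀ θ, (M θ ω).IsInvertible) : IsNormallyHyperbolic P Φ α r M := by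
  obtain ⟨D₀, lam, hD₀, hl, hl1, hdec⟩ := hG.exists_exponential_decay
  -- The factor `n` passes from operator norms to matrix norms; the `1` is for time zero in the
  -- unstable estimate.
  set D : ℝ := max (n * D₀) 1 with hD
  have hD1 : 1 ≤ D := le_max_right _ _
  have hb : ∀ᵐ ω ∂P, ∀ k : ℤ, ∀ θ, ‖opMatrix (G k) θ ω‖ ≤ n * ‖G k‖ :=
    ae_all_iff.2 fun k => ae_norm_opMatrix_le (G k)
  have hle : ∀ (N : ℕ) (k : ℤ), ‖G k‖ ≤ D₀ * lam ^ N → n * ‖G k‖ ≤ D * lam ^ N := by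
    intro N k hk
    calc n * ‖G k‖ ≤ n * (D₀ * lam ^ N) := by gcongr
      _ = (n * D₀) * lam ^ N := by ring
      _ ≤ _ := by gcongr; exact le_max_left _ _
  -- Both bundles are written as kernels, the stable one as that of `G 0 - 1`, so that invariance of
  -- both follows from `map_ker_eq_of_intertwine`. The rates do not depend on `ω`.
  refine ⟨fun θ ω => LinearMap.ker ((opMatrix (G 0) θ ω - 1 : Eu n →L[ℝ] Eu n) : Eu n →ₗ[ℝ] Eu n),
    fun θ ω => LinearMap.ker (opMatrix (G 0) θ ω : Eu n →ₗ[ℝ] Eu n),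
    fun θ ω => opMatrix (G 0) θ ω, fun θ ω => 1 - opMatrix (G 0) θ ω,
    fun _ => D, fun _ => lam, fun _ => lam⁻¹, measurable_opMatrix _,
    measurable_const.sub (measurable_opMatrix _), measurable_const, measurable_const,
    measurable_const, ?_⟩
  filter_upwards [ha.ae_isGreenAlongOrbit hΦ hG, ae_zpowMap hΦ hb, ae_zpowMap hΦ hM,
    ae_contDiff_opMatrix (G 0)] with ω h1 h2 h3 h4
  refine ⟨h4, contDiff_const.sub h4, zero_lt_one.trans_le hD1, hl, hl1, (one_lt_inv₀ hl).2 hl1,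
    fun θ => ?_⟩
  have hγ := h1 θ
  have hM' : ∀ j : ℤ, (M (θ + j • toTorus α) (zpowMap Φ j ω)).IsInvertible := fun j => h3 j _
  have hp : ∀ (N : ℕ) (j : ℤ), ‖opMatrix (G N) (θ + j • toTorus α) (zpowMap Φ j ω)‖
      ≤ D * lam ^ N := fun N j => (h2 j N _).trans (hle N N (hdec N).1)
  have hn : ∀ (N : ℕ) (j : ℤ), ‖opMatrix (G (-N)) (θ + j • toTorus α) (zpowMap Φ j ω)‖
      ≤ D * lam ^ N := fun N j => (h2 j (-N) _).trans (hle N (-N) (hdec N).2)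
  have hidem := hγ.apply_apply hl hl1 hp hn
  have hS := hγ.mem_stable_iff hl hl1 hp hn
  have hU := hγ.mem_unstable_iff hM' hl hl1 hD1 hp hn
  have hL := hγ.left 0 0
  have hR := hγ.right 0 1
  simp only [zero_zsmul, add_zero, zpowMap_zero, zero_add, one_zsmul, zpowMap_one, sub_zero,
    sub_self] at hidem hS hU hL hR
  rw [if_neg (by norm_num), sub_zero] at hL hR
  have hcomm : M θ ω * opMatrix (G 0) θ ω
      = opMatrix (G 0) (θ + toTorus α) (Φ ω) * M θ ω := hL.trans hR.symm
  have hker : ∀ v, v ∈ LinearMap.ker ((opMatrix (G 0) θ ω - 1 : Eu n →L[ℝ] Eu n) :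
      Eu n →ₗ[ℝ] Eu n) ↔ opMatrix (G 0) θ ω v = v := fun v => sub_eq_zero
  have hMi : (M θ ω).IsInvertible := by simpa [zpowMap_zero] using hM' 0
  refine ⟨hMi, ?_, fun v => ⟨(hker _).2 (hidem v), ?_, add_sub_cancel _ _⟩, fun v => ?_, fun v => ?_,
    map_ker_eq_of_intertwine hMi ?_, map_ker_eq_of_intertwine hMi hcomm⟩
  · refine ⟨Submodule.disjoint_def.2 fun v hv hv' => ?_, codisjoint_iff.2 ?_⟩
    · rw [← (hker v).1 hv]
      exact hv'
    · refine eq_top_iff.2 fun v _ => Submodule.mem_sup.2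
        ⟨opMatrix (G 0) θ ω v, (hker _).2 (hidem v), v - opMatrix (G 0) θ ω v, ?_, by abel⟩
      rw [LinearMap.mem_ker]
      exact (map_sub (opMatrix (G 0) θ ω) _ _).trans (by rw [hidem, sub_self])
  · exact (map_sub (opMatrix (G 0) θ ω) _ _).trans (sub_eq_zero.2 (hidem v).symm)
  · simp only [hker, cocycleFwd_eq_fwd]
    exact hS v
  · simp only [cocycleBwd_eq_bwd]
    exact hU v
  · rw [mul_sub, sub_mul, hcomm, mul_one, one_mul]

end Hyperbolicity

end RandomTorus

/-! ### Random sets -/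

namespace RandomTorus

section RandomSets

variable {Ω : Type*} [MeasurableSpace Ω]

/-- Compactness makes the range closed. By continuity in `θ` the distance is an infimum over a
countable dense set of parameters. -/
theorem isRandomSet_range {X Y : Type*} [TopologicalSpace X] [CompactSpace X] [Nonempty X]
    [TopologicalSpace.SeparableSpace X] [MetricSpace Y] [MeasurableSpace Y] [OpensMeasurableSpace Y]
    {g : X → Ω → Y} (hc : ∀ ω, Continuous fun θ => g θ ω) (hm : ∀ θ, Measurable (g θ)) :
    IsRandomSet fun ω => Set.range fun θ => g θ ω := by
  refine ⟨fun ω => ⟨Set.range_nonempty _, (isCompact_range (hc ω)).isClosed⟩, fun y => ?_⟩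
  refine measurable_of_Iio fun b => ?_
  have e : (fun ω => Metric.infDist y (Set.range fun θ => g θ ω)) ⁻¹' Iio b
      = ⋃ k : ℕ, {ω | dist (g (TopologicalSpace.denseSeq X k) ω) y < b} := by
    ext ω
    rw [mem_preimage, mem_Iio, Metric.infDist_lt_iff (Set.range_nonempty _), mem_iUnion]
    constructor
    · rintro ⟨_, ⟨θ, rfl⟩, h⟩
      have hopen : IsOpen {θ | dist (g θ ω) y < b} :=
        isOpen_lt ((hc ω).dist continuous_const) continuous_const
      obtain ⟨_, hθ, ⟨k, rfl⟩⟩ := (TopologicalSpace.denseRange_denseSeq X).inter_open_nonempty _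
        hopen ⟨θ, by rw [dist_comm] at h; exact h⟩
      exact ⟨k, hθ⟩
    · rintro ⟨k, hk⟩
      exact ⟨_, ⟨_, rfl⟩, by rw [dist_comm]; exact hk⟩
  rw [e]
  exact MeasurableSet.iUnion fun k => (hm _ ) (measurableSet_lt_dist y b)
where
  measurableSet_lt_dist {Y : Type _} [MetricSpace Y] [MeasurableSpace Y] [OpensMeasurableSpace Y]
      (y : Y) (b : ℝ) : MeasurableSet {z | dist z y < b} :=
    (isOpen_lt (continuous_id.dist continuous_const) continuous_const).measurableSet

variable {P : Measure Ω} {n m r : ℕ}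

/-- Every class of random sections has a representative which is continuous for all `ω`. -/
theorem LInfC.exists_continuous_rep (k : LInfC P (Eu n) m r) :
    ∃ K : RSection P (Eu n) m r, SeparationQuotient.mk K = k ∧
      ∀ ω, Continuous fun θ => K θ ω := by
  classical
  obtain ⟨N, hN, hNm, hgood⟩ := k.ae_crBound_rep.exists_measurable_mem
  have h1 : ∀ ω, CrBound r (fun x : Eu m => if ω ∈ N then LInfC.rep k (toTorus x) ω else 0) ‖k‖ := by
    intro ω
    by_cases h : ω ∈ N
    · simpa only [if_pos h] using hgood ω h
    · simpa only [if_neg h] using CrBound.zero.mono (norm_nonneg _)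
  refine ⟨RSection.ofAE (fun θ ω => if ω ∈ N then LInfC.rep k θ ω else 0) (C := ‖k‖)
    (Measurable.ite (measurable_snd hNm) (LInfC.rep k).2.meas measurable_const)
    (Eventually.of_forall h1), ?_, fun ω => ?_⟩
  · refine Eq.trans ?_ (LInfC.mk_rep k)
    rw [RSection.mk_eq_mk_iff]
    filter_upwards [hN] with ω h θ
    exact if_pos h
  · exact isOpenQuotientMap_toTorus.isQuotientMap.continuous_iff.2 (h1 ω).smooth.continuous

theorem isRandomSet_torusSet {K : RSection P (Eu n) m r} (hK : ∀ ω, Continuous fun θ => K θ ω) :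
    IsRandomSet (torusSet K) ∧ IsRandomSet fun ω => Set.range fun θ => K θ ω := by
  have hm : ∀ θ, Measurable (K θ) := fun θ => K.2.meas.comp (measurable_const.prodMk measurable_id)
  exact ⟨isRandomSet_range (fun ω => (hK ω).prodMk continuous_id)
    fun θ => (hm θ).prodMk measurable_const, isRandomSet_range hK hm⟩

end RandomSets

/-! ### Invariant tori as fixed points, and their local uniqueness -/

section InvariantTori

variable {Ω : Type*} [MeasurableSpace Ω] {P : Measure Ω} {n m r : ℕ}
  {U : Set (Eu n)} {Φ : Ω ≃ᵐ Ω} (hΦ : MeasurePreserving Φ P P) (α : Eu m)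

theorem shiftOp_toLInf {V : Type*} [NormedAddCommGroup V] [NormedSpace ℝ V] [MeasurableSpace V]
    [BorelSpace V] [SecondCountableTopology V] {f : Torus m → Ω → V} (hf : AESection P r f) :
    AESection P r (orbitShift Φ α 1 f) ∧
      shiftOp hΦ α V r (toLInf P r f) = toLInf P r (orbitShift Φ α 1 f) := by
  have e : orbitShift Φ α 1 f = fun θ ω => f (θ + toTorus (-α)) (Φ.symm ω) := by
    funext θ ω
    rw [orbitShift_one_apply, toTorus_neg, sub_eq_add_neg]
  rw [e]
  exact ⟨hf.pull _ (hΦ.symm Φ), pullOp_toLInf hf _ _⟩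

theorem ae_mem_rep_mk {K : RSection P (Eu n) m r} (hKU : ∀ᵐ ω ∂P, ∀ θ, K θ ω ∈ U) :
    ∀ᵐ ω ∂P, ∀ θ, LInfC.rep (SeparationQuotient.mk K) θ ω ∈ U := by
  filter_upwards [hKU, LInfC.ae_rep_mk K] with ω h1 h2 θ
  rw [h2]
  exact h1 θ

theorem transportMap_mk (hU : IsOpen U) (K : RSection P (Eu n) m r)
    (hKU : ∀ᵐ ω ∂P, ∀ θ, K θ ω ∈ U) (G : RMap P m (sigmaSet r 1) U) :
    transportMap hΦ α U (SeparationQuotient.mk K) (SeparationQuotient.mk G)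
      = shiftOp hΦ α (Eu n) r (toLInf P r (compSec K G)) := by
  have h := ae_mem_rep_mk hKU
  have e : toLInf P r (compSec (LInfC.rep (SeparationQuotient.mk K)) G)
      = toLInf P r (compSec K G) := by
    refine toLInf_congr (G.aeSection_comp hU _ h) ?_
    filter_upwards [LInfC.ae_rep_mk K] with ω h2 θ
    rw [compSec, compSec, h2]
  rw [← e, ← mapOp_compSec_mk hU _ h]
  rfl

/-- The derivative of `transportMap` is the transfer operator of the linearized dynamics. -/
theorem isTransferOp_transportDeriv (hU : IsOpen U) (K : RSection P (Eu n) m r)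
    (hKU : ∀ᵐ ω ∂P, ∀ θ, K θ ω ∈ U) (F : RMap P m (sigmaSet r 1) U) :
    IsTransferOp P r Φ α (transferMatrix F K)
      (transportDeriv hΦ α U (SeparationQuotient.mk K) (SeparationQuotient.mk F)) := by
  intro f hf
  have h := ae_mem_rep_mk hKU
  have hp : ∀ i, toLInf P r (partialSec i (LInfC.rep (SeparationQuotient.mk K)) F)
      = toLInf P r (partialSec i K F) := by
    intro i
    refine toLInf_congr (F.aeSection_partial hU i _ h) ?_
    filter_upwards [LInfC.ae_rep_mk K] with ω h2 θ
    rw [partialSec, partialSec, h2]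
  have hfi : ∀ i, AESection P r fun θ ω => f θ ω i := fun i =>
    hf.postcomp (EuclideanSpace.proj i : Eu n →L[ℝ] ℝ)
  have hco : ∀ i, coordOp P m r i (toLInf P r f) = toLInf P r fun θ ω => f θ ω i := fun i =>
    postOp_toLInf hf _
  have hterm : ∀ i, AESection P r fun θ ω => f θ ω i • partialSec i K F θ ω := fun i =>
    (hfi i).mul (F.aeSection_partial hU i K hKU)
  have hsum := AESection.sum Finset.univ fun i (_ : i ∈ Finset.univ) => hterm i
  have e : transport Φ α (transferMatrix F K) f
      = orbitShift Φ α 1 fun θ ω => ∑ i, f θ ω i • partialSec i K F θ ω := by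
    rw [transport]
    congr 1
    funext θ ω
    conv_lhs => rw [sum_smul_single (f θ ω), map_sum]
    simp only [map_smul]
    rfl
  have hs := shiftOp_toLInf hΦ α hsum.1
  rw [e]
  refine ⟨hs.1, ?_⟩
  rw [← hs.2, hsum.2, transportDeriv_apply, sum_apply, map_sum]
  refine Finset.sum_congr rfl fun i _ => ?_
  rw [partialMulOp_apply, hco, mapOp_partialSec_mk hU i _ h, hp,
    mulOp_toLInf (hfi i) (F.aeSection_partial hU i K hKU)]

theorem isInvariantTorus_of_fixedPoint (hU : IsOpen U) {K : RSection P (Eu n) m r}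
    (hKU : ∀ᵐ ω ∂P, ∀ θ, K θ ω ∈ U) {G : RMap P m (sigmaSet r 1) U}
    (h : transportMap hΦ α U (SeparationQuotient.mk K) (SeparationQuotient.mk G)
      = SeparationQuotient.mk K) : IsInvariantTorus P Φ α U G K := by
  refine ⟨hKU, ?_⟩
  have h1 := shiftOp_toLInf hΦ α (G.aeSection_comp hU K hKU)
  rw [transportMap_mk hΦ α hU K hKU G, h1.2, ← toLInf_coe K] at h
  have h2 := ae_eq_of_toLInf_eq h1.1 (aeSection_coe K) h
  filter_upwards [hΦ.quasiMeasurePreserving.ae h2] with ω h3 θ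
  have h4 := h3 (θ + toTorus α)
  rwa [orbitShift_one_apply, add_sub_cancel_right, Φ.symm_apply_apply] at h4

/-- The defect in the fixed point equation is the transported invariance error, and transport does
not increase norms. -/
theorem norm_transportMap_sub_le (hU : IsOpen U) {K : RSection P (Eu n) m r}
    (hKU : ∀ᵐ ω ∂P, ∀ θ, K θ ω ∈ U) {F : RMap P m (sigmaSet r 1) U} {ε : ℝ} (hε : 0 ≤ ε)
    (h : secENorm P r (invarianceError Φ α F K) ≤ ENNReal.ofReal ε) :
    ‖transportMap hΦ α U (SeparationQuotient.mk K) (SeparationQuotient.mk F)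
      - SeparationQuotient.mk K‖ ≤ ε := by
  have h1 := F.aeSection_comp hU K hKU
  have h2 := (aeSection_coe K).pull α hΦ
  have h3 := h1.sub h2
  have h4 := shiftOp_toLInf hΦ α h2
  have e : toLInf P r (orbitShift Φ α 1 fun θ ω => K (θ + toTorus α) (Φ ω))
      = SeparationQuotient.mk K := by
    rw [← toLInf_coe K]
    congr 1
    funext θ ω
    rw [orbitShift_one_apply, sub_add_cancel, Φ.apply_symm_apply]
  rw [transportMap_mk hΦ α hU K hKU F, ← e, ← h4.2, ← map_sub, ← h3.2]
  refine ((shiftOp hΦ α (Eu n) r).le_of_opNorm_le (norm_shiftOp_le hΦ α) _).trans ?_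
  rw [one_mul]
  exact norm_toLInf_le hε (ae_crBound_of_secENorm_le (κ := invarianceError Φ α F K) hε
    ((ae_crBound_of_aeSection h3.1).mono fun ω h => h.smooth) h)

theorem opNorm_le_of_single {W : Type*} [NormedAddCommGroup W] [NormedSpace ℝ W]
    {A : Eu n →L[ℝ] W} {C : ℝ} (hC : 0 ≤ C)
    (h : ∀ i, ‖A (EuclideanSpace.single i 1)‖ ≤ C) : ‖A‖ ≤ n * C := by
  refine ContinuousLinearMap.opNorm_le_bound _ (by positivity) fun v => ?_
  conv_lhs => rw [sum_smul_single v, map_sum]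
  calc _ ≤ ∑ i : Fin n, ‖v‖ * C := by
        refine norm_sum_le_of_le _ fun i _ => ?_
        rw [map_smul, norm_smul]
        gcongr
        · exact PiLp.norm_apply_le v i
        · exact h i
    _ = _ := by simp; ring

/-- Invariant tori near a hyperbolic approximate solution are unique. -/
theorem ae_eq_of_isInvariantTorus (hΦ : MeasurePreserving Φ P P) {Ks : RSection P (Eu n) m r} {δ η R s c q : ℝ}
    (hKs : ∀ᵐ ω ∂P, ∀ θ, Metric.closedBall (Ks θ ω) δ ⊆ U) (hU : IsOpen U) (hη : 0 ≤ η) (hηδ : η ≤ δ)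
    {F G : RMap P m (sigmaSet r 1) U} (hR : 0 ≤ R)
    (hm : ∀ᵐ ω ∂P, MixedModulus (sigmaSet r 1) U η R fun z (x : Eu m) => F z (toTorus x) ω)
    (hGF : ‖G - F‖ ≤ s) {a : LInfC P (Eu n) m r →L[ℝ] LInfC P (Eu n) m r}
    (ha : IsTransferOp P r Φ α (transferMatrix F Ks) a)
    {𝒢 : ℤ → LInfC P (Eu n) m r →L[ℝ] LInfC P (Eu n) m r} (h𝒢 : IsGreenFamily a 𝒢 c)
    {N : ℕ} (hN0 : 0 < N) (hN : 4 * (n * (2 * c ^ 2)) ≤ N)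
    (hq : 2 * (N + 1) * (n * c * q) ≤ 1 / 4) (hRs : n * (s + R) ≤ q)
    {K K' : Torus m → Ω → Eu n} (hK : IsInvariantTorus P Φ α U G K)
    (hK' : IsInvariantTorus P Φ α U G K') (h : ∀ᵐ ω ∂P, ∀ θ, ‖K θ ω - Ks θ ω‖ ≤ η)
    (h' : ∀ᵐ ω ∂P, ∀ θ, ‖K' θ ω - Ks θ ω‖ ≤ η) : ∀ᵐ ω ∂P, ∀ θ, K θ ω = K' θ ω := by
  have hs0 : 0 ≤ s := (norm_nonneg _).trans hGF
  have hq0 : 0 ≤ q := le_trans (by positivity) hRs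
  -- The mean value inequality on the ball of radius `η` about `Ks` shows that the difference of two
  -- solutions follows the cocycle of `F` along `Ks` up to a relative error `q`: the share `s` comes
  -- from replacing `G` by `F`, the share `R` from moving the base point.
  have key := ha.ae_eq_zero_of_almost_invariant hΦ h𝒢 hN0 hN hq hq0
    (κ := fun θ ω => K θ ω - K' θ ω) (Q := η + η) ?_ ?_
  · exact key.mono fun ω h θ => sub_eq_zero.1 (h θ)
  · filter_upwards [h, h'] with ω h1 h2 θ
    rw [← sub_sub_sub_cancel_right _ _ (Ks θ ω)]
    exact (norm_sub_le _ _).trans (add_le_add (h1 θ) (h2 θ))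
  · filter_upwards [hKs, h, h', hK.2, hK'.2, hm, F.ae_mixedRegular, G.ae_mixedRegular,
      (G - F).ae_mixedRegular] with ω h0 h1 h2 h3 h4 h5 h6 h7 h8 θ
    obtain ⟨x, rfl⟩ := toTorus_surjective θ
    have hball : ∀ w ∈ Metric.closedBall (Ks (toTorus x) ω) η, w ∈ U := fun w hw =>
      h0 _ (Metric.closedBall_subset_closedBall hηδ hw)
    have hd : ∀ w ∈ Metric.closedBall (Ks (toTorus x) ω) η,
        ‖fderiv ℝ (fun z => G z (toTorus x) ω) w - transferMatrix F Ks (toTorus x) ω‖ ≤ q := by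
      intro w hw
      have hwU := hball w hw
      have hdF := h6.differentiableAt_z (s := 0) hwU x
      have hdG := h7.differentiableAt_z (s := 0) hwU x
      refine le_trans (opNorm_le_of_single (C := s + R) (by positivity) fun i => ?_) hRs
      have e1 := fderiv_fun_sub (𝕜 := ℝ) hdG hdF
      have k1 : ‖partialZ i (fun z (x : Eu m) => (G - F : RMap P m (sigmaSet r 1) U) z (toTorus x) ω)
          w x‖ ≤ s := ((h8.partialZ hU i).norm_le hwU x).trans hGF
      have hseg : segment ℝ w (Ks (toTorus x) ω) ⊆ U := fun z hz =>
        hball z ((convex_closedBall _ _).segment_subset hw (Metric.mem_closedBall_self hη) hz)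
      have k2 : ‖partialZ i (fun z (x : Eu m) => F z (toTorus x) ω) w x
          - partialZ i (fun z (x : Eu m) => F z (toTorus x) ω) (Ks (toTorus x) ω) x‖ ≤ R :=
        (h5.partialZ h6 i).norm_sub_le hseg (mem_closedBall_iff_norm.1 hw) x
      have k3 : partialZ i (fun z (x : Eu m) => (G - F : RMap P m (sigmaSet r 1) U) z (toTorus x) ω)
          w x = fderiv ℝ (fun z => G z (toTorus x) ω) w (EuclideanSpace.single i 1)
            - fderiv ℝ (fun z => F z (toTorus x) ω) w (EuclideanSpace.single i 1) :=
        DFunLike.congr_fun e1 _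
      rw [k3] at k1
      refine le_trans (le_of_eq ?_) ((norm_add_le _ _).trans (add_le_add k1 k2))
      rw [sub_apply]
      congr 1
      simp only [partialZ, derivZ, transferMatrix]
      abel
    have hmem : K (toTorus x) ω ∈ Metric.closedBall (Ks (toTorus x) ω) η :=
      mem_closedBall_iff_norm.2 (h1 _)
    have hmem' : K' (toTorus x) ω ∈ Metric.closedBall (Ks (toTorus x) ω) η :=
      mem_closedBall_iff_norm.2 (h2 _)
    have h9 := (convex_closedBall _ _).norm_image_sub_le_of_norm_hasFDerivWithin_le'
      (fun w hw => (h7.differentiableAt_z (s := 0)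
        (hball w hw) x).hasFDerivAt.hasFDerivWithinAt) hd hmem' hmem
    rw [← h3, ← h4]
    exact h9

end InvariantTori

end RandomTorus

/-! ### Choice of constants and proof of the main theorem -/

namespace RandomTorus

theorem isInvertible_fderiv_of_isLocalDiffeomorphOn {n : ℕ} {f : Eu n → Eu n} {U : Set (Eu n)}
    (h : IsLocalDiffeomorphOn (modelWithCornersSelf ℝ (Eu n)) (modelWithCornersSelf ℝ (Eu n)) 1 f U)
    {z : Eu n} (hz : z ∈ U) : (fderiv ℝ f z).IsInvertible := by
  refine ⟨(h ⟨z, hz⟩).mfderivToContinuousLinearEquiv one_ne_zero, ?_⟩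
  rw [← mfderiv_eq_fderiv]
  rfl

section Secondary

variable {Ω : Type*} [MeasurableSpace Ω] {P : Measure Ω} {n m r : ℕ}

theorem secENorm_sub_lt {K Ks : RSection P (Eu n) m r} {η : ℝ}
    (h : ‖(SeparationQuotient.mk K : LInfC P (Eu n) m r) - SeparationQuotient.mk Ks‖ < η) :
    secENorm P 0 (fun θ ω => K θ ω - Ks θ ω) < ENNReal.ofReal η := by
  have h1 : ‖K - Ks‖ < η := h
  refine lt_of_le_of_lt (secENorm_le_of_ae (C := ‖K - Ks‖) ?_)
    ((ENNReal.ofReal_lt_ofReal_iff ((norm_nonneg _).trans_lt h1)).2 h1)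
  exact (K - Ks).ae_crBound.mono fun ω h => h.of_le (Nat.zero_le r)

theorem ae_norm_sub_le_of_secENorm {K : RSection P (Eu n) m 0} {Ks : RSection P (Eu n) m r} {η : ℝ}
    (hη : 0 ≤ η) (h : secENorm P 0 (fun θ ω => K θ ω - Ks θ ω) < ENNReal.ofReal η) :
    ∀ᵐ ω ∂P, ∀ θ, ‖K θ ω - Ks θ ω‖ ≤ η := by
  have hs : ∀ᵐ ω ∂P, ContDiff ℝ (0 : ℕ) fun x : Eu m => K (toTorus x) ω - Ks (toTorus x) ω := by
    filter_upwards [K.2.smooth, Ks.2.smooth] with ω h1 h2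
    exact h1.sub (h2.of_le (by exact_mod_cast Nat.zero_le r))
  filter_upwards [ae_crBound_of_secENorm_le hη hs h.le] with ω h θ
  obtain ⟨x, rfl⟩ := toTorus_surjective θ
  exact h.norm_le x

end Secondary

end RandomTorus

theorem mainTheorem1 {Ω : Type*} [MeasurableSpace Ω] (P : Measure Ω) [IsProbabilityMeasure P]
    (Φ : Ω ≃ᵐ Ω) (hΦ : MeasurePreserving Φ P P)
    (d m r : ℕ) (α : Eu m) (U : Set (Eu (2 * d))) (hU : IsOpen U)
    (cH δ A B : ℝ) (hcH : 0 < cH) (hδ : 0 < δ)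
    (ρ : ℝ → ℝ) (hρ : Tendsto ρ (𝓝[>] 0) (𝓝 0)) :
    ∃ ε₀ > 0, ∃ C > 0, ∃ η > 0, ∀ ε : ℝ, 0 < ε → ε < ε₀ →
      ∀ F : RMap P m (sigmaSet r 1) U,
        ‖F‖ ≤ A → HasModulus P (sigmaSet r 1) U F ρ →
        (∀ᵐ ω ∂P, ∀ θ : Torus m, IsLocalDiffeomorphOn
          (modelWithCornersSelf ℝ (Eu (2 * d))) (modelWithCornersSelf ℝ (Eu (2 * d))) 1
          (fun z => F z θ ω) U) →
      ∀ Ks : RSection P (Eu (2 * d)) m r,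
        ‖Ks‖ ≤ B → (∀ᵐ ω ∂P, ∀ θ, Metric.closedBall (Ks θ ω) δ ⊆ U) →
        secENorm P r (invarianceError Φ α F Ks) < ENNReal.ofReal ε →
        (∀ y : ℂ, ‖y‖ = 1 → ResolventBound P Φ α r (transferMatrix F Ks) y cH) →
      ∃ Kε : RSection P (Eu (2 * d)) m r,
        -- (a) existence
        (IsInvariantTorus P Φ α U F Kε ∧ ‖Kε - Ks‖ ≤ C * ε) ∧
        -- (b) uniqueness
        (secENorm P 0 (fun θ ω => Kε θ ω - Ks θ ω) < ENNReal.ofReal η ∧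
          ∀ K : RSection P (Eu (2 * d)) m 0, IsInvariantTorus P Φ α U F K →
            secENorm P 0 (fun θ ω => K θ ω - Ks θ ω) < ENNReal.ofReal η →
            ∀ᵐ ω ∂P, ∀ θ, K θ ω = Kε θ ω) ∧
        -- (c) persistence
        (∃ s > 0, ∃ 𝒦 : LInfCSigma P m (sigmaSet r 1) U → LInfC P (Eu (2 * d)) m r,
          𝒦 (SeparationQuotient.mk F) = SeparationQuotient.mk Kε ∧
          ContDiffOn ℝ 1 𝒦 (Metric.ball (SeparationQuotient.mk F) s) ∧
          ∀ G : RMap P m (sigmaSet r 1) U, ‖G - F‖ < s →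
            ∀ KG : RSection P (Eu (2 * d)) m r,
              SeparationQuotient.mk KG = 𝒦 (SeparationQuotient.mk G) →
              IsInvariantTorus P Φ α U G KG ∧
              secENorm P 0 (fun θ ω => KG θ ω - Ks θ ω) < ENNReal.ofReal η ∧
              ∀ K : RSection P (Eu (2 * d)) m 0, IsInvariantTorus P Φ α U G K →
                secENorm P 0 (fun θ ω => K θ ω - Ks θ ω) < ENNReal.ofReal η →
                ∀ᵐ ω ∂P, ∀ θ, K θ ω = KG θ ω) ∧
        -- (d) normal hyperbolicity
        IsNormallyHyperbolicTorus P Φ α r U F Kε := by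
  -- All sections in the fixed point argument lie within `δ` of `Ks`. Absolute values are taken
  -- because `A` and `B` are arbitrary real numbers.
  obtain ⟨c, hc⟩ := exists_compBounds hU m r (|B| + δ)
  have hc0 : 0 < c := zero_lt_one.trans_le hc.one_le
  set D : ℝ := ∑ i : Fin (2 * d), ‖partialMulOp hΦ α (P := P) r i‖ with hD
  have hD0 : 0 ≤ D := Finset.sum_nonneg fun i _ => (partialMulOp hΦ α r i).opNorm_nonneg
  -- The number of steps after which the boundary terms are small, for a Green family with bound `2
  -- * cH`; then `q` is the relative error tolerated over that many steps.
  obtain ⟨N, hN⟩ := exists_nat_ge (max 1 (4 * (((2 * d : ℕ) : ℝ) * (2 * (2 * cH) ^ 2))))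
  have hN1 : 4 * (((2 * d : ℕ) : ℝ) * (2 * (2 * cH) ^ 2)) ≤ N := (le_max_right _ _).trans hN
  have hN0 : 0 < N := by
    have : (1 : ℝ) ≤ N := (le_max_left _ _).trans hN
    exact_mod_cast this
  obtain ⟨q, hq0, hq⟩ : ∃ q > 0, 2 * ((N : ℝ) + 1) * (((2 * d : ℕ) : ℝ) * (2 * cH) * q) ≤ 1 / 4 := by
    refine ⟨(8 * ((N : ℝ) + 1) * (((2 * d : ℕ) : ℝ) * (2 * cH) + 1))⁻¹, by positivity, ?_⟩
    calc _ ≤ 2 * ((N : ℝ) + 1) * ((((2 * d : ℕ) : ℝ) * (2 * cH) + 1)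
          * (8 * ((N : ℝ) + 1) * (((2 * d : ℕ) : ℝ) * (2 * cH) + 1))⁻¹) := by
          gcongr
          linarith
      _ = 1 / 4 := by field_simp; norm_num
  -- For uniqueness, `s₀` and `R` share the tolerance `q`. The bound `w`, which `R` and `|A| * η`
  -- both respect, keeps the derivative within `(4 * cH)⁻¹` of its value at `Ks`.
  set s₀ : ℝ := q / (2 * (((2 * d : ℕ) : ℝ) + 1)) with hs₀
  have hs₀0 : 0 < s₀ := by positivity
  set w : ℝ := (8 * cH * (D + 1) * c)⁻¹ with hw
  have hw0 : 0 < w := by positivity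
  set R : ℝ := min s₀ w with hR
  have hR0 : 0 < R := lt_min hs₀0 hw0
  obtain ⟨τ, hτ0, hτ⟩ := exists_modulus_le hρ hR0
  set η : ℝ := min τ (min δ (w / (|A| + 1))) with hηdef
  have hη0 : 0 < η := by positivity
  have hητ : η ≤ τ := min_le_left _ _
  have hηδ : η ≤ δ := (min_le_right _ _).trans (min_le_left _ _)
  have hηw : |A| * η ≤ w := by
    calc |A| * η ≤ (|A| + 1) * (w / (|A| + 1)) := by
          gcongr
          · linarith
          · exact (min_le_right _ _).trans (min_le_right _ _)
      _ = w := by field_simp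
  have hRs : ((2 * d : ℕ) : ℝ) * (s₀ + R) ≤ q := by
    calc _ ≤ (((2 * d : ℕ) : ℝ) + 1) * (s₀ + s₀) := by
          gcongr
          · linarith
          · exact min_le_left _ _
      _ = q := by rw [hs₀]; field_simp; ring
  have hdev : D * (c * (R + |A| * η)) ≤ (4 * cH)⁻¹ := by
    calc _ ≤ (D + 1) * (c * (w + w)) := by
          gcongr
          · linarith
          · exact min_le_right _ _
      _ = (4 * cH)⁻¹ := by rw [hw]; field_simp; ring
  -- The condition on `ε` is `2 * cH * ε < η`: the solution provided by the fixed point theorem is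
  -- then closer than `η` to `Ks`.
  refine ⟨η / (2 * cH), by positivity, 2 * cH, by positivity, η, hη0, ?_⟩
  intro ε hε hεη F hFA hFρ hFdiff Ks hKsB hKs hKsε hres
  have hετ : 2 * cH * ε < η := by rwa [lt_div_iff₀' (by positivity)] at hεη
  have hFA' : ‖F‖ ≤ |A| := hFA.trans (le_abs_self A)
  have hFm : ∀ᵐ ω ∂P, MixedModulus (sigmaSet r 1) U η R fun z (x : Eu m) => F z (toTorus x) ω :=
    HasModulus.ae_mixedModulus hFρ hR0.le fun t h1 h2 => hτ t h1 (h2.trans hητ)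
  have hKsU : ∀ᵐ ω ∂P, ∀ θ, Ks θ ω ∈ U :=
    hKs.mono fun ω h θ => h θ (Metric.mem_closedBall_self hδ.le)
  set k₀ : LInfC P (Eu (2 * d)) m r := SeparationQuotient.mk Ks with hk₀
  have hk₀B : ‖k₀‖ ≤ |B| := hKsB.trans (le_abs_self B)
  have hkB : ∀ k ∈ Metric.ball k₀ δ, ‖k‖ ≤ |B| + δ := fun k hk => by
    have h1 := norm_sub_norm_le k k₀
    have h2 := mem_ball_iff_norm.1 hk
    linarith
  have hseg : ∀ k ∈ Metric.ball k₀ δ, ∀ k' ∈ Metric.ball k₀ δ, ∀ᵐ ω ∂P, ∀ θ,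
      segment ℝ (LInfC.rep k' θ ω) (LInfC.rep k θ ω) ⊆ U := fun k hk k' hk' =>
    ae_segment_subset hKs (mem_ball_iff_norm.1 hk).le (mem_ball_iff_norm.1 hk').le
  have hkU : ∀ k ∈ Metric.ball k₀ δ, ∀ᵐ ω ∂P, ∀ θ, LInfC.rep k θ ω ∈ U := fun k hk =>
    (hseg k hk k hk).mono fun ω h θ => h θ (left_mem_segment ℝ _ _)
  have hk₀mem : k₀ ∈ Metric.ball k₀ δ := Metric.mem_ball_self hδ
  have hmF : ∀ k ∈ Metric.ball k₀ η, ‖transportDeriv hΦ α U k (SeparationQuotient.mk F)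
      - transportDeriv hΦ α U k₀ (SeparationQuotient.mk F)‖ ≤ (4 * cH)⁻¹ := fun k hk => by
    have hk' := Metric.ball_subset_ball hηδ hk
    exact (norm_transportDeriv_sub_le hΦ α hU hc (hkB _ hk₀mem) (hkB _ hk')
      (hseg _ hk₀mem _ hk') hFA' hFm (mem_ball_iff_norm.1 hk).le hR0.le).trans hdev
  have ha := isTransferOp_transportDeriv hΦ α hU Ks hKsU F
  obtain ⟨L, hL, hL', hLc⟩ := ha.exists_inverse_sub_one (hres 1 (by simp))
  obtain ⟨s₁, hs₁, 𝒦, h𝒦, h𝒦G, h𝒦F⟩ := exists_contDiffOn_fixedPoint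
    (e := transportMap hΦ α U) (m := transportDeriv hΦ α U) (k₀ := k₀)
    (F := SeparationQuotient.mk F) (δ := δ) (τ := η) (ε := ε) (c := cH) (C₁ := c + D * c)
    hcH (by positivity) hηδ hε.le hετ (fun k hk G => hasFDerivAt_transportMap hΦ α hU hKs hk G)
    ((norm_transportMap_le hΦ α hU hc (hkB _ hk₀mem) (hkU _ hk₀mem)).trans
      (by have := mul_nonneg hD0 hc0.le; linarith))
    (fun k hk => (norm_transportDeriv_le hΦ α hU hc (hkB _ hk) (hkU _ hk)).trans
      (by linarith)) (fun G => continuousOn_transportDeriv hΦ α hU hKs G) hmF hL hL' hLc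
    (norm_transportMap_sub_le hΦ α hU hKsU hε.le hKsε.le)
  have hsol : ∀ G : RMap P m (sigmaSet r 1) U,
      SeparationQuotient.mk G ∈ Metric.ball (SeparationQuotient.mk F : LInfCSigma P m _ U) s₁ →
      ∀ KG : RSection P (Eu (2 * d)) m r,
        SeparationQuotient.mk KG = 𝒦 (SeparationQuotient.mk G) →
        IsInvariantTorus P Φ α U G KG ∧
          secENorm P 0 (fun θ ω => KG θ ω - Ks θ ω) < ENNReal.ofReal η ∧
          ∀ᵐ ω ∂P, ∀ θ, ‖KG θ ω - Ks θ ω‖ ≤ η := by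
    intro G hG KG hKG
    obtain ⟨h1, h2⟩ := h𝒦G _ hG
    rw [← hKG] at h1 h2
    have hKGU : ∀ᵐ ω ∂P, ∀ θ, KG θ ω ∈ U := by
      filter_upwards [hkU _ (Metric.ball_subset_ball hηδ h1), LInfC.ae_rep_mk KG] with ω h3 h4 θ
      rw [← h4]
      exact h3 θ
    refine ⟨isInvariantTorus_of_fixedPoint hΦ α hU hKGU h2,
      secENorm_sub_lt (mem_ball_iff_norm.1 h1), ?_⟩
    filter_upwards [(KG - Ks).ae_norm_le] with ω h θ
    exact (h θ).trans (mem_ball_iff_norm.1 h1).le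
  -- Uniqueness uses the Green family along `Ks` itself, for every nearby `G`, so the unperturbed
  -- case suffices.
  obtain ⟨𝒢, h𝒢⟩ := ha.exists_greenFamily hcH hres ha (by rw [sub_self, norm_zero]; positivity)
  have huniq : ∀ G : RMap P m (sigmaSet r 1) U, ‖G - F‖ ≤ s₀ →
      ∀ KG : Torus m → Ω → Eu (2 * d), IsInvariantTorus P Φ α U G KG →
      (∀ᵐ ω ∂P, ∀ θ, ‖KG θ ω - Ks θ ω‖ ≤ η) →
      ∀ K : RSection P (Eu (2 * d)) m 0, IsInvariantTorus P Φ α U G K →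
        secENorm P 0 (fun θ ω => K θ ω - Ks θ ω) < ENNReal.ofReal η →
        ∀ᵐ ω ∂P, ∀ θ, K θ ω = KG θ ω := by
    intro G hG KG hKG hKGη K hK hKη
    exact ae_eq_of_isInvariantTorus α hΦ hKs hU hη0.le hηδ hR0.le hFm hG ha h𝒢 hN0 hN1 hq hRs hK hKG
      (ae_norm_sub_le_of_secENorm hη0.le hKη) hKGη
  have hFmem : (SeparationQuotient.mk F : LInfCSigma P m _ U)
      ∈ Metric.ball (SeparationQuotient.mk F) s₁ := Metric.mem_ball_self hs₁
  -- A random set must be closed for every `ω`, hence a representative continuous without exception.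
  obtain ⟨Kε, hKε, hKεc⟩ := (𝒦 (SeparationQuotient.mk F)).exists_continuous_rep
  obtain ⟨hinv, hnear, hle⟩ := hsol F hFmem Kε hKε
  refine ⟨Kε, ⟨hinv, ?_⟩, ⟨hnear, huniq F (by simpa using hs₀0.le) Kε hinv hle⟩,
    -- The radius `s₁` ensures existence and `s₀` uniqueness.
    ⟨min s₁ s₀, lt_min hs₁ hs₀0, 𝒦, hKε.symm,
      h𝒦.mono (Metric.ball_subset_ball (min_le_left _ _)), fun G hG KG hKG => ?_⟩,
    (isRandomSet_torusSet hKεc).1, (isRandomSet_torusSet hKεc).2, hinv, ?_⟩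
  · rw [← hKε] at h𝒦F
    exact h𝒦F
  · have hGmem : (SeparationQuotient.mk G : LInfCSigma P m _ U)
        ∈ Metric.ball (SeparationQuotient.mk F) s₁ :=
      mem_ball_iff_norm.2 (hG.trans_le (min_le_left _ _))
    obtain ⟨h1, h2, h3⟩ := hsol G hGmem KG hKG
    exact ⟨h1, h2, huniq G (hG.le.trans (min_le_right _ _)) KG h1 h3⟩
  -- The transfer operator along `Kε` is within `(4 * cH)⁻¹` of the one along `Ks`, so it still has
  -- a Green family.
  · have hb := isTransferOp_transportDeriv hΦ α hU Kε hinv.1 F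
    have hball := (h𝒦G _ hFmem).1
    rw [← hKε] at hball
    obtain ⟨𝒢', h𝒢'⟩ := ha.exists_greenFamily hcH hres hb (hmF _ hball)
    refine hb.isNormallyHyperbolic hΦ h𝒢' ?_
    filter_upwards [hFdiff, hinv.1] with ω h1 h2 θ
    exact isInvertible_fderiv_of_isLocalDiffeomorphOn (h1 θ) (h2 θ)
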